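/- Let $(\mathcal W,\mathcal S)$ be a Coxeter system with $\mathcal S$ finite, with length function $l$, Bruhat order $\le$ and set of reflections $\mathcal T$. Let $V$ be its real geometric representation, and for $t\in\mathcal T$ let $\mathbb R\alpha_t\subset V$ be the line on which $t$ acts by $-1$. Let $S=\mathrm{Sym}(V)$, graded with $V$ in degree $2$. All modules are $\mathbb Z$-graded, $M\{a\}_k=M_{a+k}$, and $M_{\le k}$ denotes the submodule generated by the homogeneous elements of degree $\le k$. For $x\in\mathcal W$ let $\mathscr B(x)$ be the Braden–MacPherson sheaf on the Bruhat graph. It has the following description: $\mathscr B(x)^y=0$ for $y\not\le x$; $\mathscr B(x)^x=S$; for an edge $E\colon y\to ty$ with $t\in\mathcal T$, $y<ty$, one has $\mathscr B(x)^E=\mathscr B(x)^{ty}/\alpha_t\mathscr B(x)^{ty}$; and for $y<x$ the stalk $\mathscr B(x)^y$, with maps $\rho_{y,E}$, is a projective cover, in the category of graded $S$-modules, of the image $\mathscr B(x)^{\delta y}$ of the sections of $\mathscr B(x)$ on $\{w>y\}$ in $\bigoplus_E\mathscr B(x)^E$, where $E$ runs over the edges originating at $y$. Let $\mathscr B(x)^{[y]}\subset\mathscr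 B(x)^y$ be the kernel of $\bigoplus_E\rho_{y,E}$. Choose a line in $V^*$ that is not contained in any reflection hyperplane. Restriction of polynomial functions to it is a map of graded algebras $S\to\mathbb R[T]$, with $T$ in degree $2$. Put $M_T=M\otimes_S\mathbb R[T]$. Let $y<x$ and $c\in\{0,1\}$. Assume that the graded $\mathbb R[T]$-module $\mathscr B(x)^{\delta y}_T$ is isomorphic to a direct sum of modules of the form $(\mathbb R[T]/T^{n+1})\{-(l(x)-l(y))+n+c\}$ with $n\ge 0$. Then for all $m\ge 1$ $$\mathscr B(x)^{[y]}_{\le l(x)-l(y)+m-1}\cap\mathscr B(x)^y_{\le l(x)-l(y)-m}=0 .$$ -/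

import Mathlib

open scoped TensorProduct DirectSum

noncomputable section

universe u v

/-! ### Graded modules -/

/-- A `ℤ`-graded module over a commutative ring `R` that carries a grading `𝒜`. -/
structure GrMod (R : Type u) [CommRing R] (𝒜 : ℤ → AddSubgroup R) : Type (u + 1) where
  carrier : Type u
  [addCommGroup : AddCommGroup carrier]
  [module : Module R carrier]
  /-- the homogeneous part of degree `k` -/
  gr : ℤ → AddSubgroup carrier
  isInternal : DirectSum.IsInternal gr
  smul_mem : ∀ {i j : ℤ} {a : R} {m : carrier}, a ∈ 𝒜 i → m ∈ gr j → a • m ∈ gr (i + j)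

attribute [instance] GrMod.addCommGroup GrMod.module

instance (R : Type u) [CommRing R] (𝒜 : ℤ → AddSubgroup R) :
    CoeSort (GrMod R 𝒜) (Type u) := ⟨GrMod.carrier⟩

section Graded

variable {R : Type*} [CommRing R] {M N : Type*} [AddCommGroup M] [Module R M]
  [AddCommGroup N] [Module R N]

/-- The linear map `f` has degree `0` with respect to the given gradings. -/
def IsDegZero (ℳ : ℤ → AddSubgroup M) (𝒩 : ℤ → AddSubgroup N) (f : M →ₗ[R] N) : Prop :=
  ∀ k : ℤ, ∀ v ∈ ℳ k, f v ∈ 𝒩 k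

/-- The linear equivalence `e` identifies the two gradings, i.e. it is an isomorphism of graded
modules. -/
def IsGradedIso (ℳ : ℤ → AddSubgroup M) (𝒩 : ℤ → AddSubgroup N) (e : M ≃ₗ[R] N) : Prop :=
  ∀ k : ℤ, ∀ v : M, v ∈ ℳ k ↔ e v ∈ 𝒩 k

/-- The grading of the shifted module `M{a}`, i.e. `M{a}_k = M_{a + k}`. -/
def shiftGr (ℳ : ℤ → AddSubgroup M) (a : ℤ) : ℤ → AddSubgroup M :=
  fun k => ℳ (a + k)

/-- The induced grading of a (homogeneous) submodule. -/
def subGr (ℳ : ℤ → AddSubgroup M) (Q : Submodule R M) : ℤ → AddSubgroup Q :=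
  fun k => (ℳ k).comap Q.subtype.toAddMonoidHom

/-- The induced grading of the quotient by a (homogeneous) submodule. -/
def quotGr (ℳ : ℤ → AddSubgroup M) (K : Submodule R M) : ℤ → AddSubgroup (M ⧸ K) :=
  fun k => (ℳ k).map K.mkQ.toAddMonoidHom

/-- The componentwise grading on families. -/
def piGr {ι : Type*} {P : ι → Type*} [∀ i, AddCommGroup (P i)]
    (𝒢 : ∀ i, ℤ → AddSubgroup (P i)) : ℤ → AddSubgroup (∀ i, P i) :=
  fun k => AddSubgroup.pi Set.univ fun i => 𝒢 i k

/-- The componentwise grading on a direct sum. -/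
def directSumGr {ι : Type*} {P : ι → Type*} [∀ i, AddCommGroup (P i)]
    (𝒢 : ∀ i, ℤ → AddSubgroup (P i)) : ℤ → AddSubgroup (⨁ i, P i) :=
  fun k => ⨅ i, (𝒢 i k).comap (DFinsupp.evalAddMonoidHom i : (⨁ i, P i) →+ P i)

/-- The submodule `M_{≤ k} = ∑_{j ≤ k} R · M_j` generated in degrees `≤ k`. -/
def generatedLE (R : Type*) [CommRing R] [Module R M] (ℳ : ℤ → AddSubgroup M) (k : ℤ) :
    Submodule R M :=
  Submodule.span R {v | ∃ j ≤ k, v ∈ ℳ j}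

/-- A submodule is homogeneous if it is generated by homogeneous elements. -/
def IsHomogeneousSubmodule (ℳ : ℤ → AddSubgroup M) (K : Submodule R M) : Prop :=
  Submodule.span R {v | v ∈ K ∧ ∃ k, v ∈ ℳ k} = K

end Graded

section Cover

variable {R : Type u} [CommRing R] {𝒜 : ℤ → AddSubgroup R}

/-- `P` is a projective object of the category of graded modules (with morphisms of degree `0`). -/
def GrMod.IsProjective (P : GrMod R 𝒜) : Prop :=
  ∀ (A C : GrMod R 𝒜) (p : A →ₗ[R] C) (f : P →ₗ[R] C), IsDegZero A.gr C.gr p →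
    Function.Surjective p → IsDegZero P.gr C.gr f →
      ∃ g : P →ₗ[R] A, IsDegZero P.gr A.gr g ∧ p ∘ₗ g = f

/-- The map `π : P → M` with values in the graded module `M` is a projective cover, in the category
of graded modules, of the submodule `Q` of `M`: the graded module `P` is projective, `π` has degree
`0` and image `Q`, and no proper graded submodule of `P` surjects onto `Q`. -/
structure IsProjectiveCover (P : GrMod R 𝒜) {M : Type*} [AddCommGroup M] [Module R M]
    (ℳ : ℤ → AddSubgroup M) (Q : Submodule R M) (π : P →ₗ[R] M) : Prop where
  isProjective : P.IsProjective
  isDegZero : IsDegZero P.gr ℳ π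
  range_eq : LinearMap.range π = Q
  essential : ∀ K : Submodule R P, IsHomogeneousSubmodule P.gr K → K.map π = Q → K = ⊤

end Cover

/-! ### The geometric representation and the Bruhat graph -/

namespace CoxeterSystem

variable {B : Type u} {W : Type v} [Group W] {M : CoxeterMatrix B}

/-- The linear form `2 B(α_i, ·)` on `V = ⨁ ℝ α_j`, where `B(α_i, α_j) = -cos (π / m_ij)`.  The
value `m_ij = 0` encodes `m_ij = ∞`, and then `B(α_i, α_j) = -cos 0 = -1`. -/
def simpleCoroot (M : CoxeterMatrix B) (i : B) : Module.Dual ℝ (B →₀ ℝ) :=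
  (2 : ℝ) • Finsupp.linearCombination ℝ fun j => -Real.cos (Real.pi / M i j)

lemma simpleCoroot_single (M : CoxeterMatrix B) (i j : B) :
    simpleCoroot M i (Finsupp.single j 1) = -2 * Real.cos (Real.pi / M i j) := by
  simp [simpleCoroot]

lemma simpleCoroot_self (M : CoxeterMatrix B) (i : B) :
    simpleCoroot M i (Finsupp.single i 1) = 2 := by
  simp [simpleCoroot_single]

/-- The simple reflection `v ↦ v - 2 B(α_i, v) α_i`. -/
def simpleRefl (M : CoxeterMatrix B) (i : B) : (B →₀ ℝ) ≃ₗ[ℝ] (B →₀ ℝ) :=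
  Module.reflection (simpleCoroot_self M i)

lemma simpleRefl_isLiftable (M : CoxeterMatrix B) : M.IsLiftable (simpleRefl M) := by
  intro i j
  by_cases hij : i = j
  · subst hij
    have : simpleRefl M i * simpleRefl M i = 1 := by
      ext1 v
      exact Module.involutive_reflection (simpleCoroot_self M i) v
    rw [this, one_pow]
  have h1 : M i j ≠ 1 := M.off_diagonal i j hij
  rcases Nat.eq_zero_or_pos (M i j) with h0 | hpos
  · rw [h0, pow_zero]
  have hsymm : M j i = M i j := M.symmetric j i
  set m := M i j with hm
  apply LinearEquiv.toLinearMap_injective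
  have key := Module.reflection_mul_reflection_pow (simpleCoroot_self M i)
    (simpleCoroot_self M j) m
  simp only [simpleCoroot_single, hsymm, ← hm] at key
  have ht : -2 * Real.cos (Real.pi / m) * (-2 * Real.cos (Real.pi / m)) - 2
      = 2 * Real.cos (2 * Real.pi / m) := by
    rw [mul_div_assoc, Real.cos_two_mul]; ring
  rw [ht] at key
  change ((Module.reflection (simpleCoroot_self M i) *
    Module.reflection (simpleCoroot_self M j)) ^ m).toLinearMap = _
  rw [key]
  rcases Nat.lt_or_ge m 3 with h3 | h3
  · have h2 : m = 2 := by omega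
    rw [h2]
    ext v
    norm_num [Polynomial.Chebyshev.S_one, mul_div_assoc]
    try ring
  · have hs : Real.sin (2 * Real.pi / m) ≠ 0 := by
      apply ne_of_gt
      apply Real.sin_pos_of_pos_of_lt_pi
      · positivity
      · rw [div_lt_iff₀ (by positivity)]
        have : (3 : ℝ) ≤ m := by exact_mod_cast h3
        nlinarith [Real.pi_pos]
    have hS := Polynomial.Chebyshev.S_two_mul_real_cos (2 * Real.pi / m)
    have hm0 : (m : ℝ) ≠ 0 := by positivity
    have hS0 : ∀ p : ℤ, (m : ℤ) = 2 * p → (Polynomial.Chebyshev.S ℝ (p - 1)).eval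
        (2 * Real.cos (2 * Real.pi / m)) = 0 := by
      intro p hp
      have h := hS (p - 1)
      have hp' : (m : ℝ) = 2 * p := by exact_mod_cast hp
      have : ((p - 1 : ℤ) + 1 : ℝ) * (2 * Real.pi / m) = Real.pi := by
        push_cast; field_simp; rw [hp']; ring
      rw [this, Real.sin_pi] at h
      exact (mul_eq_zero.mp h).resolve_right hs
    have hS1 : ∀ p : ℤ, (m : ℤ) = 2 * p + 1 → (Polynomial.Chebyshev.S ℝ p).eval
        (2 * Real.cos (2 * Real.pi / m)) + (Polynomial.Chebyshev.S ℝ (p - 1)).eval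
        (2 * Real.cos (2 * Real.pi / m)) = 0 := by
      intro p hp
      have h := hS (p - 1)
      have h' := hS p
      have hp' : (m : ℝ) = 2 * p + 1 := by exact_mod_cast hp
      have e : ((p - 1 : ℤ) + 1 : ℝ) * (2 * Real.pi / m) = Real.pi - Real.pi / m := by
        push_cast; field_simp; rw [hp']; ring
      have e' : ((p : ℤ) + 1 : ℝ) * (2 * Real.pi / m) = Real.pi / m + Real.pi := by
        field_simp; rw [hp']; ring
      rw [e, Real.sin_pi_sub] at h
      rw [e', Real.sin_add_pi] at h'
      refine (mul_eq_zero.mp ?_).resolve_right hs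
      rw [add_mul, h, h']; ring
    rcases Nat.even_or_odd' m with ⟨p, hp | hp⟩
    · have hp' : (m : ℤ) = 2 * p := by exact_mod_cast hp
      have i1 : ((m : ℤ) - 1) / 2 = p - 1 := by omega
      have i2 : ((m : ℤ) - 2) / 2 = p - 1 := by omega
      rw [i1, i2, hS0 p hp']
      ext v
      simp
    · have hp' : (m : ℤ) = 2 * p + 1 := by exact_mod_cast hp
      have i1 : ((m : ℤ) - 1) / 2 = p := by omega
      have i2 : ((m : ℤ) - 2) / 2 = p - 1 := by omega
      have i3 : ((m : ℤ) - 3) / 2 = p - 1 := by omega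
      have i4 : (m : ℤ) / 2 = p := by omega
      rw [i1, i2, i3, i4, hS1 p hp']
      ext v
      simp

/-- The geometric representation of a Coxeter group, on the real vector space `V` with basis the
simple roots `α_i`. -/
def geomRep (cs : CoxeterSystem M W) : Representation ℝ W (B →₀ ℝ) :=
  (LinearEquiv.automorphismGroup.toLinearMapMonoidHom).comp
    (cs.lift ⟨simpleRefl M, simpleRefl_isLiftable M⟩)

/-- A covering step of the Bruhat graph: `b = t a` for a reflection `t`, and `b` is longer. -/
def BruhatStep (cs : CoxeterSystem M W) (a b : W) : Prop :=
  ∃ t, cs.IsReflection t ∧ b = t * a ∧ cs.length a < cs.length b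

/-- The Bruhat order. -/
def BruhatLE (cs : CoxeterSystem M W) : W → W → Prop := Relation.ReflTransGen cs.BruhatStep

/-- The strict Bruhat order. -/
def BruhatLT (cs : CoxeterSystem M W) (a b : W) : Prop := cs.BruhatLE a b ∧ a ≠ b

/-- The edges `E : y → t y` of the Bruhat graph that originate at `y`; here `t` runs over the
reflections with `y < t y`. -/
def UpEdge (cs : CoxeterSystem M W) (y : W) : Type v :=
  {t : W // cs.IsReflection t ∧ cs.BruhatLT y (t * y)}

/-- The end point `t y` of the edge `E : y → t y`. -/
def UpEdge.target {cs : CoxeterSystem M W} {y : W} (E : cs.UpEdge y) : W := E.1 * y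


/-! ### The symmetric algebra -/

/-- The algebra `S` of polynomial functions on `V*`, i.e. the symmetric algebra of `V = ⨁ ℝ α_i`:
the polynomial ring with one variable for each simple root. -/
abbrev PolyV (B : Type u) : Type u := MvPolynomial B ℝ

/-- The inclusion of `V` into `S`. -/
def linearForm (B : Type u) : (B →₀ ℝ) →ₗ[ℝ] PolyV B :=
  Finsupp.linearCombination ℝ MvPolynomial.X

/-- The grading of `S` with `V` in degree `2`. -/
def symGr (B : Type u) (k : ℤ) : AddSubgroup (PolyV B) :=
  (MvPolynomial.weightedHomogeneousSubmodule ℝ (fun _ : B => (2 : ℤ)) k).toAddSubgroup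

/-- `ℤ`-graded `S`-modules. -/
abbrev GrSMod (B : Type u) : Type (u + 1) := GrMod (PolyV B) (symGr B)

/-- The ideal of `S` generated by the label of an edge given by the reflection `t`, that is, by the
line `ℝ α_t = {v ∈ V | t v = -v}`. -/
def labelIdeal (cs : CoxeterSystem M W) (t : W) : Ideal (PolyV B) :=
  Ideal.span {a | ∃ v : B →₀ ℝ, cs.geomRep t v = -v ∧ a = linearForm B v}

/-- The submodule `α_t P` of an `S`-module `P`. -/
def labelSMul (cs : CoxeterSystem M W) (t : W) (P : Type u) [AddCommGroup P] [Module (PolyV B) P] :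
    Submodule (PolyV B) P :=
  cs.labelIdeal t • ⊤

/-! ### Sheaves on the Bruhat graph -/

/-- The data of a sheaf on the Bruhat graph in which, for every edge `E : y → t y`, the module on
`E` is the quotient `ℱ^{ty} / α_t ℱ^{ty}` of the stalk at its end point, and the restriction map
from that stalk is the quotient map. Such a sheaf is given by its stalks and by the restriction
maps `ρ_{y,E}` for the edges `E` that originate at `y`. -/
structure BruhatSheaf (cs : CoxeterSystem M W) where
  stalk : W → GrSMod B
  ρ : ∀ (y : W) (E : cs.UpEdge y),
    stalk y →ₗ[PolyV B] (stalk E.target ⧸ cs.labelSMul E.1 (stalk E.target))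

namespace BruhatSheaf

variable {cs : CoxeterSystem M W} (ℱ : cs.BruhatSheaf)

/-- The module `ℱ^E` on an edge `E : y → t y`. -/
abbrev edge {y : W} (E : cs.UpEdge y) : Type u :=
  ℱ.stalk E.target ⧸ cs.labelSMul E.1 (ℱ.stalk E.target)

/-- The restriction map from the end point of an edge: the quotient map. -/
def toEdge {y : W} (E : cs.UpEdge y) : ℱ.stalk E.target →ₗ[PolyV B] ℱ.edge E :=
  (cs.labelSMul E.1 (ℱ.stalk E.target)).mkQ

/-- The grading of `ℱ^E`. -/
def edgeGr {y : W} (E : cs.UpEdge y) : ℤ → AddSubgroup (ℱ.edge E) :=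
  quotGr (ℱ.stalk E.target).gr _

/-- The sections of `ℱ` on the full subgraph with set of vertices `I`. -/
def sections (I : Set W) : Submodule (PolyV B) (∀ w : I, ℱ.stalk w) where
  carrier := {m | ∀ (w : W) (hw : w ∈ I) (E : cs.UpEdge w) (hE : E.target ∈ I),
    ℱ.ρ w E (m ⟨w, hw⟩) = ℱ.toEdge E (m ⟨E.target, hE⟩)}
  add_mem' := by
    intro m n hm hn w hw E hE
    simp only [Pi.add_apply, map_add, hm w hw E hE, hn w hw E hE]
  zero_mem' := by
    intro w hw E hE
    simp only [Pi.zero_apply, map_zero]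
  smul_mem' := by
    intro a m hm w hw E hE
    simp only [Pi.smul_apply, map_smul, hm w hw E hE]

/-- The map from families on `{> y}` to the modules on the edges that originate at `y`. -/
def restrictToEdges (y : W) : (∀ w : {w | cs.BruhatLT y w}, ℱ.stalk w) →ₗ[PolyV B]
    ∀ E : cs.UpEdge y, ℱ.edge E :=
  LinearMap.pi fun E => ℱ.toEdge E ∘ₗ
    LinearMap.proj (φ := fun w : {w | cs.BruhatLT y w} => (ℱ.stalk w : Type u)) ⟨E.target, E.2.2⟩

/-- The grading on families indexed by the edges that originate at `y`. -/
def edgesGr (y : W) : ℤ → AddSubgroup (∀ E : cs.UpEdge y, ℱ.edge E) :=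
  piGr fun E => ℱ.edgeGr E

/-- The module `ℱ^{δy}`, i.e. the image of the sections on `{> y}` in the modules on the edges that
originate at `y`. (When only finitely many stalks are non-zero, the product over these edges is the
same as the direct sum.) -/
def boundary (y : W) : Submodule (PolyV B) (∀ E : cs.UpEdge y, ℱ.edge E) :=
  (ℱ.sections {w | cs.BruhatLT y w}).map (ℱ.restrictToEdges y)

/-- The map `⨁ ρ_{y,E}` on the stalk at `y`, over the edges `E` that originate at `y`. -/
def upRestriction (y : W) : ℱ.stalk y →ₗ[PolyV B] ∀ E : cs.UpEdge y, ℱ.edge E :=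
  LinearMap.pi (ℱ.ρ y)

/-- The module `ℱ^{[y]}`, i.e. the kernel of `⨁ ρ_{y,E}`. -/
def costalk (y : W) : Submodule (PolyV B) (ℱ.stalk y) :=
  LinearMap.ker (ℱ.upRestriction y)

/-- `ℱ` arises from the Braden–MacPherson construction of `ℬ(x)`: the stalk at `x` is `S`, the
stalk at `y` vanishes if `y ≰ x`, and for `y < x` the stalk at `y` together with the maps `ρ_{y,E}`
is a projective cover of `ℬ(x)^{δy}` in the category of graded `S`-modules. -/
structure IsBradenMacPherson (x : W) : Prop where
  top : ∃ e : ℱ.stalk x ≃ₗ[PolyV B] PolyV B, IsGradedIso (ℱ.stalk x).gr (symGr B) e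
  eq_zero : ∀ y, ¬ cs.BruhatLE y x → Subsingleton (ℱ.stalk y)
  cover : ∀ y, cs.BruhatLT y x →
    IsProjectiveCover (ℱ.stalk y) (ℱ.edgesGr y) (ℱ.boundary y) (ℱ.upRestriction y)

end BruhatSheaf

/-! ### Restriction to a line -/

/-- The line `ℝ l ⊆ V*` is not contained in any of the reflection hyperplanes
`(V*)^t = {f | t f = f}`. -/
def IsRegularLine (cs : CoxeterSystem M W) (l : Module.Dual ℝ (B →₀ ℝ)) : Prop :=
  ∀ t, cs.IsReflection t → cs.geomRep.dual t l ≠ l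

/-- The algebra `ℝ[T]` of polynomial functions on the line `ℝ l ⊆ V*`. -/
def LineAlg (_l : Module.Dual ℝ (B →₀ ℝ)) : Type := Polynomial ℝ

instance (l : Module.Dual ℝ (B →₀ ℝ)) : CommRing (LineAlg l) :=
  inferInstanceAs (CommRing (Polynomial ℝ))

/-- The restriction `S → ℝ[T]` of polynomial functions to the line `ℝ l`: an element `v ∈ V` is sent
to `l(v) T`. -/
def toLine (l : Module.Dual ℝ (B →₀ ℝ)) : PolyV B →+* LineAlg l :=
  (MvPolynomial.aeval fun i : B =>
    Polynomial.C (l (Finsupp.single i 1)) * (Polynomial.X : Polynomial ℝ)).toRingHom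

instance (l : Module.Dual ℝ (B →₀ ℝ)) : Algebra (PolyV B) (LineAlg l) := (toLine l).toAlgebra

/-- The generator `T` of `ℝ[T]`. -/
def lineT (l : Module.Dual ℝ (B →₀ ℝ)) : LineAlg l := (Polynomial.X : Polynomial ℝ)

/-- The grading of `ℝ[T]` with `T` in degree `2`. -/
def lineGr (l : Module.Dual ℝ (B →₀ ℝ)) (k : ℤ) : AddSubgroup (LineAlg l) :=
  (Submodule.span ℝ {p : Polynomial ℝ | ∃ j : ℕ, (2 * j : ℤ) = k ∧ p = Polynomial.X ^ j}).toAddSubgroup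

/-- The restriction `P_T = ℝ[T] ⊗_S P` of an `S`-module to the line `ℝ l`. -/
abbrev OnLine (l : Module.Dual ℝ (B →₀ ℝ)) (P : Type*) [AddCommGroup P] [Module (PolyV B) P] :
    Type _ :=
  LineAlg l ⊗[PolyV B] P

/-- The grading of `P_T`: the part of degree `k` is spanned by the `p ⊗ m` with `p` and `m`
homogeneous of total degree `k`. -/
def onLineGr (l : Module.Dual ℝ (B →₀ ℝ)) {P : Type*} [AddCommGroup P] [Module (PolyV B) P]
    (𝒢 : ℤ → AddSubgroup P) (k : ℤ) : AddSubgroup (OnLine l P) :=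
  AddSubgroup.closure {z | ∃ i j : ℤ, i + j = k ∧ ∃ p ∈ lineGr l i, ∃ m ∈ 𝒢 j,
    z = p ⊗ₜ[PolyV B] m}

/-- The cyclic module `ℝ[T] / T^{n+1}`. -/
abbrev Truncated (l : Module.Dual ℝ (B →₀ ℝ)) (n : ℕ) : Type :=
  LineAlg l ⧸ Ideal.span {lineT l ^ (n + 1)}

/-- The grading of `(ℝ[T] / T^{n+1}){a}`. -/
def truncatedGr (l : Module.Dual ℝ (B →₀ ℝ)) (n : ℕ) (a : ℤ) : ℤ → AddSubgroup (Truncated l n) :=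
  shiftGr (quotGr (lineGr l) (Ideal.span {lineT l ^ (n + 1)})) a

/-- The graded `ℝ[T]`-module `P_T` is isomorphic to a direct sum of modules of the form
`(ℝ[T] / T^{n+1}){a + n}` with `n ≥ 0`. -/
def IsLefschetzSum (l : Module.Dual ℝ (B →₀ ℝ)) {P : Type*} [AddCommGroup P] [Module (PolyV B) P]
    (𝒢 : ℤ → AddSubgroup P) (a : ℤ) : Prop :=
  ∃ (ι : Type) (n : ι → ℕ) (e : OnLine l P ≃ₗ[LineAlg l] ⨁ i, Truncated l (n i)),
    IsGradedIso (onLineGr l 𝒢) (directSumGr fun i => truncatedGr l (n i) (a + n i)) e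


end CoxeterSystem

/-! ### Existence of the Braden–MacPherson sheaves -/

section Components

variable {R : Type u} [CommRing R] {𝒜 : ℤ → AddSubgroup R}

/-- The homogeneous component of degree `k` of an element of a graded module. -/
def GrMod.proj (P : GrMod R 𝒜) (k : ℤ) : P →+ P :=
  let := P.isInternal.chooseDecomposition
  (P.gr k).subtype.comp ((DFinsupp.evalAddMonoidHom k).comp
    (DirectSum.decomposeAddEquiv P.gr).toAddMonoidHom)

namespace GrMod

variable (P : GrMod R 𝒜)

lemma proj_mem (k : ℤ) (v : P) : P.proj k v ∈ P.gr k := by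
  simp [proj]

lemma proj_of_mem {k : ℤ} {v : P} (hv : v ∈ P.gr k) : P.proj k v = v := by
  let := P.isInternal.chooseDecomposition
  exact DirectSum.decompose_of_mem_same P.gr hv

lemma proj_of_ne {k j : ℤ} {v : P} (hv : v ∈ P.gr k) (h : k ≠ j) : P.proj j v = 0 := by
  let := P.isInternal.chooseDecomposition
  exact DirectSum.decompose_of_mem_ne P.gr hv h

lemma sum_proj (v : P) : ∃ s : Finset ℤ, ∀ t, s ⊆ t → ∑ k ∈ t, P.proj k v = v := by
  classical
  let := P.isInternal.chooseDecomposition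
  refine ⟨(DirectSum.decompose P.gr v).support, fun t ht => ?_⟩
  conv_rhs => rw [← DirectSum.sum_support_decompose P.gr v]
  symm
  apply Finset.sum_subset ht
  intro k _ hk
  simpa using hk

lemma proj_smul {i k : ℤ} {a : R} (ha : a ∈ 𝒜 i) (v : P) :
    P.proj k (a • v) = a • P.proj (k - i) v := by
  obtain ⟨s, hs⟩ := P.sum_proj v
  have h := hs (insert (k - i) s) (Finset.subset_insert _ _)
  conv_lhs => rw [← h, Finset.smul_sum, map_sum]
  rw [Finset.sum_eq_single (k - i)]
  · apply proj_of_mem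
    have := P.smul_mem ha (P.proj_mem (k - i) v)
    rwa [add_sub_cancel] at this
  · intro j _ hj
    exact P.proj_of_ne (P.smul_mem ha (P.proj_mem j v)) (by omega)
  · intro h
    exact absurd (Finset.mem_insert_self _ _) h

end GrMod

/-- The homogeneous parts are independent. -/
def IndepGr {M : Type*} [AddCommGroup M] (ℳ : ℤ → AddSubgroup M) : Prop :=
  ∀ (s : Finset ℤ) (x : ℤ → M), (∀ k, x k ∈ ℳ k) → ∑ k ∈ s, x k = 0 → ∀ k ∈ s, x k = 0

lemma GrMod.indep (P : GrMod R 𝒜) : IndepGr P.gr := by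
  intro s x hx h k hk
  have := congrArg (P.proj k) h
  rw [map_sum, map_zero, Finset.sum_eq_single k] at this
  · rwa [P.proj_of_mem (hx k)] at this
  · intro j _ hj
    exact P.proj_of_ne (hx j) hj
  · exact fun h => absurd hk h

lemma indep_quot (P : GrMod R 𝒜) (K : Submodule R P) (hK : ∀ v ∈ K, ∀ k, P.proj k v ∈ K) :
    IndepGr (quotGr P.gr K) := by
  intro s x hx h k hk
  choose y hy hyx using hx
  have e : ∀ k, x k = K.mkQ (y k) := fun k => (hyx k).symm
  simp only [e, ← map_sum] at h ⊢
  rw [Submodule.mkQ_apply, Submodule.Quotient.mk_eq_zero] at h ⊢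
  have := hK _ h k
  rw [map_sum, Finset.sum_eq_single k] at this
  · rwa [P.proj_of_mem (hy k)] at this
  · intro j _ hj
    exact P.proj_of_ne (hy j) hj
  · exact fun h => absurd hk h

lemma indep_pi {ι : Type*} {P : ι → Type*} [∀ i, AddCommGroup (P i)]
    (𝒢 : ∀ i, ℤ → AddSubgroup (P i)) (h : ∀ i, IndepGr (𝒢 i)) : IndepGr (piGr 𝒢) := by
  intro s x hx h0 k hk
  funext i
  refine h i s (fun k => x k i) (fun k => hx k i trivial) ?_ k hk
  simpa using congrFun h0 i

lemma map_proj_eq {P P' : GrMod R 𝒜} {M : Type*} [AddCommGroup M] [Module R M]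
    {ℳ : ℤ → AddSubgroup M} (hM : IndepGr ℳ) {f : P →ₗ[R] M} {g : P' →ₗ[R] M}
    (hf : IsDegZero P.gr ℳ f) (hg : IsDegZero P'.gr ℳ g) {v : P} {v' : P'} (h : f v = g v')
    (k : ℤ) : f (P.proj k v) = g (P'.proj k v') := by
  classical
  obtain ⟨s, hs⟩ := P.sum_proj v
  obtain ⟨s', hs'⟩ := P'.sum_proj v'
  have h1 := hs (insert k (s ∪ s')) (by intro j hj; simp [hj])
  have h2 := hs' (insert k (s ∪ s')) (by intro j hj; simp [hj])
  rw [← sub_eq_zero]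
  refine hM (insert k (s ∪ s')) (fun k => f (P.proj k v) - g (P'.proj k v'))
    (fun k => sub_mem (hf k _ (P.proj_mem k v)) (hg k _ (P'.proj_mem k v'))) ?_ k
    (Finset.mem_insert_self _ _)
  rw [Finset.sum_sub_distrib, ← map_sum, ← map_sum, h1, h2, h, sub_self]

end Components

section Free

variable {B : Type u}

open CoxeterSystem

lemma symGr_mul {i j : ℤ} {a b : PolyV B} (ha : a ∈ symGr B i) (hb : b ∈ symGr B j) :
    a * b ∈ symGr B (i + j) :=
  MvPolynomial.IsWeightedHomogeneous.mul ha hb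

/-- The free `S`-module of rank one, generated in degree `0`. -/
@[reducible] def symMod (B : Type u) : GrSMod B where
  carrier := PolyV B
  gr := symGr B
  isInternal := by
    let := MvPolynomial.weightedDecomposition ℝ (fun _ : B => (2 : ℤ))
    exact DirectSum.Decomposition.isInternal
      (MvPolynomial.weightedHomogeneousSubmodule ℝ (fun _ : B => (2 : ℤ)))
  smul_mem := symGr_mul

lemma weight_eq (m : B →₀ ℕ) : Finsupp.weight (fun _ : B => (2 : ℤ)) m = 2 * (m.degree : ℤ) := by
  simp [Finsupp.weight_apply, Finsupp.sum, Finsupp.degree_apply, Finset.mul_sum, mul_comm]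

lemma symGr_neg {k : ℤ} (hk : k < 0) {a : PolyV B} (ha : a ∈ symGr B k) : a = 0 := by
  have ha : MvPolynomial.IsWeightedHomogeneous (fun _ : B => (2 : ℤ)) a k := ha
  by_contra h
  obtain ⟨m, hm⟩ := MvPolynomial.exists_coeff_ne_zero h
  have := ha hm
  rw [weight_eq] at this
  omega

lemma symGr_zero {a : PolyV B} (ha : a ∈ symGr B 0) : a = 0 ∨ IsUnit a := by
  have ha : MvPolynomial.IsWeightedHomogeneous (fun _ : B => (2 : ℤ)) a 0 := ha
  have h : a = MvPolynomial.C (MvPolynomial.coeff 0 a) := by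
    classical
    ext m
    rw [MvPolynomial.coeff_C]
    split_ifs with hm
    · rw [hm]
    · by_contra hne
      have := ha hne
      rw [weight_eq] at this
      exact hm ((Finsupp.degree_eq_zero_iff m).mp (by omega)).symm
  by_cases h0 : MvPolynomial.coeff 0 a = 0
  · left
    rw [h, h0, map_zero]
  · right
    rw [h]
    exact (IsUnit.mk0 _ h0).map MvPolynomial.C

lemma one_mem_symGr : (1 : PolyV B) ∈ symGr B 0 :=
  MvPolynomial.isWeightedHomogeneous_one ℝ _

lemma homogeneous_proj (P : GrSMod B) {K : Submodule (PolyV B) P}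
    (hK : IsHomogeneousSubmodule P.gr K) {v : P} (hv : v ∈ K) (k : ℤ) : P.proj k v ∈ K := by
  have key : ∀ v ∈ Submodule.span (PolyV B) {v | v ∈ K ∧ ∃ k, v ∈ P.gr k}, ∀ k,
      P.proj k v ∈ K := by
    intro v hv
    induction hv using Submodule.span_induction with
    | mem v hv =>
      intro k
      obtain ⟨hv, j, hj⟩ := hv
      by_cases h : j = k
      · subst h
        rwa [P.proj_of_mem hj]
      · rw [P.proj_of_ne hj h]
        exact K.zero_mem
    | zero => intro k; rw [map_zero]; exact K.zero_mem
    | add x y _ _ hx hy => intro k; rw [map_add]; exact K.add_mem (hx k) (hy k)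
    | smul a x _ hx =>
      intro k
      obtain ⟨s, hs⟩ := (symMod B).sum_proj a
      have h : a • x = ∑ i ∈ s, ((symMod B).proj i a : PolyV B) • x := by
        rw [← Finset.sum_smul]
        congr 1
        exact (hs s subset_rfl).symm
      rw [h, map_sum]
      refine K.sum_mem fun i _ => ?_
      rw [P.proj_smul ((symMod B).proj_mem i a)]
      exact K.smul_mem _ (hx _)
  exact key v (hK.symm ▸ hv : v ∈ Submodule.span (PolyV B) {v | v ∈ K ∧ ∃ k, v ∈ P.gr k}) k

/-- The free `S`-module with generators in the degrees `d 0, …, d (n - 1)`. -/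
@[reducible] def freeMod {n : ℕ} (d : Fin n → ℤ) : GrSMod B where
  carrier := Fin n → PolyV B
  gr := fun k => AddSubgroup.pi Set.univ fun j => symGr B (k - d j)
  isInternal := by
    classical
    constructor
    · rw [injective_iff_map_eq_zero]
      intro x hx
      ext k j : 3
      have h := congrArg (fun f : Fin n → PolyV B => (symMod B).proj (k - d j) (f j)) hx
      simp only [DirectSum.coeAddMonoidHom_eq_dfinsuppSum, DFinsupp.sum] at h
      rw [Finset.sum_apply, map_sum, Pi.zero_apply, map_zero] at h
      have h2 : ∀ i, (symMod B).proj (k - d j) ((x i : Fin n → PolyV B) j) =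
          if i = k then (x i : Fin n → PolyV B) j else 0 := by
        intro i
        have hm := (x i).2 j trivial
        split_ifs with hi
        · subst hi
          exact (symMod B).proj_of_mem hm
        · exact (symMod B).proj_of_ne hm (by omega)
      simp only [h2] at h
      rw [Finset.sum_ite_eq'] at h
      split_ifs at h with hk
      · exact h
      · rw [DFinsupp.notMem_support_iff.mp hk]
        rfl
    · intro f
      rw [← AddMonoidHom.mem_range]
      have : f = ∑ j, Pi.single j (f j) := (Finset.univ_sum_single f).symm
      rw [this]
      refine sum_mem fun j _ => ?_
      obtain ⟨s, hs⟩ := (symMod B).sum_proj (f j)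
      have h : (Pi.single j (f j) : Fin n → PolyV B) =
          ∑ i ∈ s, Pi.single j ((symMod B).proj i (f j) : PolyV B) := by
        conv_lhs => rw [← hs s subset_rfl]
        exact map_sum (AddMonoidHom.single (fun _ : Fin n => PolyV B) j) _ _
      rw [h]
      refine sum_mem fun i _ => ?_
      refine ⟨DirectSum.of _ (i + d j) ⟨Pi.single j ((symMod B).proj i (f j) : PolyV B), ?_⟩, ?_⟩
      · intro j' _
        change (Pi.single j ((symMod B).proj i (f j) : PolyV B) : Fin n → PolyV B) j' ∈
          symGr B (i + d j - d j')
        by_cases hj : j' = j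
        · subst hj
          rw [Pi.single_eq_same, add_sub_cancel_right]
          exact (symMod B).proj_mem i (f j')
        · rw [Pi.single_eq_of_ne hj]
          exact zero_mem _
      · rw [DirectSum.coeAddMonoidHom_of]
  smul_mem := by
    intro i j a m ha hm k _
    have := symGr_mul ha (hm k trivial)
    rwa [← add_sub_assoc] at this

lemma linearCombination_mem {n : ℕ} {d : Fin n → ℤ} {M : Type*} [AddCommGroup M]
    [Module (PolyV B) M] {ℳ : ℤ → AddSubgroup M}
    (hℳ : ∀ {i j : ℤ} {a : PolyV B} {m : M}, a ∈ symGr B i → m ∈ ℳ j → a • m ∈ ℳ (i + j))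
    {q : Fin n → M} (hq : ∀ j, q j ∈ ℳ (d j)) :
    IsDegZero (freeMod d).gr ℳ (Fintype.linearCombination (PolyV B) q) := by
  intro k v hv
  rw [Fintype.linearCombination_apply]
  refine sum_mem fun j _ => ?_
  have := hℳ (hv j trivial) (hq j)
  rwa [sub_add_cancel] at this

lemma single_mem {n : ℕ} [DecidableEq (Fin n)] (d : Fin n → ℤ) (j : Fin n) :
    (Pi.single j 1 : Fin n → PolyV B) ∈ (freeMod (B := B) d).gr (d j) := by
  intro j' _
  change (Pi.single j 1 : Fin n → PolyV B) j' ∈ symGr B (d j - d j')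
  by_cases hj : j' = j
  · subst hj
    rw [Pi.single_eq_same, sub_self]
    exact one_mem_symGr
  · rw [Pi.single_eq_of_ne hj]
    exact zero_mem _

lemma freeMod_isProjective {n : ℕ} (d : Fin n → ℤ) : (freeMod (B := B) d).IsProjective := by
  classical
  intro A C p f hp hsurj hf
  have hsingle := single_mem (B := B) d
  choose a ha using fun j : Fin n => hsurj (f (Pi.single j 1 : Fin n → PolyV B))
  refine ⟨Fintype.linearCombination (PolyV B) fun j => A.proj (d j) (a j),
    linearCombination_mem A.smul_mem fun j => A.proj_mem _ _, ?_⟩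
  refine LinearMap.pi_ext' fun j => LinearMap.ext_ring ?_
  have h := map_proj_eq C.indep hp hf (ha j) (d j)
  rw [GrMod.proj_of_mem (freeMod d) (hsingle j)] at h
  simpa [Fintype.linearCombination_apply_single] using h

theorem exists_projectiveCover {M : Type*} [AddCommGroup M]
    [Module (PolyV B) M] {ℳ : ℤ → AddSubgroup M}
    (hℳ : ∀ {i j : ℤ} {a : PolyV B} {m : M}, a ∈ symGr B i → m ∈ ℳ j → a • m ∈ ℳ (i + j))
    (hind : IndepGr ℳ) (Q : Submodule (PolyV B) M) (hQ : IsHomogeneousSubmodule ℳ Q)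
    (hfg : Q.FG) :
    ∃ (n : ℕ) (d : Fin n → ℤ) (q : Fin n → M),
      IsProjectiveCover (freeMod d) ℳ Q (Fintype.linearCombination (PolyV B) q) := by
  classical
  have hex : ∃ (n : ℕ) (d : Fin n → ℤ) (q : Fin n → M), (∀ j, q j ∈ ℳ (d j)) ∧
      Submodule.span (PolyV B) (Set.range q) = Q := by
    rw [IsHomogeneousSubmodule] at hQ
    rw [← hQ] at hfg
    obtain ⟨t, ht, hts⟩ := Submodule.fg_span_iff_fg_span_finset_subset _ |>.mp hfg
    rw [hQ] at hts
    choose d hd using fun j : Fin t.card => (ht (t.equivFin.symm j).2).2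
    refine ⟨t.card, d, fun j => t.equivFin.symm j, hd, ?_⟩
    rw [hts]
    congr 1
    ext z
    constructor
    · rintro ⟨j, rfl⟩
      exact (t.equivFin.symm j).2
    · intro hz
      exact ⟨t.equivFin ⟨z, hz⟩, by simp⟩
  obtain ⟨n, hn⟩ : ∃ n, n = Nat.find hex := ⟨_, rfl⟩
  have hfind := Nat.find_spec hex
  rw [← hn] at hfind
  obtain ⟨d, q, hq, hspan⟩ := hfind
  have hmin : ∀ m < n, ¬ ∃ (d : Fin m → ℤ) (q : Fin m → M), (∀ j, q j ∈ ℳ (d j)) ∧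
      Submodule.span (PolyV B) (Set.range q) = Q := fun m hm => Nat.find_min hex (hn ▸ hm)
  -- no relation involves a generator with an invertible coefficient
  have hrel : ∀ (c : Fin n → PolyV B) (j : Fin n), c j ∈ symGr B 0 →
      ∑ i, c i • q i = 0 → c j = 0 := by
    intro c j hcj hc
    by_contra hne
    have hu := (symGr_zero hcj).resolve_left hne
    obtain ⟨n', hn'⟩ : ∃ n', n = n' + 1 := Nat.exists_eq_succ_of_ne_zero (fun h => by
      rw [h] at j; exact j.elim0)
    clear hn
    subst hn'
    refine hmin n' (Nat.lt_succ_self _) ⟨d ∘ j.succAbove, q ∘ j.succAbove, fun i => hq _, ?_⟩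
    rw [← hspan]
    apply le_antisymm
    · exact Submodule.span_mono (Set.range_comp_subset_range _ _)
    · rw [Submodule.span_le]
      rintro _ ⟨i, rfl⟩
      rw [SetLike.mem_coe]
      rcases Fin.eq_self_or_eq_succAbove j i with rfl | ⟨i', rfl⟩
      · rw [Fin.sum_univ_succAbove _ i] at hc
        have h1 : c i • q i ∈ Submodule.span (PolyV B) (Set.range (q ∘ i.succAbove)) := by
          rw [eq_neg_of_add_eq_zero_left hc]
          exact neg_mem (sum_mem fun i' _ =>
            Submodule.smul_mem _ _ (Submodule.subset_span ⟨i', rfl⟩))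
        obtain ⟨w, hw⟩ := hu
        rw [← hw] at h1
        have := Submodule.smul_mem _ (↑w⁻¹ : PolyV B) h1
        rwa [smul_smul, Units.inv_mul, one_smul] at this
      · exact Submodule.subset_span ⟨i', rfl⟩
  have hdz := linearCombination_mem hℳ hq
  refine ⟨n, d, q, freeMod_isProjective d, hdz, ?_, ?_⟩
  · rw [Fintype.range_linearCombination, hspan]
  · intro K hK hKQ
    have hsingle : ∀ j, (Pi.single j 1 : Fin n → PolyV B) ∈ K := by
      by_contra! hcon
      obtain ⟨j, hj, hjmin⟩ := Finset.exists_min_image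
        (Finset.univ.filter fun j => (Pi.single j 1 : Fin n → PolyV B) ∉ K) d
        (by obtain ⟨j, hj⟩ := hcon; exact ⟨j, by simpa using hj⟩)
      have hj : (Pi.single j 1 : Fin n → PolyV B) ∉ K := by simpa using hj
      have hless : ∀ i, d i < d j → (Pi.single i 1 : Fin n → PolyV B) ∈ K := by
        intro i hi
        by_contra h
        exact absurd (hjmin i (by simpa using h)) (not_le.mpr hi)
      have hqj : q j ∈ K.map (Fintype.linearCombination (PolyV B) q) := by
        rw [hKQ, ← hspan]
        exact Submodule.subset_span ⟨j, rfl⟩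
      obtain ⟨κ, hκ, hκq⟩ := hqj
      set κ' : Fin n → PolyV B := (freeMod d).proj (d j) κ with hκ'
      have hκ'K : κ' ∈ K := homogeneous_proj (freeMod d) hK hκ (d j)
      have hκ'gr := (freeMod (B := B) d).proj_mem (d j) κ
      have hsj := single_mem (B := B) d j
      have e1 : Fintype.linearCombination (PolyV B) q (Pi.single j 1) = q j := by
        rw [Fintype.linearCombination_apply_single, one_smul]
      have e2 : Fintype.linearCombination (PolyV B) q κ' = q j := by
        have := map_proj_eq hind hdz hdz (hκq.trans e1.symm) (d j)
        rw [GrMod.proj_of_mem (freeMod d) hsj, e1] at this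
        exact this
      have hc0 : ∑ i, ((Pi.single j 1 : Fin n → PolyV B) - κ') i • q i = 0 := by
        rw [← Fintype.linearCombination_apply, map_sub, e1, e2, sub_self]
      have hcgr : ∀ i, ((Pi.single j 1 : Fin n → PolyV B) - κ') i ∈ symGr B (d j - d i) :=
        fun i => sub_mem (hsj i trivial) (hκ'gr i trivial)
      apply hj
      have hsum : (Pi.single j 1 : Fin n → PolyV B) = κ' +
          ∑ i, ((Pi.single j 1 : Fin n → PolyV B) - κ') i • (Pi.single i 1 : Fin n → PolyV B) := by
        rw [← pi_eq_sum_univ']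
        abel
      rw [hsum]
      refine K.add_mem hκ'K (K.sum_mem fun i _ => ?_)
      rcases lt_trichotomy (d i) (d j) with h | h | h
      · exact K.smul_mem _ (hless i h)
      · have h0 := hcgr i
        rw [h, sub_self] at h0
        rw [hrel _ i h0 hc0, zero_smul]
        exact K.zero_mem
      · rw [symGr_neg (by omega) (hcgr i), zero_smul]
        exact K.zero_mem
    rw [eq_top_iff]
    intro v _
    have : (v : Fin n → PolyV B) = ∑ i, (v : Fin n → PolyV B) i •
        (Pi.single i 1 : Fin n → PolyV B) := by
      rw [← pi_eq_sum_univ']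
    rw [this]
    exact K.sum_mem fun i _ => K.smul_mem _ (hsingle i)

end Free

namespace CoxeterSystem

variable {B : Type u} {W : Type v} [Group W] {M : CoxeterMatrix B}

lemma linearForm_mem (w : B →₀ ℝ) : linearForm B w ∈ symGr B 2 := by
  rw [linearForm, Finsupp.linearCombination_apply]
  refine sum_mem fun i _ => ?_
  exact Submodule.smul_mem (MvPolynomial.weightedHomogeneousSubmodule ℝ (fun _ : B => (2 : ℤ)) 2)
    _ (MvPolynomial.isWeightedHomogeneous_X ℝ (fun _ : B => (2 : ℤ)) i)

lemma proj_mem_labelSMul (cs : CoxeterSystem M W) (t : W) (P : GrSMod B) {v : P}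
    (hv : v ∈ cs.labelSMul t P) (k : ℤ) : P.proj k v ∈ cs.labelSMul t P := by
  have key : ∀ a ∈ cs.labelIdeal t, ∀ (w : P) (k : ℤ), P.proj k (a • w) ∈ cs.labelSMul t P := by
    intro a ha
    rw [labelIdeal] at ha
    induction ha using Submodule.span_induction with
    | mem a ha =>
      intro w k
      obtain ⟨u, hu, rfl⟩ := ha
      rw [P.proj_smul (linearForm_mem u)]
      exact Submodule.smul_mem_smul (Ideal.subset_span ⟨u, hu, rfl⟩) Submodule.mem_top
    | zero => intro w k; rw [zero_smul, map_zero]; exact zero_mem _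
    | add x y _ _ hx hy => intro w k; rw [add_smul, map_add]; exact add_mem (hx w k) (hy w k)
    | smul b x _ hx =>
      intro w k
      rw [smul_eq_mul, mul_comm, mul_smul]
      exact hx _ k
  induction hv using Submodule.smul_induction_on' with
  | smul a ha w _ => exact key a ha w k
  | add x _ y _ hx hy => rw [map_add]; exact add_mem hx hy

lemma BruhatLE.length_le {cs : CoxeterSystem M W} {a b : W} (h : cs.BruhatLE a b) :
    cs.length a ≤ cs.length b := by
  induction h with
  | refl => rfl
  | tail _ h ih =>
    obtain ⟨_, _, _, h⟩ := h
    omega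

lemma BruhatLT.length_lt {cs : CoxeterSystem M W} {a b : W} (h : cs.BruhatLT a b) :
    cs.length a < cs.length b := by
  obtain ⟨h, hne⟩ := h
  rcases Relation.ReflTransGen.cases_tail h with h | ⟨c, hc, _, _, _, hl⟩
  · exact absurd h.symm hne
  · exact lt_of_le_of_lt (BruhatLE.length_le hc) hl

lemma BruhatLT.trans {cs : CoxeterSystem M W} {a b c : W} (h : cs.BruhatLT a b)
    (h' : cs.BruhatLT b c) : cs.BruhatLT a c :=
  ⟨Relation.ReflTransGen.trans h.1 h'.1, fun e => by
    subst e; have := h.length_lt; have := h'.length_lt; omega⟩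

lemma finite_bruhatLE [Finite B] (cs : CoxeterSystem M W) (x : W) :
    {w | cs.BruhatLE w x}.Finite := by
  apply ((List.finite_length_le B (cs.length x)).image cs.wordProd).subset
  intro w hw
  obtain ⟨ω, hω, rfl⟩ := cs.exists_isReduced w
  refine ⟨ω, ?_, rfl⟩
  have := BruhatLE.length_le (show cs.BruhatLE _ _ from hw)
  rwa [hω.eq] at this

namespace BruhatSheaf

variable {cs : CoxeterSystem M W} (ℱ : cs.BruhatSheaf)

lemma indep_edgesGr (y : W) : IndepGr (ℱ.edgesGr y) :=
  indep_pi _ fun _ => indep_quot _ _ fun _ hv k => cs.proj_mem_labelSMul _ _ hv k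

lemma smul_mem_edgesGr (y : W) {i j : ℤ} {a : PolyV B} {m : ∀ E : cs.UpEdge y, ℱ.edge E}
    (ha : a ∈ symGr B i) (hm : m ∈ ℱ.edgesGr y j) : a • m ∈ ℱ.edgesGr y (i + j) := by
  intro E _
  obtain ⟨v, hv, hvm⟩ := hm E trivial
  refine ⟨a • v, GrMod.smul_mem _ ha hv, ?_⟩
  change (Submodule.mkQ _) (a • v) = a • m E
  rw [map_smul]
  congr 1

lemma isDegZero_toEdge {y : W} (E : cs.UpEdge y) :
    IsDegZero (ℱ.stalk E.target).gr (ℱ.edgeGr E) (ℱ.toEdge E) :=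
  fun _ v hv => ⟨v, hv, rfl⟩

/-- The homogeneous components of a section are sections. -/
lemma proj_mem_sections {I : Set W} (hI : ∀ w ∈ I, ∀ E : cs.UpEdge w,
      IsDegZero (ℱ.stalk w).gr (ℱ.edgeGr E) (ℱ.ρ w E))
    {m : ∀ w : I, ℱ.stalk w} (hm : m ∈ ℱ.sections I) (k : ℤ) :
    (fun w : I => (ℱ.stalk w).proj k (m w)) ∈ ℱ.sections I := by
  intro w hw E hE
  exact map_proj_eq (indep_quot _ _ fun _ hv k => cs.proj_mem_labelSMul _ _ hv k)
    (hI w hw E) (ℱ.isDegZero_toEdge E) (hm w hw E hE) k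

lemma boundary_homogeneous [Finite B] {x y : W}
    (h0 : ∀ w, ¬ cs.BruhatLE w x → Subsingleton (ℱ.stalk w))
    (hI : ∀ w, cs.BruhatLT y w → ∀ E : cs.UpEdge w,
      IsDegZero (ℱ.stalk w).gr (ℱ.edgeGr E) (ℱ.ρ w E)) :
    IsHomogeneousSubmodule (ℱ.edgesGr y) (ℱ.boundary y) := by
  classical
  have hfinx := cs.finite_bruhatLE x
  apply le_antisymm
  · rw [Submodule.span_le]
    exact fun v hv => hv.1
  · rintro _ ⟨m, hm, rfl⟩
    choose s hs using fun w : {w | cs.BruhatLT y w} => (ℱ.stalk w).sum_proj (m w)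
    let t : Finset ℤ := hfinx.toFinset.biUnion fun w =>
      if h : cs.BruhatLT y w then s ⟨w, h⟩ else ∅
    have hsum : m = ∑ k ∈ t, fun w : {w | cs.BruhatLT y w} => (ℱ.stalk w).proj k (m w) := by
      funext w
      rw [Finset.sum_apply]
      by_cases hw : cs.BruhatLE w x
      · refine (hs w t fun k hk => ?_).symm
        refine Finset.mem_biUnion.mpr ⟨w, hfinx.mem_toFinset.mpr hw, ?_⟩
        have hyw : cs.BruhatLT y w.1 := w.2
        rw [dif_pos hyw]
        exact hk
      · have := h0 w hw
        exact Subsingleton.elim _ _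
    have hmem : ∀ k ∈ t, ℱ.restrictToEdges y
        (fun w : {w | cs.BruhatLT y w} => (ℱ.stalk w).proj k (m w)) ∈
        Submodule.span (PolyV B) {v | v ∈ ℱ.boundary y ∧ ∃ k, v ∈ ℱ.edgesGr y k} := by
      intro k _
      apply Submodule.subset_span
      refine ⟨Submodule.mem_map_of_mem (ℱ.proj_mem_sections hI hm k), k, ?_⟩
      intro E _
      exact ℱ.isDegZero_toEdge E k _ (GrMod.proj_mem _ k _)
    have e : ℱ.restrictToEdges y m = ∑ k ∈ t, ℱ.restrictToEdges y
        (fun w : {w | cs.BruhatLT y w} => (ℱ.stalk w).proj k (m w)) := by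
      rw [← map_sum, ← hsum]
    rw [e]
    exact sum_mem hmem

lemma boundary_fg [Finite B] {x y : W}
    (h0 : ∀ w, ¬ cs.BruhatLE w x → Subsingleton (ℱ.stalk w))
    (hfin : ∀ w, cs.BruhatLT y w → Module.Finite (PolyV B) (ℱ.stalk w)) :
    (ℱ.boundary y).FG := by
  have hfinx := cs.finite_bruhatLE x
  apply Submodule.FG.map
  let J := {w : W // cs.BruhatLT y w ∧ cs.BruhatLE w x}
  have : Finite J := (hfinx.subset fun w hw => hw.2 :
    {w | cs.BruhatLT y w ∧ cs.BruhatLE w x}.Finite)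
  have : IsNoetherianRing (PolyV B) := inferInstance
  have : ∀ j : J, IsNoetherian (PolyV B) (ℱ.stalk j.1) := fun j => by
    have := hfin j.1 j.2.1
    exact isNoetherian_of_isNoetherianRing_of_finite _ _
  let f : (∀ w : {w | cs.BruhatLT y w}, ℱ.stalk w) →ₗ[PolyV B] ∀ j : J, ℱ.stalk j.1 :=
    LinearMap.pi fun j => LinearMap.proj
      (φ := fun w : {w | cs.BruhatLT y w} => (ℱ.stalk w : Type u)) ⟨j.1, j.2.1⟩
  have hf : Function.Injective f := by
    intro m m' h
    funext w
    by_cases hw : cs.BruhatLE w x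
    · exact congrFun h ⟨w.1, w.2, hw⟩
    · have := h0 w hw
      exact Subsingleton.elim _ _
  have : IsNoetherian (PolyV B) (∀ j : J, ℱ.stalk j.1) := isNoetherian_pi
  have := isNoetherian_of_injective f hf
  exact IsNoetherian.noetherian _

lemma exists_cover [Finite B] {x y : W}
    (h0 : ∀ w, ¬ cs.BruhatLE w x → Subsingleton (ℱ.stalk w))
    (hfin : ∀ w, cs.BruhatLT y w → Module.Finite (PolyV B) (ℱ.stalk w))
    (hI : ∀ w, cs.BruhatLT y w → ∀ E : cs.UpEdge w,
      IsDegZero (ℱ.stalk w).gr (ℱ.edgeGr E) (ℱ.ρ w E)) :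
    ∃ (n : ℕ) (d : Fin n → ℤ) (q : Fin n → ∀ E : cs.UpEdge y, ℱ.edge E),
      IsProjectiveCover (freeMod d) (ℱ.edgesGr y) (ℱ.boundary y)
        (Fintype.linearCombination (PolyV B) q) := by
  have h1 := ℱ.indep_edgesGr y
  have h2 := ℱ.boundary_homogeneous h0 hI
  have h3 := ℱ.boundary_fg h0 hfin
  exact exists_projectiveCover (ℳ := ℱ.edgesGr y) (fun ha hm => ℱ.smul_mem_edgesGr y ha hm)
    h1 (ℱ.boundary y) h2 h3

end BruhatSheaf

/-! A concrete model: all stalks are modules `freeMod d`, and the restriction maps are given by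
lifts of the images of the standard generators. -/

/-- The degrees of the generators of a stalk, together with lifts of the images of the generators
in the stalks at the end points of the edges that originate there. -/
structure StalkData (B : Type u) (W : Type v) where
  n : ℕ
  deg : Fin n → ℤ
  lift : Fin n → W → ℕ → PolyV B

namespace StalkData

/-- The stalk. -/
@[reducible] def stalk (D : StalkData B W) : GrSMod B := freeMod D.deg

/-- The restriction map to the edge given by the reflection `t`. -/
def toEdge (cs : CoxeterSystem M W) (D D' : StalkData B W) (t : W) :
    D.stalk →ₗ[PolyV B] (D'.stalk ⧸ cs.labelSMul t D'.stalk) :=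
  Fintype.linearCombination (PolyV B) fun j =>
    (cs.labelSMul t D'.stalk).mkQ fun i : Fin D'.n => D.lift j t i

/-- The sheaf with given stalk data. -/
def sheaf (cs : CoxeterSystem M W) (D : W → StalkData B W) : cs.BruhatSheaf where
  stalk := fun w => (D w).stalk
  ρ := fun w E => toEdge cs (D w) (D E.target) E.1

/-- The trivial stalk. -/
def zero : StalkData B W := ⟨0, fun _ => 0, fun _ _ _ => 0⟩

/-- The stalk `S`. -/
def one : StalkData B W := ⟨1, fun _ => 0, fun _ _ _ => 0⟩

/-- The condition that `d` is a valid choice of the stalk at `y`, given the stalks on `{> y}`. -/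
def IsNext (cs : CoxeterSystem M W) (y : W) (D : {w | cs.BruhatLT y w} → StalkData B W)
    (d : StalkData B W) : Prop :=
  IsProjectiveCover d.stalk
    (piGr fun E : cs.UpEdge y => quotGr (D ⟨E.target, E.2.2⟩).stalk.gr
      (cs.labelSMul E.1 (D ⟨E.target, E.2.2⟩).stalk))
    (Submodule.map
      (LinearMap.pi fun E : cs.UpEdge y =>
        (cs.labelSMul E.1 (D ⟨E.target, E.2.2⟩).stalk).mkQ ∘ₗ
          LinearMap.proj (φ := fun w : {w | cs.BruhatLT y w} => ((D w).stalk : Type u))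
            ⟨E.target, E.2.2⟩)
      { carrier := {m : ∀ w : {w | cs.BruhatLT y w}, (D w).stalk |
          ∀ (w : W) (hw : cs.BruhatLT y w) (E : cs.UpEdge w) (hE : cs.BruhatLT y E.target),
            toEdge cs (D ⟨w, hw⟩) (D ⟨E.target, hE⟩) E.1 (m ⟨w, hw⟩) =
              (cs.labelSMul E.1 (D ⟨E.target, hE⟩).stalk).mkQ (m ⟨E.target, hE⟩)}
        add_mem' := by
          intro m n hm hn w hw E hE
          simp only [Pi.add_apply, map_add, hm w hw E hE, hn w hw E hE]
        zero_mem' := by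
          intro w hw E hE
          simp only [Pi.zero_apply, map_zero]
        smul_mem' := by
          intro a m hm w hw E hE
          simp only [Pi.smul_apply, map_smul, hm w hw E hE] })
    (LinearMap.pi fun E : cs.UpEdge y =>
      toEdge cs d (D ⟨E.target, E.2.2⟩) E.1)

lemma isNext_iff (cs : CoxeterSystem M W) (D : W → StalkData B W) (y : W) :
    IsNext cs y (fun w => D w) (D y) ↔
      IsProjectiveCover ((sheaf cs D).stalk y) ((sheaf cs D).edgesGr y) ((sheaf cs D).boundary y)
        ((sheaf cs D).upRestriction y) :=
  Iff.rfl

open Classical in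
/-- The step of the construction. -/
def next (cs : CoxeterSystem M W) (x y : W) (D : {w | cs.BruhatLT y w} → StalkData B W) :
    StalkData B W :=
  if y = x then one
  else if h : cs.BruhatLE y x ∧ ∃ d, IsNext cs y D d then h.2.choose else zero

open Classical in
/-- The stalk data of the Braden–MacPherson sheaf, constructed by downward recursion. -/
def bm (cs : CoxeterSystem M W) (x : W) : W → StalkData B W :=
  (measure fun w => cs.length x - cs.length w).wf.fix fun y prev =>
    next cs x y fun w =>
      if h : cs.length x - cs.length w.1 < cs.length x - cs.length y ∧ cs.BruhatLE w.1 x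
      then prev w.1 h.1 else zero

lemma bm_of_not_le (cs : CoxeterSystem M W) (x y : W) (h : ¬ cs.BruhatLE y x) :
    bm cs x y = zero := by
  rw [bm, WellFounded.fix_eq, next, if_neg, dif_neg (fun h' => h h'.1)]
  rintro rfl
  exact h Relation.ReflTransGen.refl

lemma bm_eq (cs : CoxeterSystem M W) (x y : W) :
    bm cs x y = next cs x y fun w => bm cs x w := by
  conv_lhs => rw [bm, WellFounded.fix_eq]
  congr 1
  funext w
  split_ifs with h
  · rfl
  · by_cases hw : cs.BruhatLE w.1 x
    · exfalso
      apply h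
      refine ⟨?_, hw⟩
      have := (show cs.BruhatLT y w.1 from w.2).length_lt
      have := hw.length_le
      omega
    · rw [bm_of_not_le cs x w hw]

lemma isNext_bm [Finite B] (cs : CoxeterSystem M W) (x y : W) (hy : cs.BruhatLT y x) :
    IsNext cs y (fun w => bm cs x w) (bm cs x y) := by
  induction hk : cs.length x - cs.length y using Nat.strong_induction_on generalizing y with
  | _ k ih =>
  suffices h : ∃ d, IsNext cs y (fun w => bm cs x w) d by
    rw [bm_eq, next, if_neg hy.2, dif_pos ⟨hy.1, h⟩]
    exact Exists.choose_spec _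
  let ℱ := sheaf cs (bm cs x)
  have h0 : ∀ w, ¬ cs.BruhatLE w x → Subsingleton (ℱ.stalk w) := by
    intro w hw
    change Subsingleton (Fin (bm cs x w).n → PolyV B)
    rw [bm_of_not_le cs x w hw]
    exact inferInstanceAs (Subsingleton (Fin 0 → PolyV B))
  have hsub : ∀ w (E : cs.UpEdge w), ¬ cs.BruhatLE E.target x → Subsingleton (ℱ.edge E) := by
    intro w E h
    have := h0 _ h
    exact (Submodule.mkQ_surjective (cs.labelSMul E.1 (ℱ.stalk E.target))).subsingleton
  obtain ⟨n, d, q, hq⟩ := ℱ.exists_cover (x := x) (y := y) h0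
    (fun w _ => inferInstanceAs (Module.Finite (PolyV B) (Fin (bm cs x w).n → PolyV B)))
    (by
      intro w hw E
      by_cases hwx : cs.BruhatLT w x
      · have h1 := hw.length_lt
        have h2 := hwx.length_lt
        have := (isNext_iff cs (bm cs x) w).mp (ih _ (by omega) w hwx rfl)
        intro k v hv
        exact this.isDegZero k v hv E trivial
      · have : Subsingleton (ℱ.edge E) := by
          apply hsub
          intro hle
          exact hwx ⟨Relation.ReflTransGen.trans E.2.2.1 hle, fun e => by
            have := BruhatLE.length_le hle
            rw [← e] at this
            exact absurd E.2.2.length_lt (not_lt.mpr this)⟩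
        intro k v _
        rw [Subsingleton.elim (ℱ.ρ w E v) 0]
        exact zero_mem _)
  choose r hr using fun (j : Fin n) (E : cs.UpEdge y) =>
    Submodule.mkQ_surjective (cs.labelSMul E.1 (ℱ.stalk E.target)) (q j E)
  classical
  let L : Fin n → W → ℕ → PolyV B := fun j t i =>
    if h : cs.IsReflection t ∧ cs.BruhatLT y (t * y) then
      if hi : i < (bm cs x (t * y)).n then (r j ⟨t, h⟩ : Fin _ → PolyV B) ⟨i, hi⟩ else 0
    else 0
  refine ⟨⟨n, d, L⟩, ?_⟩
  have hmap : (LinearMap.pi fun E : cs.UpEdge y =>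
      toEdge cs ⟨n, d, L⟩ (bm cs x E.target) E.1) = Fintype.linearCombination (PolyV B) q := by
    refine LinearMap.pi_ext' fun j => LinearMap.ext_ring ?_
    funext E
    have h1 : (toEdge cs ⟨n, d, L⟩ (bm cs x E.target) E.1) (Pi.single j 1) =
        (cs.labelSMul E.1 (bm cs x E.target).stalk).mkQ fun i => L j E.1 i := by
      simp [toEdge, Fintype.linearCombination_apply_single]
    have h2 : (fun i : Fin (bm cs x E.target).n => L j E.1 i) = r j E := by
      funext i
      have hi : i.1 < (bm cs x (E.1 * y)).n := i.2
      simp only [L]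
      rw [dif_pos E.2, dif_pos hi]
      rfl
    have h3 : Fintype.linearCombination (PolyV B) q (Pi.single j 1) = q j := by
      rw [Fintype.linearCombination_apply_single, one_smul]
    have h4 := hr j E
    rw [← h2] at h4
    exact h1.trans (h4.trans (congrFun h3 E).symm)
  unfold IsNext
  rw [hmap]
  exact hq

/-- The Braden–MacPherson sheaf exists. -/
theorem isBradenMacPherson_bm [Finite B] (cs : CoxeterSystem M W) (x : W) :
    (sheaf cs (bm cs x)).IsBradenMacPherson x where
  top := by
    have h : bm cs x x = one := by rw [bm_eq, next, if_pos rfl]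
    change ∃ e : (bm cs x x).stalk ≃ₗ[PolyV B] PolyV B,
      IsGradedIso (bm cs x x).stalk.gr (symGr B) e
    rw [h]
    refine ⟨LinearEquiv.funUnique (Fin 1) (PolyV B) (PolyV B), fun k v => ?_⟩
    constructor
    · intro hv
      have := hv (0 : Fin 1) trivial
      change _ ∈ symGr B (k - 0) at this
      rwa [sub_zero] at this
    · intro hv j _
      have hj : j = (0 : Fin 1) := Subsingleton.elim (α := Fin 1) _ _
      subst hj
      change _ ∈ symGr B (k - 0)
      rwa [sub_zero]
  eq_zero := by
    intro w hw
    change Subsingleton (Fin (bm cs x w).n → PolyV B)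
    rw [bm_of_not_le cs x w hw]
    exact inferInstanceAs (Subsingleton (Fin 0 → PolyV B))
  cover := fun y hy => (isNext_iff cs _ y).mp (isNext_bm cs x y hy)

end StalkData

/-- For every `x` there is a sheaf that arises from the Braden–MacPherson construction. -/
theorem exists_isBradenMacPherson [Finite B] (cs : CoxeterSystem M W) (x : W) :
    ∃ ℱ : cs.BruhatSheaf, ℱ.IsBradenMacPherson x :=
  ⟨_, StalkData.isBradenMacPherson_bm cs x⟩

end CoxeterSystem

end

/-! Put `D = l(x) - l(y)`, let `P` be the stalk of `ℬ(x)` at `y` and `K` its costalk, the kernel of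
`P → ℬ(x)^{δy}`. Both turn out to be graded free. In homogeneous bases of degrees `d_i` (for `P`)
and `f_j` (for `K`), the inclusion `K ⊆ P` is a matrix `A` with cokernel `ℬ(x)^{δy}`. A product of
labels annihilates the cokernel and does not vanish at the point `l` of the line; hence `A` is
square and its value `A(l)` is an invertible real matrix.

An element of the intersection is a combination of columns of `A` with `f_j ≤ D + m - 1` whose
entries in the rows with `d_i > D - m` vanish. It has to be shown that this block of `A` is
injective, and it suffices to do so at `l` (`eq_zero_of_evalAt`). Let `γ` be a real vector supported
on these columns such that `κ = A(l) γ` vanishes in these rows. Since `A` links only degrees of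
equal parity, all degrees may be assumed to have the same parity. If `κ ≠ 0`, let `g ≤ D - m` be the
largest `d_i` with `κ_i ≠ 0`. Filling up with powers of `T`, the vector `κ` becomes an element `u`
of degree `g` in the cokernel restricted to the line, and the columns of `A` give `T^(D-1-g) u = 0`.
The Lefschetz assumption makes this power of `T` injective in degree `g` (`IsLefschetzSum.eq_zero`),
so `u = 0`. A projective cover has its kernel inside the maximal ideal times `P`, so the generators
stay independent modulo the maximal ideal. This forces `κ = 0` after all, hence `γ = 0`. The
argument is `sum_evalAt_eq_zero` and `generatedLE_inf_eq_bot`.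

The remaining input is that `K` is free (`isGradedProjective_costalk`). Translating the skyscraper
at the identity along a reduced word of `x` yields a Bott–Samelson sheaf that is flabby, with top
stalk `S` and with graded projective stalks and costalks (`exists_bottSamelson`). The identification
of top stalks extends to morphisms in both directions (`exists_isHom`), and by minimality of `ℬ(x)`
their composite on `ℬ(x)` is bijective (`bijective_of_isMinimal`). So the costalks of `ℬ(x)` are
direct summands of those of the Bott–Samelson sheaf.

Translation needs two facts about roots: labels of different reflections are not proportional, and
right multiplication by a simple reflection preserves all edges except those inside a coset. -/

/-! ### Roots of the geometric representation -/

namespace CoxeterSystem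

section Form

variable {B : Type*} (M : CoxeterMatrix B)

/-- Twice the canonical bilinear form on the space spanned by the simple roots. -/
noncomputable def rootForm : (B →₀ ℝ) →ₗ[ℝ] Module.Dual ℝ (B →₀ ℝ) :=
  Finsupp.linearCombination ℝ (simpleCoroot M)

lemma rootForm_single (i : B) : rootForm M (Finsupp.single i 1) = simpleCoroot M i := by
  simp [rootForm]

lemma rootForm_comm (u v : B →₀ ℝ) : rootForm M u v = rootForm M v u := by
  have h : rootForm M = (rootForm M).flip := by
    refine Finsupp.lhom_ext' fun i => LinearMap.ext_ring ?_
    refine Finsupp.lhom_ext' fun j => LinearMap.ext_ring ?_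
    simp [rootForm_single, simpleCoroot_single, M.symmetric j i]
  exact congrArg (fun f => f u v) h

lemma simpleRefl_apply (i : B) (v : B →₀ ℝ) :
    simpleRefl M i v = v - rootForm M (Finsupp.single i 1) v • Finsupp.single i 1 := by
  rw [rootForm_single]
  exact Module.reflection_apply _ _

lemma rootForm_simpleRefl (i : B) (u v : B →₀ ℝ) :
    rootForm M (simpleRefl M i u) (simpleRefl M i v) = rootForm M u v := by
  have h2 : rootForm M (Finsupp.single i 1) (Finsupp.single i 1) = 2 := by
    rw [rootForm_single, simpleCoroot_self]
  simp only [simpleRefl_apply, map_sub, map_smul, LinearMap.sub_apply, LinearMap.smul_apply,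
    smul_eq_mul, h2, rootForm_comm M u (Finsupp.single i 1)]
  ring

/-- The coefficients of the roots of a dihedral group. -/
lemma exists_dihedral_coeff (m : ℕ) (hm : m ≠ 1) :
    ∃ c : ℕ → ℝ, c 0 = 0 ∧ c 1 = 1 ∧ (∀ n, c (n + 2) = 2 * Real.cos (Real.pi / m) * c (n + 1) - c n)
      ∧ ∀ n, (m = 0 ∨ n ≤ m) → 0 ≤ c n := by
  rcases Nat.eq_zero_or_pos m with rfl | hpos
  -- `m = 0` encodes infinite order. As `π / 0 = 0`, the recursion becomes `c (n + 2) = 2 c (n + 1)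
  -- - c n`, solved by `c n = n`.
  · refine ⟨fun n => n, by simp, by simp, fun n => ?_, fun n _ => by positivity⟩
    simp
    ring
  · have h2 : (2 : ℝ) ≤ m := by exact_mod_cast (by omega : 2 ≤ m)
    have hs : 0 < Real.sin (Real.pi / m) := by
      apply Real.sin_pos_of_pos_of_lt_pi
      · positivity
      · rw [div_lt_iff₀ (by positivity)]
        nlinarith [Real.pi_pos]
    -- The recursion is the addition theorem for the sine, and `n π / m` stays in `[0, π]` for `n ≤
    -- m`.
    refine ⟨fun n => Real.sin (n * (Real.pi / m)) / Real.sin (Real.pi / m), by simp,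
      by simp [hs.ne'], fun n => ?_, fun n hn => ?_⟩
    · rw [← mul_div_assoc, ← sub_div]
      push_cast
      have e1 : ((n : ℝ) + 2) * (Real.pi / m) = (n + 1) * (Real.pi / m) + Real.pi / m := by ring
      have e2 : (n : ℝ) * (Real.pi / m) = (n + 1) * (Real.pi / m) - Real.pi / m := by ring
      rw [e1, e2, Real.sin_add, Real.sin_sub]
      ring
    · have hn : n ≤ m := hn.resolve_left (by omega)
      apply div_nonneg _ hs.le
      apply Real.sin_nonneg_of_nonneg_of_le_pi
      · positivity
      · have : (n : ℝ) ≤ m := by exact_mod_cast hn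
        rw [mul_div_assoc', div_le_iff₀ (by positivity)]
        nlinarith [Real.pi_pos]

end Form

/-! ### Positivity of roots and faithfulness of the geometric representation -/

variable {B : Type*} {W : Type*} [Group W] {M : CoxeterMatrix B} (cs : CoxeterSystem M W)

lemma geomRep_simple (i : B) (v : B →₀ ℝ) :
    cs.geomRep (cs.simple i) v =
      v - rootForm M (Finsupp.single i 1) v • Finsupp.single i 1 := by
  rw [← simpleRefl_apply, geomRep]
  simp [lift_apply_simple]

lemma geomRep_mul_apply (a b : W) (v : B →₀ ℝ) :
    cs.geomRep (a * b) v = cs.geomRep a (cs.geomRep b v) := by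
  rw [map_mul]; rfl

lemma geomRep_one_apply (v : B →₀ ℝ) : cs.geomRep 1 v = v := by
  rw [map_one]; rfl

lemma geomRep_inv_apply_self (a : W) (v : B →₀ ℝ) :
    cs.geomRep a⁻¹ (cs.geomRep a v) = v := by
  rw [← geomRep_mul_apply, inv_mul_cancel, geomRep_one_apply]

lemma geomRep_apply_inv_self (a : W) (v : B →₀ ℝ) :
    cs.geomRep a (cs.geomRep a⁻¹ v) = v := by
  rw [← geomRep_mul_apply, mul_inv_cancel, geomRep_one_apply]

lemma rootForm_single_self (i : B) :
    rootForm M (Finsupp.single i 1) (Finsupp.single i 1) = 2 := by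
  rw [rootForm_single, simpleCoroot_self]

lemma geomRep_simple_single (i : B) :
    cs.geomRep (cs.simple i) (Finsupp.single i 1) = -Finsupp.single i 1 := by
  rw [geomRep_simple, rootForm_single_self, two_smul]
  abel

lemma rootForm_geomRep (w : W) (u v : B →₀ ℝ) :
    rootForm M (cs.geomRep w u) (cs.geomRep w v) = rootForm M u v := by
  induction w using cs.simple_induction_left with
  | one => simp only [geomRep_one_apply]
  | mul_simple_left w i ih =>
    rw [geomRep_mul_apply, geomRep_mul_apply, geomRep_simple, geomRep_simple,
      ← simpleRefl_apply, ← simpleRefl_apply, rootForm_simpleRefl, ih]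

/-- The word ends in `j`, so `s_j` acts first on `α_i`. Each further letter changes one of the two
coordinates, and its new value is given by the recursion for `c`. -/
lemma geomRep_alternatingWord (i j : B) (c : ℕ → ℝ) (h0 : c 0 = 0) (h1 : c 1 = 1)
    (hc : ∀ n, c (n + 2) = 2 * Real.cos (Real.pi / M i j) * c (n + 1) - c n) (k : ℕ) :
    cs.geomRep (cs.wordProd (alternatingWord i j k)) (Finsupp.single i 1) =
      if Even k then c (k + 1) • Finsupp.single i 1 + c k • Finsupp.single j 1
      else c k • Finsupp.single i 1 + c (k + 1) • Finsupp.single j 1 := by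
  induction k with
  | zero => simp [alternatingWord, h0, h1]
  | succ k ih =>
    rw [alternatingWord_succ', wordProd_cons, geomRep_mul_apply, ih]
    by_cases hk : Even k
    · have hk' : ¬ Even (k + 1) := by simpa [Nat.even_add_one] using hk
      simp only [hk, hk', if_true, if_false, geomRep_simple, rootForm_single, map_add, map_smul,
        simpleCoroot_single, M.symmetric j i, hc, M.diagonal, Nat.cast_one, div_one, Real.cos_pi]
      module
    · have hk' : Even (k + 1) := by simpa [Nat.even_add_one] using hk
      simp only [hk, hk', if_true, if_false, geomRep_simple, rootForm_single, map_add, map_smul,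
        simpleCoroot_single, hc, M.diagonal, Nat.cast_one, div_one, Real.cos_pi]
      module

/-- If `w s_i` is longer than `w`, then `w α_i` is a positive root. -/
theorem geomRep_single_nonneg (w : W) (i : B) (h : cs.length w < cs.length (w * cs.simple i)) :
    0 ≤ cs.geomRep w (Finsupp.single i 1) := by
  induction hn : cs.length w using Nat.strong_induction_on generalizing w i with
  | _ n ih =>
  by_cases hw : w = 1
  · rw [hw, geomRep_one_apply]
    simp
  obtain ⟨j, hj⟩ := cs.exists_rightDescent_of_ne_one hw
  have hij : i ≠ j := by
    rintro rfl
    exact absurd hj (not_lt.mpr h.le)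
  -- Split off from the right of `w` an alternating word in `s_i`, `s_j` that ends in `s_j`, with
  -- lengths adding up. For the longest such word the remaining factor `v` is minimal in its coset
  -- of the dihedral subgroup.
  let p : ℕ → Prop := fun k => ∃ v, w = v * cs.wordProd (alternatingWord i j k) ∧
    cs.length v + k = cs.length w
  have hp1 : p 1 := by
    refine ⟨w * cs.simple j, ?_, ?_⟩
    · simp [alternatingWord]
    · exact cs.isRightDescent_iff.mp hj
  have hlen : 1 ≤ cs.length w := by
    obtain ⟨v, _, hv⟩ := hp1
    omega
  classical
  obtain ⟨k, hk1, hk, hmax⟩ : ∃ k, 1 ≤ k ∧ p k ∧ ¬ p (k + 1) := by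
    refine ⟨Nat.findGreatest p (cs.length w), Nat.le_findGreatest hlen hp1,
      Nat.findGreatest_spec hlen hp1, fun h' => ?_⟩
    have h'' := h'
    obtain ⟨v, _, hv⟩ := h''
    exact Nat.findGreatest_is_greatest (Nat.lt_succ_self _) (by omega) h'
  obtain ⟨v, hv, hvl⟩ := hk
  obtain ⟨k', rfl⟩ : ∃ k', k = k' + 1 := ⟨k - 1, by omega⟩
  -- both simple reflections lengthen `v`
  have hasc : cs.length v < cs.length (v * cs.simple i) ∧
      cs.length v < cs.length (v * cs.simple j) := by
    -- The letter that would prolong the alternating word: a descent here contradicts the maximality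
    -- of `k`.
    have hq : cs.length v < cs.length (v * cs.simple (if Even (k' + 1) then j else i)) := by
      by_contra hcon
      have hd := (cs.isRightDescent_iff (w := v)).mp
        (lt_of_le_of_ne (not_lt.mp hcon) (cs.length_mul_simple_ne v _))
      refine hmax ⟨v * cs.simple (if Even (k' + 1) then j else i), ?_, by omega⟩
      rw [alternatingWord_succ' i j (k' + 1), wordProd_cons, mul_assoc,
        simple_mul_simple_cancel_left, hv]
    -- The first letter of the alternating word: a descent here would write `w` with fewer letters
    -- than its length.
    have hpp : cs.length v < cs.length (v * cs.simple (if Even k' then j else i)) := by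
      by_contra hcon
      have hd := (cs.isRightDescent_iff (w := v)).mp
        (lt_of_le_of_ne (not_lt.mp hcon) (cs.length_mul_simple_ne v _))
      have e : w = (v * cs.simple (if Even k' then j else i)) *
          cs.wordProd (alternatingWord i j k') := by
        rw [hv, alternatingWord_succ' i j k', wordProd_cons, mul_assoc]
      have h1 := cs.length_mul_le (v * cs.simple (if Even k' then j else i))
        (cs.wordProd (alternatingWord i j k'))
      have h2 := cs.length_wordProd_le (alternatingWord i j k')
      rw [length_alternatingWord] at h2
      rw [← e] at h1
      omega
    by_cases hk' : Even k'
    · have : ¬ Even (k' + 1) := by simpa [Nat.even_add_one] using hk'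
      simp only [this, hk', if_true, if_false] at hq hpp
      exact ⟨hq, hpp⟩
    · have : Even (k' + 1) := by simpa [Nat.even_add_one] using hk'
      simp only [this, hk', if_true, if_false] at hq hpp
      exact ⟨hpp, hq⟩
  have hvi := ih (cs.length v) (by omega) v i hasc.1 rfl
  have hvj := ih (cs.length v) (by omega) v j hasc.2 rfl
  -- Since `w s_i` is longer than `w`, the alternating word remains reduced after appending `s_i`.
  -- Its length `k' + 2` is then at most `m_ij`, which keeps both dihedral coefficients
  -- non-negative.
  have hm : M i j = 0 ∨ k' + 2 ≤ M i j := by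
    by_contra! hcon
    have hnr := cs.not_isReduced_alternatingWord j i (m := k' + 2)
      (by rw [M.symmetric j i]; exact hcon.1) (by rw [M.symmetric j i]; exact hcon.2)
    apply hnr
    have h1 := cs.length_wordProd_le (alternatingWord j i (k' + 2))
    have h2 : w * cs.simple i = v * cs.wordProd (alternatingWord j i (k' + 2)) := by
      rw [alternatingWord_succ j i (k' + 1), wordProd_concat, ← mul_assoc, ← hv]
    have h3 := cs.length_mul_le v (cs.wordProd (alternatingWord j i (k' + 2)))
    rw [← h2] at h3
    rw [length_alternatingWord] at h1
    rw [IsReduced, length_alternatingWord]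
    omega
  obtain ⟨c, h0, h1, hc, hpos⟩ := exists_dihedral_coeff (M i j) (M.off_diagonal i j hij)
  have e := cs.geomRep_alternatingWord i j c h0 h1 hc (k' + 1)
  have p1 := hpos (k' + 1) (by omega)
  have p2 := hpos (k' + 1 + 1) (by omega)
  rw [hv, geomRep_mul_apply, e]
  split_ifs
  · rw [map_add, map_smul, map_smul]
    exact add_nonneg (smul_nonneg p2 hvi) (smul_nonneg p1 hvj)
  · rw [map_add, map_smul, map_smul]
    exact add_nonneg (smul_nonneg p1 hvi) (smul_nonneg p2 hvj)

lemma geomRep_single_nonpos (w : W) (i : B) (h : cs.length (w * cs.simple i) < cs.length w) :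
    cs.geomRep w (Finsupp.single i 1) ≤ 0 := by
  have := cs.geomRep_single_nonneg (w * cs.simple i) i
    (by rwa [simple_mul_simple_cancel_right])
  rw [geomRep_mul_apply, geomRep_simple_single, map_neg] at this
  exact neg_nonneg.mp this

lemma single_ne_zero (i : B) : (Finsupp.single i 1 : B →₀ ℝ) ≠ 0 := by simp

/-- The geometric representation is faithful. -/
theorem eq_one_of_geomRep (w : W) (h : ∀ v, cs.geomRep w v = v) : w = 1 := by
  by_contra hw
  obtain ⟨j, hj⟩ := cs.exists_rightDescent_of_ne_one hw
  -- At a right descent `j` the root `w α_j` is negative, whereas a `w` acting trivially would fix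
  -- the positive root `α_j`.
  have := cs.geomRep_single_nonpos w j hj
  rw [h] at this
  exact single_ne_zero j (le_antisymm this (by simp))

/-! ### Reflections, their roots and the length function -/

/-- `β` is a root of the reflection `t`. -/
structure IsRootOf (t : W) (β : B →₀ ℝ) : Prop where
  exists_eq : ∃ w i, β = cs.geomRep w (Finsupp.single i 1)
  apply_eq : ∀ v, cs.geomRep t v = v - rootForm M β v • β

variable {cs}

lemma exists_isRootOf {t : W} (ht : cs.IsReflection t) : ∃ β, cs.IsRootOf t β := by
  obtain ⟨w, i, rfl⟩ := ht
  refine ⟨cs.geomRep w (Finsupp.single i 1), ⟨w, i, rfl⟩, fun v => ?_⟩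
  rw [geomRep_mul_apply, geomRep_mul_apply, geomRep_simple, map_sub, map_smul,
    geomRep_apply_inv_self]
  congr 2
  rw [← cs.rootForm_geomRep w, geomRep_apply_inv_self]

lemma isRootOf_conj (w : W) (i : B) :
    cs.IsRootOf (w * cs.simple i * w⁻¹) (cs.geomRep w (Finsupp.single i 1)) := by
  refine ⟨⟨w, i, rfl⟩, fun v => ?_⟩
  rw [geomRep_mul_apply, geomRep_mul_apply, geomRep_simple, map_sub, map_smul,
    geomRep_apply_inv_self]
  congr 2
  rw [← cs.rootForm_geomRep w, geomRep_apply_inv_self]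

namespace IsRootOf

variable {t t' : W} {β β' : B →₀ ℝ}

lemma rootForm_self (h : cs.IsRootOf t β) : rootForm M β β = 2 := by
  obtain ⟨w, i, rfl⟩ := h.exists_eq
  rw [rootForm_geomRep, rootForm_single_self]

lemma ne_zero (h : cs.IsRootOf t β) : β ≠ 0 := by
  rintro rfl
  have := h.rootForm_self
  simp at this

lemma apply_self (h : cs.IsRootOf t β) : cs.geomRep t β = -β := by
  rw [h.apply_eq, h.rootForm_self, two_smul]
  abel

lemma neg_iff (h : cs.IsRootOf t β) (v : B →₀ ℝ) :
    cs.geomRep t v = -v ↔ ∃ c : ℝ, v = c • β := by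
  constructor
  · intro hv
    refine ⟨rootForm M β v / 2, ?_⟩
    rw [h.apply_eq, sub_eq_iff_eq_add] at hv
    have h2 : (2 : ℝ) • v = rootForm M β v • β := by
      rw [two_smul]
      nth_rw 1 [hv]
      abel
    rw [div_eq_inv_mul, mul_smul, ← h2, smul_smul]
    norm_num
  · rintro ⟨c, rfl⟩
    rw [map_smul, h.apply_self, smul_neg]

/-- The form takes the value `2` on every root, so the factor is `±1`, both reflections act by the
same formula, and faithfulness applies. Thus distinct reflections have non-proportional labels. -/
lemma eq_of_eq_smul (h : cs.IsRootOf t β) (h' : cs.IsRootOf t' β') (c : ℝ) (hc : β' = c • β) :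
    t = t' := by
  have hc2 : c * c = 1 := by
    have := h'.rootForm_self
    rw [hc, map_smul, map_smul, LinearMap.smul_apply, h.rootForm_self, smul_eq_mul,
      smul_eq_mul] at this
    linarith
  have key : ∀ v, cs.geomRep t v = cs.geomRep t' v := by
    intro v
    rw [h.apply_eq, h'.apply_eq, hc, map_smul, LinearMap.smul_apply, smul_smul, smul_eq_mul,
      mul_right_comm, hc2, one_mul]
  have : t'⁻¹ * t = 1 := cs.eq_one_of_geomRep _ fun v => by
    rw [geomRep_mul_apply, key, geomRep_inv_apply_self]
  exact (inv_mul_eq_one.mp this).symm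

lemma nonneg_or_nonpos (h : cs.IsRootOf t β) : 0 ≤ β ∨ β ≤ 0 := by
  obtain ⟨w, i, rfl⟩ := h.exists_eq
  rcases lt_or_gt_of_ne (cs.length_mul_simple_ne w i) with hl | hl
  · exact Or.inr (cs.geomRep_single_nonpos w i hl)
  · exact Or.inl (cs.geomRep_single_nonneg w i hl)

lemma neg (h : cs.IsRootOf t β) : cs.IsRootOf t (-β) := by
  obtain ⟨w, i, hw⟩ := h.exists_eq
  refine ⟨⟨w * cs.simple i, i, ?_⟩, fun v => ?_⟩
  · rw [geomRep_mul_apply, geomRep_simple_single, map_neg, hw]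
  · rw [h.apply_eq]
    simp

lemma conj (h : cs.IsRootOf t β) (a : W) : cs.IsRootOf (a * t * a⁻¹) (cs.geomRep a β) := by
  obtain ⟨w, i, hw⟩ := h.exists_eq
  refine ⟨⟨a * w, i, ?_⟩, fun v => ?_⟩
  · rw [geomRep_mul_apply, hw]
  · rw [geomRep_mul_apply, geomRep_mul_apply, h.apply_eq, map_sub, map_smul,
      geomRep_apply_inv_self]
    congr 2
    rw [← cs.rootForm_geomRep a, geomRep_apply_inv_self]

/-- The reflection `s_i` changes only the coordinate at `α_i`. If it made `β` negative, all other
coordinates of `β` would vanish, and `β` would be a multiple of `α_i`. -/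
lemma nonneg_of_simple (h : cs.IsRootOf t β) (i : B) (hβ : 0 ≤ β) (hne : t ≠ cs.simple i) :
    0 ≤ cs.geomRep (cs.simple i) β := by
  refine (h.conj (cs.simple i)).nonneg_or_nonpos.resolve_right fun hcon => hne ?_
  have hs : cs.IsRootOf (cs.simple i) (Finsupp.single i 1) := by
    simpa [geomRep_one_apply] using isRootOf_conj (cs := cs) 1 i
  refine (hs.eq_of_eq_smul h (β i) ?_).symm
  rw [geomRep_simple] at hcon
  ext j
  by_cases hij : i = j
  · subst hij
    simp
  · have h1 := hcon j
    have h2 := hβ j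
    simp [Finsupp.single_eq_of_ne (Ne.symm hij)] at h1 h2 ⊢
    linarith

/-- If `a⁻¹ β` is negative for the positive root `β` of `t`, then `t a` is shorter than `a`. -/
lemma length_lt_of_nonpos (h : cs.IsRootOf t β) (hβ : 0 ≤ β) (a : W)
    (ha : cs.geomRep a⁻¹ β ≤ 0) : cs.length (t * a) < cs.length a := by
  induction hn : cs.length a using Nat.strong_induction_on generalizing a t β with
  | _ n ih =>
  have ha1 : a ≠ 1 := by
    rintro rfl
    rw [inv_one, geomRep_one_apply] at ha
    exact h.ne_zero (le_antisymm ha hβ)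
  -- Strip a left descent `s_i` from `a`. Unless `t = s_i`, conjugating by `s_i` keeps the root
  -- positive, and the induction hypothesis for `s_i a` bounds the length of `s_i t a`, hence that
  -- of `t a`.
  obtain ⟨i, hi⟩ := cs.exists_leftDescent_of_ne_one ha1
  have hi' := cs.isLeftDescent_iff.mp hi
  by_cases hti : t = cs.simple i
  · rw [hti]
    omega
  have hc := h.conj (cs.simple i)
  have hpos := h.nonneg_of_simple i hβ hti
  have key := ih (cs.length (cs.simple i * a)) (by omega) hc hpos (cs.simple i * a) (by
    rw [mul_inv_rev, inv_simple, geomRep_mul_apply, ← geomRep_mul_apply _ (cs.simple i),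
      simple_mul_simple_self, geomRep_one_apply]
    exact ha) rfl
  have e : cs.simple i * t * (cs.simple i)⁻¹ * (cs.simple i * a) = cs.simple i * (t * a) := by
    group
  rw [e] at key
  have := cs.length_simple_mul (t * a) i
  omega

end IsRootOf

/-- If left multiplication by the reflection `t` lengthens `a`, it lengthens `a s`, unless
`t a = a s`. -/
theorem IsReflection.length_lt_mul_simple {t : W} (ht : cs.IsReflection t) (a : W) (i : B)
    (h : cs.length a < cs.length (t * a)) (hne : t * a ≠ a * cs.simple i) :
    cs.length (a * cs.simple i) < cs.length (t * (a * cs.simple i)) := by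
  obtain ⟨β, hβ, hpos⟩ : ∃ β, cs.IsRootOf t β ∧ 0 ≤ β := by
    obtain ⟨β, hβ⟩ := exists_isRootOf ht
    rcases hβ.nonneg_or_nonpos with h | h
    · exact ⟨β, hβ, h⟩
    · exact ⟨-β, hβ.neg, neg_nonneg.mpr h⟩
  -- The sign of `a⁻¹ β` decides whether `t` lengthens `a`. Here it is positive, and `s_i` preserves
  -- this unless `a⁻¹ t a = s_i`. The length criterion is then used for `t a s_i`, whose inverse
  -- sends `β` to a negative root.
  have h1 : 0 ≤ cs.geomRep a⁻¹ β := by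
    refine ((hβ.conj a⁻¹).nonneg_or_nonpos).resolve_right fun hcon => ?_
    have := hβ.length_lt_of_nonpos hpos a hcon
    omega
  have h2 := (hβ.conj a⁻¹).nonneg_of_simple i h1 (by
    intro e
    apply hne
    rw [← e]
    group)
  have h3 := hβ.length_lt_of_nonpos hpos (t * (a * cs.simple i)) (by
    rw [mul_inv_rev, geomRep_mul_apply, ht.inv, hβ.apply_self, map_neg, mul_inv_rev,
      geomRep_mul_apply, inv_simple]
    exact neg_nonpos.mpr h2)
  rwa [← mul_assoc, ht.mul_self, one_mul] at h3

end CoxeterSystem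

namespace CoxeterSystem

universe u v

variable {B : Type u} {W : Type v} [Group W] {M : CoxeterMatrix B}

/-! ### Edges of the Bruhat graph and the lifting property -/

/-- There is an edge `y → z` in the Bruhat graph. -/
def Edge (cs : CoxeterSystem M W) (y z : W) : Prop :=
  cs.IsReflection (z * y⁻¹) ∧ cs.length y < cs.length z

variable {cs : CoxeterSystem M W}

lemma bruhatStep_iff {y z : W} : cs.BruhatStep y z ↔ cs.Edge y z := by
  constructor
  · rintro ⟨t, ht, rfl, h⟩
    exact ⟨by simpa using ht, h⟩
  · rintro ⟨ht, h⟩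
    exact ⟨z * y⁻¹, ht, by simp, h⟩

lemma Edge.le {y z : W} (h : cs.Edge y z) : cs.BruhatLE y z :=
  Relation.ReflTransGen.single (bruhatStep_iff.mpr h)

lemma Edge.lt {y z : W} (h : cs.Edge y z) : cs.BruhatLT y z :=
  ⟨h.le, fun e => by have := h.2; rw [e] at this; exact lt_irrefl _ this⟩

lemma BruhatLE.trans {a b c : W} (h : cs.BruhatLE a b) (h' : cs.BruhatLE b c) :
    cs.BruhatLE a c :=
  Relation.ReflTransGen.trans h h'

lemma BruhatLT.trans_le {a b c : W} (h : cs.BruhatLT a b) (h' : cs.BruhatLE b c) :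
    cs.BruhatLT a c :=
  ⟨h.1.trans h', fun e => by
    have := h.length_lt
    have := h'.length_le
    rw [e] at *
    omega⟩

lemma mul_simple_mul_inv_eq (y z : W) (i : B) :
    z * cs.simple i * (y * cs.simple i)⁻¹ = z * y⁻¹ := by
  rw [mul_inv_rev]
  group

lemma Edge.mul_simple {y z : W} (h : cs.Edge y z) (i : B) (hne : z ≠ y * cs.simple i) :
    cs.Edge (y * cs.simple i) (z * cs.simple i) := by
  refine ⟨by rw [mul_simple_mul_inv_eq]; exact h.1, ?_⟩
  have := h.1.length_lt_mul_simple y i (by simpa using h.2) (by simpa using hne)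
  rwa [← mul_assoc, inv_mul_cancel_right] at this

lemma edge_mul_simple {y : W} {i : B} (h : cs.length y < cs.length (y * cs.simple i)) :
    cs.Edge y (y * cs.simple i) :=
  ⟨⟨y, i, rfl⟩, h⟩

lemma mul_simple_ne_self (y : W) (i : B) : y * cs.simple i ≠ y := fun h => by
  have := cs.length_mul_simple_ne y i
  rw [h] at this
  exact this rfl

/-- A form of the lifting property without case distinction on descents. Follow a chain of edges
from `a` to `b`: right multiplication by `s` maps edges to edges, except for an edge from some `c`
to `c s`, and such an edge interchanges the two alternatives. -/
lemma BruhatLE.mul_simple {a b : W} (h : cs.BruhatLE a b) (i : B) :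
    cs.BruhatLE (a * cs.simple i) (b * cs.simple i) ∨
      (cs.BruhatLE (a * cs.simple i) b ∧ cs.BruhatLE a (b * cs.simple i)) := by
  induction h with
  | refl => exact Or.inl Relation.ReflTransGen.refl
  | @tail b c hab hbc ih =>
    have hbc := bruhatStep_iff.mp hbc
    by_cases hc : c = b * cs.simple i
    · subst hc
      rw [simple_mul_simple_cancel_right]
      rcases ih with h | h
      · exact Or.inr ⟨h, hab⟩
      · exact Or.inl h.1
    · have hs := (hbc.mul_simple i hc).le
      rcases ih with h | h
      · exact Or.inl (h.trans hs)
      · exact Or.inr ⟨h.1.trans hbc.le, h.2.trans hs⟩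

/-- The elements above the lower element `y` of a coset are stable under right multiplication by
`s`. -/
lemma BruhatLE.mul_simple_of_lower {y u : W} {i : B}
    (hy : cs.length y < cs.length (y * cs.simple i)) (h : cs.BruhatLE y u) :
    cs.BruhatLE y (u * cs.simple i) := by
  rcases h.mul_simple i with h' | h'
  · exact (edge_mul_simple hy).le.trans h'
  · exact h'.2

lemma BruhatLE.upper_le_of_lower {y u : W} {i : B} (h : cs.BruhatLE y u)
    (hu : cs.length (u * cs.simple i) < cs.length u) : cs.BruhatLE (y * cs.simple i) u := by
  have hu' := edge_mul_simple (cs := cs) (y := u * cs.simple i) (i := i)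
    (by rwa [simple_mul_simple_cancel_right])
  rw [simple_mul_simple_cancel_right] at hu'
  rcases h.mul_simple i with h' | h'
  · exact h'.trans hu'.le
  · exact h'.1

/-! ### Labels -/

lemma linearForm_injective : Function.Injective (linearForm B) :=
  MvPolynomial.linearIndependent_X B ℝ

/-- An element `α_t` of the line on which the reflection `t` acts by `-1`. -/
noncomputable def label (cs : CoxeterSystem M W) (t : W) : PolyV B :=
  open Classical in
  if h : cs.IsReflection t then linearForm B (exists_isRootOf h).choose else 0

lemma exists_label_eq {t : W} (ht : cs.IsReflection t) :
    ∃ β, cs.IsRootOf t β ∧ cs.label t = linearForm B β :=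
  ⟨_, (exists_isRootOf ht).choose_spec, dif_pos ht⟩

lemma label_mem (t : W) : cs.label t ∈ symGr B 2 := by
  rw [label]
  split_ifs
  · exact linearForm_mem _
  · exact zero_mem _

lemma label_ne_zero {t : W} (ht : cs.IsReflection t) : cs.label t ≠ 0 := by
  obtain ⟨β, hβ, e⟩ := exists_label_eq ht
  rw [e]
  exact (map_ne_zero_iff _ linearForm_injective).mpr hβ.ne_zero

lemma labelIdeal_eq {t : W} (ht : cs.IsReflection t) :
    cs.labelIdeal t = Ideal.span {cs.label t} := by
  obtain ⟨β, hβ, e⟩ := exists_label_eq ht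
  rw [e, labelIdeal]
  apply le_antisymm
  · rw [Ideal.span_le]
    rintro _ ⟨v, hv, rfl⟩
    obtain ⟨c, rfl⟩ := (hβ.neg_iff v).mp hv
    rw [map_smul, MvPolynomial.smul_eq_C_mul]
    exact Ideal.mul_mem_left _ _ (Ideal.mem_span_singleton_self _)
  · rw [Ideal.span_singleton_le_iff_mem]
    exact Ideal.subset_span ⟨β, hβ.apply_self, rfl⟩

lemma mem_labelSMul {t : W} (ht : cs.IsReflection t) {P : Type u} [AddCommGroup P]
    [Module (PolyV B) P] {v : P} :
    v ∈ cs.labelSMul t P ↔ ∃ u, v = cs.label t • u := by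
  rw [labelSMul, labelIdeal_eq ht, Submodule.ideal_span_singleton_smul,
    Submodule.mem_smul_pointwise_iff_exists]
  exact ⟨fun ⟨u, _, hu⟩ => ⟨u, hu.symm⟩, fun ⟨u, hu⟩ => ⟨u, trivial, hu.symm⟩⟩

/-- A polynomial ring modulo a non-zero linear form is a domain, in which another linear form
vanishes only if the two are proportional. -/
lemma linearForm_dvd_of_dvd_mul {β β' : B →₀ ℝ} (h0 : β ≠ 0) (h : ∀ c : ℝ, β' ≠ c • β)
    {p : PolyV B} (hp : linearForm B β ∣ linearForm B β' * p) : linearForm B β ∣ p := by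
  classical
  obtain ⟨i, hi⟩ := Finsupp.ne_iff.mp h0
  rw [Finsupp.zero_apply] at hi
  -- Pick a coordinate with `β i ≠ 0` and eliminate `X i`: `σ` kills `β` and is the identity modulo
  -- `β`. So divisibility by `β` means being killed by `σ`, whose target is a domain.
  let σ : PolyV B →ₐ[ℝ] PolyV B := MvPolynomial.aeval fun j =>
    MvPolynomial.X j - linearForm B ((Finsupp.single j (1 : ℝ) i * (β i)⁻¹) • β)
  have hσ : ∀ v : B →₀ ℝ, σ (linearForm B v) = linearForm B (v - (v i * (β i)⁻¹) • β) := by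
    intro v
    induction v using Finsupp.induction_linear with
    | zero => simp
    | add f g hf hg =>
      rw [map_add, map_add, hf, hg, ← map_add]
      congr 1
      rw [Finsupp.add_apply]
      module
    | single j r =>
      have : (Finsupp.single j r : B →₀ ℝ) = r • Finsupp.single j 1 := by simp
      rw [this, map_smul, map_smul]
      have e : linearForm B (Finsupp.single j 1) = MvPolynomial.X j := by simp [linearForm]
      rw [e, MvPolynomial.aeval_X, ← e, ← map_sub, ← map_smul]
      congr 1
      rw [Finsupp.smul_apply, smul_eq_mul]
      module
  have hσβ : σ (linearForm B β) = 0 := by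
    rw [hσ, mul_inv_cancel₀ hi, one_smul, sub_self, map_zero]
  have hdiff : ∀ q : PolyV B, linearForm B β ∣ q - σ q := by
    intro q
    rw [← Ideal.mem_span_singleton, ← Ideal.Quotient.eq]
    have : (Ideal.Quotient.mkₐ ℝ (Ideal.span {linearForm B β})) =
        (Ideal.Quotient.mkₐ ℝ (Ideal.span {linearForm B β})).comp σ := by
      refine MvPolynomial.algHom_ext fun j => ?_
      rw [AlgHom.comp_apply, MvPolynomial.aeval_X, map_sub, eq_comm, sub_eq_self, map_smul,
        map_smul, Ideal.Quotient.mkₐ_eq_mk,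
        Ideal.Quotient.eq_zero_iff_mem.mpr (Ideal.mem_span_singleton_self _), smul_zero]
    exact congrArg (fun f => f q) this
  obtain ⟨r, hr⟩ := hp
  have h1 := congrArg σ hr
  rw [map_mul, map_mul, hσβ, zero_mul, mul_eq_zero] at h1
  have h2 := h1.resolve_left fun h2 => by
    rw [hσ, map_eq_zero_iff _ linearForm_injective, sub_eq_zero] at h2
    exact h _ h2
  have h3 := hdiff p
  rwa [h2, sub_zero] at h3

lemma label_dvd_of_dvd_mul {t t' : W} (ht : cs.IsReflection t) (ht' : cs.IsReflection t')
    (hne : t ≠ t') {p : PolyV B} (h : cs.label t ∣ cs.label t' * p) : cs.label t ∣ p := by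
  obtain ⟨β, hβ, e⟩ := exists_label_eq ht
  obtain ⟨β', hβ', e'⟩ := exists_label_eq ht'
  rw [e, e'] at h
  rw [e]
  exact linearForm_dvd_of_dvd_mul hβ.ne_zero
    (fun c hc => hne (hβ.eq_of_eq_smul hβ' c hc)) h

/-- The linear form `w α_i`. -/
noncomputable def rootPoly (cs : CoxeterSystem M W) (i : B) (w : W) : PolyV B :=
  linearForm B (cs.geomRep w (Finsupp.single i 1))

lemma rootPoly_mem (i : B) (w : W) : cs.rootPoly i w ∈ symGr B 2 := linearForm_mem _

lemma rootPoly_mul_simple (i : B) (w : W) :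
    cs.rootPoly i (w * cs.simple i) = -cs.rootPoly i w := by
  rw [rootPoly, geomRep_mul_apply, geomRep_simple_single, map_neg, map_neg, rootPoly]

lemma exists_rootPoly_eq (i : B) (w : W) :
    ∃ c : ℝ, c ≠ 0 ∧ cs.rootPoly i w = MvPolynomial.C c * cs.label (w * cs.simple i * w⁻¹) := by
  obtain ⟨β, hβ, e⟩ := exists_label_eq (cs := cs) (t := w * cs.simple i * w⁻¹) ⟨w, i, rfl⟩
  have h := isRootOf_conj (cs := cs) w i
  obtain ⟨c, hc⟩ := (hβ.neg_iff _).mp h.apply_self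
  refine ⟨c, ?_, ?_⟩
  · rintro rfl
    rw [zero_smul] at hc
    exact h.ne_zero hc
  · rw [e, rootPoly, hc, map_smul, MvPolynomial.smul_eq_C_mul]

/-- A reflection moves every vector by a multiple of its root. Hence `w ↦ w α_i` is a section of the
structure sheaf, which is what lets it multiply sections of other sheaves. -/
lemma exists_rootPoly_sub_eq (i : B) {y z : W} (h : cs.IsReflection (z * y⁻¹)) :
    ∃ c : ℝ, cs.rootPoly i z - cs.rootPoly i y = MvPolynomial.C c * cs.label (z * y⁻¹) := by
  obtain ⟨β, hβ, e⟩ := exists_label_eq h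
  refine ⟨-rootForm M β (cs.geomRep y (Finsupp.single i 1)), ?_⟩
  have hz : cs.geomRep z (Finsupp.single i 1) =
      cs.geomRep (z * y⁻¹) (cs.geomRep y (Finsupp.single i 1)) := by
    rw [← geomRep_mul_apply, inv_mul_cancel_right]
  rw [e, rootPoly, rootPoly, ← map_sub, hz, hβ.apply_eq, ← MvPolynomial.smul_eq_C_mul, ← map_smul]
  congr 1
  module

end CoxeterSystem

/-! ### Graded projective modules -/

section GradedProjective

open CoxeterSystem

universe u w w'

variable {B : Type u}

lemma symGr_of_mul {i k : ℤ} {a f : PolyV B} (ha : a ∈ symGr B i) (ha0 : a ≠ 0)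
    (h : a * f ∈ symGr B (i + k)) : f ∈ symGr B k := by
  have hz : ∀ j, j ≠ k → (symMod B).proj j f = 0 := by
    intro j hj
    have h1 := (symMod B).proj_smul (k := i + j) ha f
    have h2 : (symMod B).proj (i + j) (a • f) = 0 :=
      (symMod B).proj_of_ne (v := a • f) h (by omega)
    rw [h2, add_sub_cancel_left] at h1
    exact (mul_eq_zero.mp h1.symm).resolve_left ha0
  obtain ⟨s, hs⟩ := (symMod B).sum_proj f
  have := hs (insert k s) (Finset.subset_insert _ _)
  rw [Finset.sum_eq_single k (fun j _ hj => hz j hj)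
    (fun h => absurd (Finset.mem_insert_self _ _) h)] at this
  rw [← this]
  exact (symMod B).proj_mem k f

lemma mem_freeMod_gr {n : ℕ} {d : Fin n → ℤ} {k : ℤ} {v : Fin n → PolyV B} :
    v ∈ (freeMod d).gr k ↔ ∀ j, v j ∈ symGr B (k - d j) :=
  ⟨fun h j => h j trivial, fun h j _ => h j⟩

/-- The grading is compatible with that of the ring. -/
def IsGradedSMul (B : Type u) {M : Type w} [AddCommGroup M] [Module (PolyV B) M]
    (ℳ : ℤ → AddSubgroup M) : Prop :=
  ∀ (i j : ℤ) (a : PolyV B) (m : M), a ∈ symGr B i → m ∈ ℳ j → a • m ∈ ℳ (i + j)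

/-- The graded module `M` is a direct summand of a graded free module of finite rank. -/
def IsGradedProjective (B : Type u) {M : Type w} [AddCommGroup M] [Module (PolyV B) M]
    (ℳ : ℤ → AddSubgroup M) : Prop :=
  ∃ (n : ℕ) (d : Fin n → ℤ) (i : M →ₗ[PolyV B] (Fin n → PolyV B))
    (p : (Fin n → PolyV B) →ₗ[PolyV B] M), IsDegZero ℳ (freeMod d).gr i ∧
      IsDegZero (freeMod d).gr ℳ p ∧ ∀ m, p (i m) = m

namespace IsGradedProjective

variable {M : Type w} [AddCommGroup M] [Module (PolyV B) M] {ℳ : ℤ → AddSubgroup M}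
  {N : Type w'} [AddCommGroup N] [Module (PolyV B) N] {𝒩 : ℤ → AddSubgroup N}

lemma isGradedSMul (h : IsGradedProjective B ℳ) : IsGradedSMul B ℳ := by
  obtain ⟨n, d, i, p, hi, hp, hpi⟩ := h
  intro k l a m ha hm
  rw [← hpi (a • m), map_smul]
  exact hp _ _ ((freeMod d).smul_mem ha (hi _ _ hm))

lemma finite (h : IsGradedProjective B ℳ) : Module.Finite (PolyV B) M := by
  obtain ⟨n, d, i, p, hi, hp, hpi⟩ := h
  exact Module.Finite.of_surjective p fun m => ⟨i m, hpi m⟩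

/-- Maps out of a graded projective module can be chosen within a given relation. -/
lemma exists_lift (h : IsGradedProjective B ℳ) (h𝒩 : IsGradedSMul B 𝒩)
    (T : Submodule (PolyV B) (M × N)) (hT : ∀ k, ∀ m ∈ ℳ k, ∃ n ∈ 𝒩 k, (m, n) ∈ T) :
    ∃ g : M →ₗ[PolyV B] N, IsDegZero ℳ 𝒩 g ∧ ∀ m, (m, g m) ∈ T := by
  classical
  obtain ⟨n, d, i, p, hi, hp, hpi⟩ := h
  -- Choose partners of the images of the standard generators, extend linearly over the free module,
  -- and restrict along the inclusion of the summand.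
  choose q hq hqT using fun j : Fin n => hT (d j) _ (hp _ _ (single_mem d j))
  have hdz := linearCombination_mem (d := d) (fun {i j a m} => h𝒩 i j a m) hq
  refine ⟨Fintype.linearCombination (PolyV B) q ∘ₗ i, fun k v hv => hdz _ _ (hi _ _ hv),
    fun m => ?_⟩
  have : (m, (Fintype.linearCombination (PolyV B) q ∘ₗ i) m) =
      ∑ j, i m j • (p (Pi.single j 1), q j) := by
    rw [LinearMap.comp_apply, Fintype.linearCombination_apply, ← hpi m]
    refine Prod.ext ?_ ?_
    · rw [Prod.fst_sum]
      conv_lhs => rw [pi_eq_sum_univ' (i m), map_sum]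
      simp [hpi]
    · rw [Prod.snd_sum]
      simp [hpi]
  rw [this]
  exact sum_mem fun j _ => T.smul_mem _ (hqT j)

lemma of_retract (h : IsGradedProjective B ℳ) (i' : N →ₗ[PolyV B] M) (p' : M →ₗ[PolyV B] N)
    (hi' : IsDegZero 𝒩 ℳ i') (hp' : IsDegZero ℳ 𝒩 p') (hpi' : ∀ m, p' (i' m) = m) :
    IsGradedProjective B 𝒩 := by
  obtain ⟨n, d, i, p, hi, hp, hpi⟩ := h
  exact ⟨n, d, i ∘ₗ i', p' ∘ₗ p, fun k v hv => hi _ _ (hi' _ _ hv),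
    fun k v hv => hp' _ _ (hp _ _ hv), fun m => by simp [hpi, hpi']⟩

lemma of_equiv (h : IsGradedProjective B ℳ) (e : M ≃ₗ[PolyV B] N) (δ : ℤ)
    (he : ∀ k v, v ∈ ℳ k ↔ e v ∈ 𝒩 (k + δ)) : IsGradedProjective B 𝒩 := by
  obtain ⟨n, d, i, p, hi, hp, hpi⟩ := h
  refine ⟨n, fun j => d j + δ, i ∘ₗ e.symm.toLinearMap, e.toLinearMap ∘ₗ p, ?_, ?_, ?_⟩
  · intro k v hv
    have h1 : e.symm v ∈ ℳ (k - δ) := by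
      rw [he, e.apply_symm_apply, sub_add_cancel]
      exact hv
    have h2 := mem_freeMod_gr.mp (hi _ _ h1)
    refine mem_freeMod_gr.mpr fun j => ?_
    have := h2 j
    rwa [sub_sub, add_comm δ] at this
  · intro k v hv
    have h1 : v ∈ (freeMod d).gr (k - δ) := by
      refine mem_freeMod_gr.mpr fun j => ?_
      have := mem_freeMod_gr.mp hv j
      rwa [sub_sub, add_comm δ]
    have h2 := (he _ _).mp (hp _ _ h1)
    rwa [sub_add_cancel] at h2
  · intro m
    simp [hpi]

lemma of_fintype {ι : Type*} [Fintype ι] (d : ι → ℤ) (i : M →ₗ[PolyV B] (ι → PolyV B))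
    (p : (ι → PolyV B) →ₗ[PolyV B] M) (hi : ∀ k, ∀ m ∈ ℳ k, ∀ j, i m j ∈ symGr B (k - d j))
    (hp : ∀ k v, (∀ j, v j ∈ symGr B (k - d j)) → p v ∈ ℳ k) (hpi : ∀ m, p (i m) = m) :
    IsGradedProjective B ℳ := by
  let e := LinearEquiv.funCongrLeft (PolyV B) (PolyV B) (Fintype.equivFin ι)
  refine ⟨Fintype.card ι, d ∘ (Fintype.equivFin ι).symm, e.symm.toLinearMap ∘ₗ i,
    p ∘ₗ e.toLinearMap, ?_, ?_, ?_⟩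
  · intro k v hv
    exact mem_freeMod_gr.mpr fun j => hi k v hv _
  · intro k v hv
    refine hp _ _ fun j => ?_
    have := mem_freeMod_gr.mp hv (Fintype.equivFin ι j)
    rwa [Function.comp_apply, Equiv.symm_apply_apply] at this
  · intro m
    simp [hpi]

/-- An extension of graded projective modules is graded projective. -/
lemma of_exact {A : Type*} [AddCommGroup A] [Module (PolyV B) A] {𝒜 : ℤ → AddSubgroup A}
    {C : Type*} [AddCommGroup C] [Module (PolyV B) C] {𝒞 : ℤ → AddSubgroup C}
    (hA : IsGradedProjective B 𝒜) (hC : IsGradedProjective B 𝒞) (hM : IsGradedSMul B ℳ)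
    (j : A →ₗ[PolyV B] M) (f : M →ₗ[PolyV B] C) (hf : IsDegZero ℳ 𝒞 f)
    (hj : ∀ k a, a ∈ 𝒜 k ↔ j a ∈ ℳ k) (hinj : Function.Injective j)
    (hex : ∀ m, f m = 0 → ∃ a, j a = m)
    (hsurj : ∀ k, ∀ c ∈ 𝒞 k, ∃ m ∈ ℳ k, f m = c) : IsGradedProjective B ℳ := by
  -- A graded section `σ` of `f` exists because `𝒞` is graded projective. Then `m ↦ m - σ (f m)` is
  -- a retraction onto the kernel, and `M` is a summand of the sum of the two free modules.
  obtain ⟨σ, hσ, hσf⟩ := hC.exists_lift hM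
    ((LinearMap.ker ((LinearMap.fst (PolyV B) C M) - f ∘ₗ LinearMap.snd (PolyV B) C M)))
    (fun k c hc => by
      obtain ⟨m, hm, rfl⟩ := hsurj k c hc
      exact ⟨m, hm, by simp⟩)
  have hσf : ∀ c, f (σ c) = c := fun c => by
    have := hσf c
    simp only [LinearMap.mem_ker, LinearMap.sub_apply, LinearMap.fst_apply,
      LinearMap.comp_apply, LinearMap.snd_apply, sub_eq_zero] at this
    exact this.symm
  have hr : ∀ m, ∃ a, j a = m - σ (f m) := fun m => hex _ (by rw [map_sub, hσf, sub_self])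
  choose r0 hr0 using hr
  let r : M →ₗ[PolyV B] A :=
    { toFun := r0
      map_add' := fun x y => hinj (by simp only [hr0, map_add]; abel)
      map_smul' := fun a x => hinj (by simp only [hr0, map_smul, smul_sub, RingHom.id_apply]) }
  have hr' : ∀ m, j (r m) = m - σ (f m) := hr0
  obtain ⟨n, d, i, p, hi, hp, hpi⟩ := hA
  obtain ⟨n', d', i', p', hi', hp', hpi'⟩ := hC
  refine of_fintype (Sum.elim d d')
    ((LinearEquiv.sumArrowLequivProdArrow (Fin n) (Fin n') (PolyV B) (PolyV B)).symm.toLinearMap ∘ₗ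
      LinearMap.prod (i ∘ₗ r) (i' ∘ₗ f))
    (LinearMap.coprod (j ∘ₗ p) (σ ∘ₗ p') ∘ₗ
      (LinearEquiv.sumArrowLequivProdArrow (Fin n) (Fin n') (PolyV B) (PolyV B)).toLinearMap)
    ?_ ?_ ?_
  · intro k m hm
    have hrm : r m ∈ 𝒜 k := by
      rw [hj, hr']
      exact sub_mem hm (hσ _ _ (hf _ _ hm))
    rintro (a | b)
    · exact mem_freeMod_gr.mp (hi _ _ hrm) a
    · exact mem_freeMod_gr.mp (hi' _ _ (hf _ _ hm)) b
  · intro k v hv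
    refine add_mem ((hj _ _).mp (hp _ _ ?_)) (hσ _ _ (hp' _ _ ?_))
    · exact mem_freeMod_gr.mpr fun a => hv (Sum.inl a)
    · exact mem_freeMod_gr.mpr fun b => hv (Sum.inr b)
  · intro m
    simp [hpi, hpi', hr']

lemma of_subsingleton [Subsingleton M] : IsGradedProjective B ℳ := by
  refine ⟨0, Fin.elim0, 0, 0, ?_, ?_, fun m => Subsingleton.elim _ _⟩
  · intro k v _
    exact zero_mem _
  · intro k v _
    exact zero_mem _

lemma symGr : IsGradedProjective B (symGr B) := by
  refine of_fintype (ι := Unit) (fun _ => 0) (LinearMap.pi fun _ => LinearMap.id)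
    (LinearMap.proj ()) ?_ ?_ ?_
  · intro k m hm j
    simpa using hm
  · intro k v hv
    simpa using hv ()
  · intro m
    rfl

lemma smul_eq_zero (h : IsGradedProjective B ℳ) {a : PolyV B} (ha : a ≠ 0) {m : M}
    (hm : a • m = 0) : m = 0 := by
  obtain ⟨n, d, i, p, hi, hp, hpi⟩ := h
  have h1 := congrArg i hm
  rw [map_smul, map_zero] at h1
  rw [← hpi m, (_root_.smul_eq_zero.mp h1).resolve_left ha, map_zero]

lemma smul_injective (h : IsGradedProjective B ℳ) {a : PolyV B} (ha : a ≠ 0) {m m' : M}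
    (hm : a • m = a • m') : m = m' := by
  rw [← sub_eq_zero] at hm ⊢
  rw [← smul_sub] at hm
  exact h.smul_eq_zero ha hm

lemma mem_of_smul_mem (h : IsGradedProjective B ℳ) {i k : ℤ} {a : PolyV B}
    (ha : a ∈ CoxeterSystem.symGr B i) (ha0 : a ≠ 0) {m : M} (hm : a • m ∈ ℳ (i + k)) :
    m ∈ ℳ k := by
  obtain ⟨n, d, ι, p, hi, hp, hpi⟩ := h
  rw [← hpi m]
  refine hp _ _ (mem_freeMod_gr.mpr fun j => ?_)
  have := mem_freeMod_gr.mp (hi _ _ hm) j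
  rw [map_smul, add_sub_assoc] at this
  exact symGr_of_mul ha ha0 this

/-- Divisibility is checked on the coordinates in an ambient free module, where labels of distinct
reflections are coprime, and the quotient is projected back to the summand. -/
lemma exists_eq_label_smul {W : Type*} [Group W] {C : CoxeterMatrix B} {cs : CoxeterSystem C W}
    (h : IsGradedProjective B ℳ) {t t' : W} (ht : cs.IsReflection t)
    (ht' : cs.IsReflection t') (hne : t ≠ t') {m m' : M}
    (hm : cs.label t' • m = cs.label t • m') : ∃ m'', m = cs.label t • m'' := by
  obtain ⟨n, d, i, p, hi, hp, hpi⟩ := h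
  have h1 : ∀ j, cs.label t ∣ i m j := fun j => by
    refine label_dvd_of_dvd_mul ht ht' hne ⟨i m' j, ?_⟩
    have := congrFun (congrArg i hm) j
    rw [map_smul, map_smul] at this
    exact this
  choose c hc using h1
  refine ⟨p c, ?_⟩
  rw [← map_smul]
  conv_lhs => rw [← hpi m]
  congr 1
  funext j
  exact hc j

lemma homogeneous_top (h : IsGradedProjective B ℳ) :
    IsHomogeneousSubmodule ℳ (⊤ : Submodule (PolyV B) M) := by
  classical
  obtain ⟨n, d, i, p, hi, hp, hpi⟩ := h
  rw [IsHomogeneousSubmodule, eq_top_iff]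
  intro m _
  rw [← hpi m, pi_eq_sum_univ' (i m), map_sum]
  refine sum_mem fun j _ => ?_
  rw [map_smul]
  exact Submodule.smul_mem _ _ (Submodule.subset_span ⟨trivial, d j, hp _ _ (single_mem d j)⟩)

/-- A submodule that contains all homogeneous elements is everything. -/
lemma mem_of_homogeneous (h : IsGradedProjective B ℳ) (Q : Submodule (PolyV B) M)
    (hQ : ∀ k, ∀ m ∈ ℳ k, m ∈ Q) (m : M) : m ∈ Q := by
  have h1 : Submodule.span (PolyV B) {v | v ∈ (⊤ : Submodule (PolyV B) M) ∧ ∃ k, v ∈ ℳ k} ≤ Q := by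
    rw [Submodule.span_le]
    rintro v ⟨_, k, hv⟩
    exact hQ k v hv
  have h2 := h.homogeneous_top
  rw [IsHomogeneousSubmodule] at h2
  rw [h2] at h1
  exact h1 trivial

lemma indepGr (h : IsGradedProjective B ℳ) : IndepGr ℳ := by
  obtain ⟨n, d, i, p, hi, hp, hpi⟩ := h
  intro s x hx h0 k hk
  have h1 := (freeMod d).indep s (fun k => i (x k)) (fun k => hi _ _ (hx k))
    (by rw [← map_sum, h0, map_zero]) k hk
  rw [← hpi (x k)]
  exact (congrArg p h1).trans (map_zero p)

/-- A graded projective module of finite rank is graded free. -/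
theorem exists_basis (h : IsGradedProjective B ℳ) :
    ∃ (n : ℕ) (d : Fin n → ℤ) (e : (Fin n → PolyV B) ≃ₗ[PolyV B] M),
      IsGradedIso (freeMod d).gr ℳ e := by
  have hfin := h.finite
  obtain ⟨n, d, q, hq⟩ := exists_projectiveCover (ℳ := ℳ)
    (fun {i j a m} => h.isGradedSMul i j a m) h.indepGr ⊤ h.homogeneous_top hfin.fg_top
  set π := Fintype.linearCombination (PolyV B) q with hπ
  have hsurj : ∀ k, ∀ m ∈ ℳ k, ∃ v ∈ (freeMod d).gr k, π v = m := by
    intro k m hm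
    obtain ⟨n', d', i, p, hi, hp, hpi⟩ := h
    have hr : m ∈ LinearMap.range π := by
      rw [hq.range_eq]
      trivial
    obtain ⟨v, hv⟩ := hr
    have h1 := map_proj_eq (P := freeMod d) (P' := freeMod d')
      (show IndepGr ℳ from IsGradedProjective.indepGr ⟨n', d', i, p, hi, hp, hpi⟩)
      hq.isDegZero hp (v := v) (v' := i m) (by rw [hv, hpi]) k
    rw [GrMod.proj_of_mem (freeMod d') (hi _ _ hm), hpi] at h1
    exact ⟨_, (freeMod d).proj_mem k v, h1⟩
  -- The free projective cover `π` of a graded projective module splits.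
  obtain ⟨σ, hσ, hσπ⟩ := h.exists_lift (𝒩 := (freeMod d).gr)
    (fun i j a m ha hm => (freeMod d).smul_mem ha hm)
    ((LinearMap.ker ((LinearMap.fst (PolyV B) M _) - π ∘ₗ LinearMap.snd (PolyV B) M _)))
    (fun k m hm => by
      obtain ⟨v, hv, rfl⟩ := hsurj k m hm
      exact ⟨v, hv, by simp⟩)
  have hσπ : ∀ m, π (σ m) = m := fun m => by
    have := hσπ m
    simp only [LinearMap.mem_ker, LinearMap.sub_apply, LinearMap.fst_apply,
      LinearMap.comp_apply, LinearMap.snd_apply, sub_eq_zero] at this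
    exact this.symm
  -- The image of the splitting is a graded submodule of the cover that maps onto `M`. By
  -- essentiality it is everything, so `π` is bijective.
  have htop : LinearMap.range σ = ⊤ := by
    apply hq.essential
    · apply le_antisymm
      · rw [Submodule.span_le]
        exact fun v hv => hv.1
      · rintro _ ⟨m, rfl⟩
        refine h.mem_of_homogeneous ((Submodule.span (PolyV B) _).comap σ) (fun k m hm => ?_) m
        exact Submodule.subset_span ⟨⟨m, rfl⟩, k, hσ _ _ hm⟩
    · rw [eq_top_iff]
      exact fun m _ => ⟨σ m, ⟨m, rfl⟩, hσπ m⟩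
  have hσsurj := LinearMap.range_eq_top.mp htop
  have hπσ : ∀ v, σ (π v) = v := fun v => by
    obtain ⟨m, rfl⟩ := hσsurj v
    rw [hσπ]
  refine ⟨n, d, LinearEquiv.ofLinearMap π σ (LinearMap.ext hσπ) (LinearMap.ext hπσ), fun k v => ?_⟩
  refine ⟨fun hv => hq.isDegZero _ _ hv, fun hv => ?_⟩
  have := hσ _ _ hv
  rwa [LinearEquiv.coe_ofLinearMap, hπσ] at this

end IsGradedProjective

end GradedProjective

namespace CoxeterSystem

universe u v w w'

/-! ### Sheaves on the Bruhat graph given by relations between stalks -/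

/-- A sheaf on the Bruhat graph, given by its stalks and, for every edge `y → z`, the module of
compatible pairs in the stalks at `y` and `z`. -/
structure RelSheaf (B : Type u) (W : Type v) where
  stalk : W → Type w
  [addCommGroup : ∀ w, AddCommGroup (stalk w)]
  [module : ∀ w, Module (PolyV B) (stalk w)]
  /-- the homogeneous parts of the stalks -/
  gr : ∀ w, ℤ → AddSubgroup (stalk w)
  /-- the compatible pairs -/
  rel : ∀ y z, Submodule (PolyV B) (stalk y × stalk z)

attribute [instance] RelSheaf.addCommGroup RelSheaf.module

namespace RelSheaf

variable {B : Type u} {W : Type v} [Group W] {M : CoxeterMatrix B} (cs : CoxeterSystem M W)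
  (F : RelSheaf.{u, v, w} B W) (F' : RelSheaf.{u, v, w'} B W)

/-- The family `m` is a section over the set `I`. -/
def IsSection (I : Set W) (m : ∀ w, F.stalk w) : Prop :=
  ∀ y ∈ I, ∀ z ∈ I, cs.Edge y z → (m y, m z) ∈ F.rel y z

/-- All members of the family `m` are homogeneous of degree `k`. -/
def HasDegree {F : RelSheaf.{u, v, w} B W} (m : ∀ w, F.stalk w) (k : ℤ) : Prop :=
  ∀ w, m w ∈ F.gr w k

/-- The element `a` of the stalk at `y` is compatible with the family `m`. -/
def IsCompatible {y : W} (a : F.stalk y) (m : ∀ w, F.stalk w) : Prop :=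
  ∀ z, cs.Edge y z → (a, m z) ∈ F.rel y z

/-- Homogeneous sections on `{> y}` extend to `y`. -/
def FlabbyAt (y : W) : Prop :=
  ∀ k (m : ∀ w, F.stalk w), HasDegree m k → F.IsSection cs {z | cs.BruhatLT y z} m →
    ∃ a ∈ F.gr y k, F.IsCompatible cs a m

/-- The elements of the stalk at `y` that are compatible with `0`. -/
def costalk (y : W) : Submodule (PolyV B) (F.stalk y) where
  carrier := {a | ∀ z, cs.Edge y z → (a, 0) ∈ F.rel y z}
  add_mem' := by
    intro a b ha hb z hz
    have := add_mem (ha z hz) (hb z hz)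
    rwa [Prod.mk_add_mk, add_zero] at this
  zero_mem' := fun z _ => (F.rel y z).zero_mem
  smul_mem' := by
    intro r a ha z hz
    have := (F.rel y z).smul_mem r (ha z hz)
    rwa [Prod.smul_mk, smul_zero] at this

/-- The set `I` contains with `y` all end points of edges `y → z`. -/
def IsUpper (cs : CoxeterSystem M W) (I : Set W) : Prop :=
  ∀ y ∈ I, ∀ z, cs.Edge y z → z ∈ I

/-- The properties of the Bott–Samelson and the Braden–MacPherson sheaves that are supported in
lengths at most `l(x)`. -/
structure IsGood (x : W) : Prop where
  proj : ∀ w, IsGradedProjective B (F.gr w)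
  subsingleton : ∀ w, cs.length x < cs.length w → Subsingleton (F.stalk w)
  rel_zero : ∀ y z, cs.Edge y z → ∀ b, (0, b) ∈ F.rel y z ↔ ∃ c, b = cs.label (z * y⁻¹) • c
  flabby : ∀ y, F.FlabbyAt cs y
  extend : ∀ y k, ∀ a ∈ F.gr y k, ∃ m : ∀ w, F.stalk w, HasDegree m k ∧
    F.IsSection cs {z | cs.BruhatLT y z} m ∧ F.IsCompatible cs a m

variable {cs F F'}

lemma isUpper_gt (y : W) : IsUpper cs {z | cs.BruhatLT y z} :=
  fun _ hu _ h => BruhatLT.trans_le hu h.le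

lemma isUpper_ge (y : W) : IsUpper cs {z | cs.BruhatLE y z} :=
  fun _ hu _ h => BruhatLE.trans hu h.le

lemma IsSection.mono {I J : Set W} {m : ∀ w, F.stalk w} (h : F.IsSection cs J m) (hIJ : I ⊆ J) :
    F.IsSection cs I m :=
  fun y hy z hz => h y (hIJ hy) z (hIJ hz)

lemma IsSection.congr {I : Set W} {m m' : ∀ w, F.stalk w} (h : F.IsSection cs I m)
    (he : ∀ w ∈ I, m' w = m w) : F.IsSection cs I m' := by
  intro y hy z hz hyz
  rw [he y hy, he z hz]
  exact h y hy z hz hyz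

lemma isUpper_subset_gt {J : Set W} (hJ : IsUpper cs J) {w : W} (hw : w ∈ J) {z : W}
    (hz : cs.BruhatLE w z) : z ∈ J := by
  induction hz with
  | refl => exact hw
  | tail _ h ih => exact hJ _ ih _ (bruhatStep_iff.mp h)

/-- Homogeneous sections extend from an upper set to a larger one. -/
lemma exists_extension {L : ℕ} (hsub : ∀ w, L < cs.length w → Subsingleton (F.stalk w))
    {I J : Set W} (hI : IsUpper cs I) (hJ : IsUpper cs J)
    (hfl : ∀ w ∈ J, w ∉ I → F.FlabbyAt cs w) {k : ℤ} {m : ∀ w, F.stalk w} (hm : HasDegree m k)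
    (hs : F.IsSection cs I m) :
    ∃ m' : ∀ w, F.stalk w, HasDegree m' k ∧ F.IsSection cs J m' ∧ ∀ w ∈ I, m' w = m w := by
  classical
  -- Descending induction on the length bound `N`, starting at `L + 1`, above which all stalks
  -- vanish. The missing values in length `N` can be chosen independently, since edges strictly
  -- increase the length.
  have key : ∀ n N : ℕ, N + n = L + 1 → ∃ m' : ∀ w, F.stalk w, HasDegree m' k ∧
      F.IsSection cs {w | w ∈ I ∨ w ∈ J ∧ N ≤ cs.length w} m' ∧ ∀ w ∈ I, m' w = m w := by
    intro n
    induction n with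
    | zero =>
      intro N hN
      refine ⟨m, hm, ?_, fun _ _ => rfl⟩
      intro y hy z hz hyz
      by_cases hyI : y ∈ I
      · exact hs y hyI z (hI y hyI z hyz) hyz
      · have hy' := (hy.resolve_left hyI).2
        have h1 := hsub y (by omega)
        have h2 := hsub z (by have := hyz.2; omega)
        rw [Subsingleton.elim (m y, m z) 0]
        exact zero_mem _
    | succ n ih =>
      intro N hN
      obtain ⟨m', hm', hs', he⟩ := ih (N + 1) (by omega)
      have hex : ∀ w, w ∈ J → w ∉ I → cs.length w = N →
          ∃ a ∈ F.gr w k, F.IsCompatible cs a m' := by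
        intro w hwJ hwI hwN
        refine hfl w hwJ hwI k m' hm' (hs'.mono fun z hz => ?_)
        refine Or.inr ⟨isUpper_subset_gt hJ hwJ hz.1, ?_⟩
        have := BruhatLT.length_lt hz
        omega
      choose a ha hc using hex
      refine ⟨fun w => if h : w ∈ J ∧ w ∉ I ∧ cs.length w = N then a w h.1 h.2.1 h.2.2 else m' w,
        ?_, ?_, ?_⟩
      · intro w
        dsimp only
        split_ifs with h
        · exact ha w h.1 h.2.1 h.2.2
        · exact hm' w
      · intro y hy z hz hyz
        have hzN : ¬ (z ∈ J ∧ z ∉ I ∧ cs.length z = N) := by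
          rintro ⟨_, hzI, hzN⟩
          rcases hy with hy | hy
          · exact hzI (hI y hy z hyz)
          · have := hyz.2
            omega
        dsimp only
        rw [dif_neg hzN]
        split_ifs with h
        · exact hc y h.1 h.2.1 h.2.2 z hyz
        · refine hs' y ?_ z ?_ hyz
          · rcases hy with hy | hy
            · exact Or.inl hy
            · by_cases hyI : y ∈ I
              · exact Or.inl hyI
              · refine Or.inr ⟨hy.1, ?_⟩
                have : cs.length y ≠ N := fun e => h ⟨hy.1, hyI, e⟩
                omega
          · rcases hz with hz | hz
            · exact Or.inl hz
            · by_cases hzI : z ∈ I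
              · exact Or.inl hzI
              · refine Or.inr ⟨hz.1, ?_⟩
                have : cs.length z ≠ N := fun e => hzN ⟨hz.1, hzI, e⟩
                omega
      · intro w hw
        dsimp only
        rw [dif_neg fun h => h.2.1 hw]
        exact he w hw
  obtain ⟨m', hm', hs', he⟩ := key (L + 1) 0 (by omega)
  exact ⟨m', hm', hs'.mono fun w hw => Or.inr ⟨hw, Nat.zero_le _⟩, he⟩

/-! ### Extending and dividing sections of good sheaves -/

namespace IsGood

variable {x : W} (hF : F.IsGood cs x)
include hF

lemma exists_extension {I J : Set W} (hI : IsUpper cs I) (hJ : IsUpper cs J)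
    {k : ℤ} {m : ∀ w, F.stalk w} (hm : HasDegree m k) (hs : F.IsSection cs I m) :
    ∃ m' : ∀ w, F.stalk w, HasDegree m' k ∧ F.IsSection cs J m' ∧ ∀ w ∈ I, m' w = m w :=
  RelSheaf.exists_extension hF.subsingleton hI hJ (fun w _ _ => hF.flabby w) hm hs

/-- A homogeneous element of a stalk is the value of a homogeneous section on `{≥ y}`. -/
lemma exists_section {y : W} {k : ℤ} {a : F.stalk y} (ha : a ∈ F.gr y k) :
    ∃ m : ∀ w, F.stalk w, HasDegree m k ∧ F.IsSection cs {z | cs.BruhatLE y z} m ∧ m y = a := by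
  classical
  obtain ⟨m, hm, hs, hc⟩ := hF.extend y k a ha
  refine ⟨Function.update m y a, ?_, ?_, by simp⟩
  · intro w
    by_cases hw : w = y
    · subst hw
      simpa using ha
    · rw [Function.update_of_ne hw]
      exact hm w
  · intro u hu z hz huz
    have hzy : z ≠ y := by
      rintro rfl
      have := BruhatLE.length_le hu
      have := huz.2
      omega
    rw [Function.update_of_ne hzy]
    by_cases huy : u = y
    · subst huy
      rw [Function.update_self]
      exact hc z huz
    · rw [Function.update_of_ne huy]
      exact hs u ⟨hu, Ne.symm huy⟩ z ⟨hz, Ne.symm hzy⟩ huz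

lemma exists_partner {y z : W} (h : cs.Edge y z) (a : F.stalk y) : ∃ b, (a, b) ∈ F.rel y z := by
  have := (hF.proj y).mem_of_homogeneous
    ((F.rel y z).map (LinearMap.fst (PolyV B) (F.stalk y) (F.stalk z))) (fun k a ha => by
      obtain ⟨m, _, _, hc⟩ := hF.extend y k a ha
      exact ⟨_, hc z h, rfl⟩) a
  obtain ⟨⟨a', b⟩, hab, rfl⟩ := this
  exact ⟨b, hab⟩

lemma rel_of_subsingleton {y z : W} (h : cs.Edge y z) [Subsingleton (F.stalk z)] (a : F.stalk y)
    (b : F.stalk z) : (a, b) ∈ F.rel y z := by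
  obtain ⟨b', hb'⟩ := hF.exists_partner h a
  rwa [Subsingleton.elim b b']

/-- For any partner `b'` of `a`, the element `α_t (b - b')` is divisible by the label of the edge.
The two labels are coprime, so `b - b'` is divisible by it and may be added to `b'`. -/
lemma rel_of_label_smul {y z t : W} (h : cs.Edge y z) (ht : cs.IsReflection t)
    (hne : t ≠ z * y⁻¹) {a : F.stalk y} {b : F.stalk z}
    (hab : (cs.label t • a, cs.label t • b) ∈ F.rel y z) : (a, b) ∈ F.rel y z := by
  obtain ⟨b', hb'⟩ := hF.exists_partner h a
  have h1 := sub_mem hab ((F.rel y z).smul_mem (cs.label t) hb')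
  rw [Prod.smul_mk, Prod.mk_sub_mk, sub_self, ← smul_sub, hF.rel_zero y z h] at h1
  obtain ⟨c, hc⟩ := h1
  have h2 := (hF.proj z).exists_eq_label_smul h.1 ht (Ne.symm hne) hc
  rw [← hF.rel_zero y z h] at h2
  have := add_mem hb' h2
  rwa [Prod.mk_add_mk, add_zero, add_sub_cancel] at this

lemma rel_of_rootPoly_smul {y z w : W} (i : B) (h : cs.Edge y z)
    (hne : w * cs.simple i * w⁻¹ ≠ z * y⁻¹) {a : F.stalk y} {b : F.stalk z}
    (hab : (cs.rootPoly i w • a, cs.rootPoly i w • b) ∈ F.rel y z) : (a, b) ∈ F.rel y z := by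
  obtain ⟨c, hc, e⟩ := exists_rootPoly_eq (cs := cs) i w
  refine hF.rel_of_label_smul h ⟨w, i, rfl⟩ hne ?_
  have := (F.rel y z).smul_mem (MvPolynomial.C c⁻¹) hab
  rwa [e, Prod.smul_mk, smul_smul, smul_smul, ← mul_assoc, ← map_mul, inv_mul_cancel₀ hc, map_one,
    one_mul] at this

lemma rel_zero_smul {y z : W} (h : cs.Edge y z) (c : F.stalk z) :
    (0, cs.label (z * y⁻¹) • c) ∈ F.rel y z :=
  (hF.rel_zero y z h _).mpr ⟨c, rfl⟩

end IsGood

/-! ### Morphisms -/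

/-- A morphism of sheaves of degree `0`. -/
structure IsHom (cs : CoxeterSystem M W) {F : RelSheaf.{u, v, w} B W} {F' : RelSheaf.{u, v, w'} B W}
    (φ : ∀ w, F.stalk w →ₗ[PolyV B] F'.stalk w) : Prop where
  isDegZero : ∀ w, IsDegZero (F.gr w) (F'.gr w) (φ w)
  map_rel : ∀ y z, cs.Edge y z → ∀ a b, (a, b) ∈ F.rel y z → (φ y a, φ z b) ∈ F'.rel y z

/-- A map of the stalks at `x` extends to a morphism. -/
theorem exists_isHom {x : W} (hF : F.IsGood cs x) (hF' : F'.IsGood cs x)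
    (φx : F.stalk x →ₗ[PolyV B] F'.stalk x) (hφx : IsDegZero (F.gr x) (F'.gr x) φx) :
    ∃ φ : ∀ w, F.stalk w →ₗ[PolyV B] F'.stalk w, IsHom cs φ ∧ φ x = φx := by
  classical
  have key : ∀ n N : ℕ, N + n = cs.length x → ∃ φ : ∀ w, F.stalk w →ₗ[PolyV B] F'.stalk w,
      (∀ w, IsDegZero (F.gr w) (F'.gr w) (φ w)) ∧
      (∀ y z, cs.Edge y z → N ≤ cs.length y → ∀ a b, (a, b) ∈ F.rel y z →
        (φ y a, φ z b) ∈ F'.rel y z) ∧ φ x = φx := by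
    intro n
    induction n with
    | zero =>
      intro N hN
      -- Edges that start in length at least `l(x)` end in zero stalks and impose no condition.
      refine ⟨Function.update (fun _ => 0) x φx, fun w => ?_, ?_, by simp⟩
      · by_cases hw : w = x
        · subst hw
          simpa using hφx
        · rw [Function.update_of_ne hw]
          intro k v _
          exact zero_mem _
      · intro y z hyz hy a b _
        have := hF'.subsingleton z (by have := hyz.2; omega)
        exact hF'.rel_of_subsingleton hyz _ _
    | succ n ih =>
      intro N hN
      obtain ⟨φ, hφ, hr, hx⟩ := ih (N + 1) (by omega)
      have hex : ∀ w, cs.length w = N → ∃ g : F.stalk w →ₗ[PolyV B] F'.stalk w,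
          IsDegZero (F.gr w) (F'.gr w) g ∧ ∀ z, cs.Edge w z → ∀ a b, (a, b) ∈ F.rel w z →
            (g a, φ z b) ∈ F'.rel w z := by
        intro w hw
        -- The admissible values of the new component `g` at each element of the stalk. They exist
        -- for homogeneous elements: extend to a section above `w`, apply the components already
        -- built, and use flabbiness of `F'`. Projectivity then gives a linear choice.
        let T : Submodule (PolyV B) (F.stalk w × F'.stalk w) :=
          { carrier := {p | ∀ z, cs.Edge w z → ∃ b, (p.1, b) ∈ F.rel w z ∧
              (p.2, φ z b) ∈ F'.rel w z}
            add_mem' := by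
              intro p q hp hq z hz
              obtain ⟨b, hb, hb'⟩ := hp z hz
              obtain ⟨c, hc, hc'⟩ := hq z hz
              exact ⟨b + c, add_mem hb hc, by rw [map_add]; exact add_mem hb' hc'⟩
            zero_mem' := fun z _ => ⟨0, zero_mem _, by rw [map_zero]; exact zero_mem _⟩
            smul_mem' := by
              intro r p hp z hz
              obtain ⟨b, hb, hb'⟩ := hp z hz
              exact ⟨r • b, (F.rel w z).smul_mem r hb, by
                rw [map_smul]; exact (F'.rel w z).smul_mem r hb'⟩ }
        obtain ⟨g, hg, hgT⟩ := (hF.proj w).exists_lift (hF'.proj w).isGradedSMul T (by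
          intro k a ha
          obtain ⟨m, hm, hs, hc⟩ := hF.extend w k a ha
          obtain ⟨a', ha', hc'⟩ := hF'.flabby w k (fun z => φ z (m z))
            (fun z => hφ z _ _ (hm z)) (by
              intro y hy z hz hyz
              refine hr y z hyz ?_ _ _ (hs y hy z hz hyz)
              have := BruhatLT.length_lt hy
              omega)
          exact ⟨a', ha', fun z hz => ⟨m z, hc z hz, hc' z hz⟩⟩)
        -- `T` provides just one partner of `a`. Any other one differs from it by a multiple of the
        -- label, and `φ z` preserves such multiples.
        refine ⟨g, hg, fun z hz a b hab => ?_⟩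
        obtain ⟨b', hb', hgb'⟩ := hgT a z hz
        have h1 := sub_mem hab hb'
        rw [Prod.mk_sub_mk, sub_self, hF.rel_zero w z hz] at h1
        obtain ⟨c, hc⟩ := h1
        have h2 := hF'.rel_zero_smul hz (φ z c)
        rw [← map_smul, ← hc, map_sub] at h2
        have := add_mem hgb' h2
        rwa [Prod.mk_add_mk, add_zero, add_sub_cancel] at this
      choose g hg hgr using hex
      refine ⟨fun w => if h : cs.length w = N then g w h else φ w, fun w => ?_, ?_, ?_⟩
      · dsimp only
        split_ifs with h
        · exact hg w h
        · exact hφ w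
      · intro y z hyz hy a b hab
        have hz : cs.length z ≠ N := by have := hyz.2; omega
        dsimp only
        rw [dif_neg hz]
        split_ifs with h
        · exact hgr y h z hyz a b hab
        · exact hr y z hyz (by omega) a b hab
      · dsimp only
        rw [dif_neg (by omega), hx]
  obtain ⟨φ, hφ, hr, hx⟩ := key (cs.length x) 0 (by omega)
  exact ⟨φ, ⟨hφ, fun y z h => hr y z h (Nat.zero_le _)⟩, hx⟩

end RelSheaf

end CoxeterSystem

namespace CoxeterSystem

universe u v w

namespace RelSheaf

variable {B : Type u} {W : Type v} [Group W] {M : CoxeterMatrix B} (cs : CoxeterSystem M W)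
  (F : RelSheaf.{u, v, w} B W) (i : B)

/-! ### Translation of sheaves -/

/-- The sections over the coset `{w, w s}`, as families that vanish elsewhere. -/
def cosetSections (w : W) : Submodule (PolyV B) (∀ v, F.stalk v) where
  carrier := {f | (∀ v, v ≠ w → v ≠ w * cs.simple i → f v = 0) ∧
    F.IsSection cs {w, w * cs.simple i} f}
  add_mem' := by
    rintro f g ⟨hf, hf'⟩ ⟨hg, hg'⟩
    refine ⟨fun v h h' => by rw [Pi.add_apply, hf v h h', hg v h h', add_zero], ?_⟩
    exact fun y hy z hz h => add_mem (hf' y hy z hz h) (hg' y hy z hz h)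
  zero_mem' := ⟨fun _ _ _ => rfl, fun y _ z _ _ => zero_mem _⟩
  smul_mem' := by
    rintro r f ⟨hf, hf'⟩
    refine ⟨fun v h h' => by rw [Pi.smul_apply, hf v h h', smul_zero], ?_⟩
    exact fun y hy z hz h => (F.rel y z).smul_mem r (hf' y hy z hz h)

/-- The translation of a sheaf through the wall of the simple reflection `s`. -/
noncomputable def translate : RelSheaf.{u, v, max v w} B W where
  stalk w := F.cosetSections cs i w
  gr w k :=
    { carrier := {f | ∀ v, f.1 v ∈ F.gr v k}
      add_mem' := fun hf hg v => add_mem (hf v) (hg v)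
      zero_mem' := fun v => zero_mem _
      neg_mem' := fun hf v => neg_mem (hf v) }
  -- At `y` and `y s` the stalks are the same module, and a pair is compatible if its difference is
  -- a label multiple of a coset section. Along any other edge compatibility is imposed at both
  -- members of the coset.
  rel y z :=
    { carrier := {p | (z = y * cs.simple i → ∃ h ∈ F.cosetSections cs i y,
          p.1.1 - p.2.1 = cs.label (z * y⁻¹) • h) ∧
        (z ≠ y * cs.simple i → (p.1.1 y, p.2.1 z) ∈ F.rel y z ∧
          (p.1.1 (y * cs.simple i), p.2.1 (z * cs.simple i)) ∈
            F.rel (y * cs.simple i) (z * cs.simple i))}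
      add_mem' := by
        rintro p q ⟨hp, hp'⟩ ⟨hq, hq'⟩
        refine ⟨fun hz => ?_, fun hz => ⟨add_mem (hp' hz).1 (hq' hz).1,
          add_mem (hp' hz).2 (hq' hz).2⟩⟩
        obtain ⟨h, hh, e⟩ := hp hz
        obtain ⟨h', hh', e'⟩ := hq hz
        refine ⟨h + h', add_mem hh hh', ?_⟩
        rw [smul_add, ← e, ← e']
        change p.1.1 + q.1.1 - (p.2.1 + q.2.1) = _
        abel
      zero_mem' := by
        refine ⟨fun _ => ⟨0, zero_mem _, ?_⟩, fun _ => ⟨zero_mem _, zero_mem _⟩⟩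
        rw [smul_zero]
        exact sub_self _
      smul_mem' := by
        rintro r p ⟨hp, hp'⟩
        refine ⟨fun hz => ?_, fun hz => ⟨(F.rel _ _).smul_mem r (hp' hz).1,
          (F.rel _ _).smul_mem r (hp' hz).2⟩⟩
        obtain ⟨h, hh, e⟩ := hp hz
        refine ⟨r • h, (F.cosetSections cs i y).smul_mem r hh, ?_⟩
        rw [smul_comm, ← e, smul_sub]
        rfl }

variable {cs F i}

lemma cosetSections_mul_simple (w : W) :
    F.cosetSections cs i (w * cs.simple i) = F.cosetSections cs i w := by
  ext f
  change (_ ∧ _) ↔ (_ ∧ _)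
  rw [simple_mul_simple_cancel_right, Set.pair_comm]
  exact and_congr_left fun _ => forall_congr' fun v => ⟨fun h a b => h b a, fun h a b => h b a⟩

lemma cosetSections_rel {y : W} {f : ∀ v, F.stalk v} (hf : f ∈ F.cosetSections cs i y)
    (hy : cs.length y < cs.length (y * cs.simple i)) :
    (f y, f (y * cs.simple i)) ∈ F.rel y (y * cs.simple i) :=
  hf.2 y (by simp) _ (by simp) (edge_mul_simple hy)

lemma mem_cosetSections {y : W} {f : ∀ v, F.stalk v}
    (hy : cs.length y < cs.length (y * cs.simple i))
    (h0 : ∀ v, v ≠ y → v ≠ y * cs.simple i → f v = 0)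
    (h : (f y, f (y * cs.simple i)) ∈ F.rel y (y * cs.simple i)) :
    f ∈ F.cosetSections cs i y := by
  refine ⟨h0, ?_⟩
  rintro u (rfl | rfl) z (rfl | rfl) huz
  · exact absurd huz.2 (lt_irrefl _)
  · exact h
  · exact absurd huz.2 (not_lt.mpr hy.le)
  · exact absurd huz.2 (lt_irrefl _)

lemma cosetSections_ext {y : W} {f g : ∀ v, F.stalk v} (hf : f ∈ F.cosetSections cs i y)
    (hg : g ∈ F.cosetSections cs i y)
    (h : ∀ v, v = y ∨ v = y * cs.simple i → f v = g v) : f = g := by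
  funext v
  by_cases hv : v = y ∨ v = y * cs.simple i
  · exact h v hv
  · rw [not_or] at hv
    rw [hf.1 v hv.1 hv.2, hg.1 v hv.1 hv.2]

lemma translate_rel_iff {y z : W} (hne : z ≠ y * cs.simple i) {f : (F.translate cs i).stalk y}
    {g : (F.translate cs i).stalk z} :
    (f, g) ∈ (F.translate cs i).rel y z ↔ (f.1 y, g.1 z) ∈ F.rel y z ∧
      (f.1 (y * cs.simple i), g.1 (z * cs.simple i)) ∈
        F.rel (y * cs.simple i) (z * cs.simple i) :=
  ⟨fun h => h.2 hne, fun h => ⟨fun e => absurd e hne, fun _ => h⟩⟩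

lemma translate_rel_upper_iff {y z : W} (hne : z ≠ y * cs.simple i)
    {f : (F.translate cs i).stalk (y * cs.simple i)}
    {g : (F.translate cs i).stalk (z * cs.simple i)} :
    (f, g) ∈ (F.translate cs i).rel (y * cs.simple i) (z * cs.simple i) ↔
      (f.1 y, g.1 z) ∈ F.rel y z ∧ (f.1 (y * cs.simple i), g.1 (z * cs.simple i)) ∈
        F.rel (y * cs.simple i) (z * cs.simple i) := by
  have hne' : z * cs.simple i ≠ y * cs.simple i * cs.simple i := fun e => hne (by
    rw [simple_mul_simple_cancel_right] at e
    rw [← e, simple_mul_simple_cancel_right])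
  rw [translate_rel_iff hne', and_comm]
  have e : ∀ y', y' = y → ∀ z', z' = z → ((f.1 y', g.1 z') ∈ F.rel y' z' ↔
      (f.1 y, g.1 z) ∈ F.rel y z) := by
    rintro y' rfl z' rfl
    rfl
  rw [e _ (cs.simple_mul_simple_cancel_right i) _ (cs.simple_mul_simple_cancel_right i)]

lemma translate_rel_simple_iff {y : W} {f : (F.translate cs i).stalk y}
    {g : (F.translate cs i).stalk (y * cs.simple i)} :
    (f, g) ∈ (F.translate cs i).rel y (y * cs.simple i) ↔
      ∃ h ∈ F.cosetSections cs i y, f.1 - g.1 = cs.label (y * cs.simple i * y⁻¹) • h :=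
  ⟨fun h => h.1 rfl, fun h => ⟨fun _ => h, fun e => absurd rfl e⟩⟩

lemma IsSection.add {I : Set W} {m m' : ∀ w, F.stalk w} (h : F.IsSection cs I m)
    (h' : F.IsSection cs I m') : F.IsSection cs I (m + m') :=
  fun y hy z hz hyz => add_mem (h y hy z hz hyz) (h' y hy z hz hyz)

lemma IsSection.smul {I : Set W} {m : ∀ w, F.stalk w} (h : F.IsSection cs I m) (r : PolyV B) :
    F.IsSection cs I (r • m) :=
  fun y hy z hz hyz => (F.rel y z).smul_mem r (h y hy z hz hyz)

/-- The set `I` is a union of cosets `{w, w s}`. -/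
def IsStable (cs : CoxeterSystem M W) (i : B) (I : Set W) : Prop :=
  ∀ w ∈ I, w * cs.simple i ∈ I

/-- The family `m` in the translated sheaf is given on `I` by `μ + β ν`, where `β` is the section
`w ↦ w α_s` of the structure sheaf. -/
def IsLiftOf (I : Set W) (m : ∀ w, (F.translate cs i).stalk w) (μ ν : ∀ w, F.stalk w) : Prop :=
  ∀ w ∈ I, ∀ v, v = w ∨ v = w * cs.simple i → (m w).1 v = μ v + cs.rootPoly i w • ν v

lemma rootPoly_smul_mem {x : W} (hF : F.IsGood cs x) {k : ℤ} {v w : W} {a : F.stalk v}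
    (ha : a ∈ F.gr v (k - 2)) : cs.rootPoly i w • a ∈ F.gr v k := by
  have := (hF.proj v).isGradedSMul 2 (k - 2) _ _ (rootPoly_mem (cs := cs) i w) ha
  rwa [add_sub_cancel] at this

lemma C_mem (c : ℝ) : (MvPolynomial.C c : PolyV B) ∈ symGr B 0 :=
  MvPolynomial.isWeightedHomogeneous_C _ c

lemma C_smul_mem {x : W} (hF : F.IsGood cs x) {k : ℤ} {v : W} (c : ℝ) {a : F.stalk v}
    (ha : a ∈ F.gr v k) : (MvPolynomial.C c : PolyV B) • a ∈ F.gr v k := by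
  have := (hF.proj v).isGradedSMul 0 k _ _ (C_mem c) ha
  rwa [zero_add] at this

/-- In the stalk at `w` the coefficient of `ν` is `w α_s` at both members of the coset. A
combination of sections with a constant coefficient is a section over the coset. -/
lemma exists_isLiftOf {x : W} (hF : F.IsGood cs x) {I : Set W} (hI : IsStable cs i I)
    {μ ν : ∀ w, F.stalk w} {k : ℤ} (hμ : HasDegree μ k) (hν : HasDegree ν (k - 2))
    (hμs : F.IsSection cs I μ) (hνs : F.IsSection cs I ν) :
    ∃ m : ∀ w, (F.translate cs i).stalk w, HasDegree m k ∧ IsLiftOf I m μ ν := by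
  classical
  have hmem : ∀ w ∈ I, (fun v => if v = w ∨ v = w * cs.simple i then
      μ v + cs.rootPoly i w • ν v else 0) ∈ F.cosetSections cs i w := by
    intro w hw
    refine ⟨fun v h h' => if_neg (by tauto), ?_⟩
    refine IsSection.congr (m := μ + cs.rootPoly i w • ν) ?_ fun v hv => if_pos hv
    refine (hμs.add (hνs.smul _)).mono ?_
    rintro v (rfl | rfl)
    · exact hw
    · exact hI _ hw
  have hex : ∀ w, ∃ f : (F.translate cs i).stalk w, f ∈ (F.translate cs i).gr w k ∧
      (w ∈ I → ∀ v, v = w ∨ v = w * cs.simple i → f.1 v = μ v + cs.rootPoly i w • ν v) := by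
    intro w
    by_cases hw : w ∈ I
    · refine ⟨⟨_, hmem w hw⟩, fun v => ?_, fun _ v hv => if_pos hv⟩
      dsimp only
      split_ifs
      · exact add_mem (hμ v) (rootPoly_smul_mem hF (hν v))
      · exact zero_mem _
    · exact ⟨0, zero_mem _, fun h => absurd h hw⟩
  choose m hm hm' using hex
  exact ⟨m, hm, hm'⟩

/-- From `y` to `y s` the coefficient `w α_s` changes sign, so the values differ by a multiple of
the label. Along another edge the coefficient changes by a multiple of the label of that edge, and
such multiples are compatible with zero. -/
lemma IsLiftOf.isSection {x : W} (hF : F.IsGood cs x) {I : Set W} (hI : IsStable cs i I)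
    {μ ν : ∀ w, F.stalk w} (hμ : F.IsSection cs I μ) (hν : F.IsSection cs I ν)
    {m : ∀ w, (F.translate cs i).stalk w} (hm : IsLiftOf I m μ ν) :
    (F.translate cs i).IsSection cs I m := by
  intro y hy z hz hyz
  by_cases hne : z = y * cs.simple i
  · subst hne
    rw [translate_rel_simple_iff]
    obtain ⟨c, hc, e⟩ := exists_rootPoly_eq (cs := cs) i y
    obtain ⟨n, hn, hn'⟩ : ∃ n ∈ F.cosetSections cs i y, ∀ v, v = y ∨ v = y * cs.simple i →
        n v = ν v := by
      classical
      refine ⟨fun v => if v = y ∨ v = y * cs.simple i then ν v else 0,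
        ⟨fun v h h' => if_neg (by tauto), ?_⟩, fun v hv => if_pos hv⟩
      refine IsSection.congr (m := ν) (hν.mono ?_) fun v hv => if_pos hv
      rintro v (rfl | rfl)
      · exact hy
      · exact hz
    -- The difference is `2 (y α_s) ν`, and `y α_s` is `c` times the label.
    refine ⟨MvPolynomial.C (2 * c) • n, Submodule.smul_mem _ _ hn, ?_⟩
    refine cosetSections_ext (y := y) (cs := cs) (i := i) (sub_mem (m y).2 ?_)
      (Submodule.smul_mem _ _ (Submodule.smul_mem _ _ hn)) ?_
    · rw [← cosetSections_mul_simple]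
      exact (m _).2
    · intro v hv
      have hv' : v = y * cs.simple i ∨ v = y * cs.simple i * cs.simple i := by
        rw [simple_mul_simple_cancel_right]
        exact hv.symm
      rw [Pi.sub_apply, hm y hy v hv, hm _ hz v hv', rootPoly_mul_simple, Pi.smul_apply,
        Pi.smul_apply, hn' v hv, e, map_mul, map_ofNat]
      module
  · rw [translate_rel_iff hne]
    obtain ⟨c, e⟩ := exists_rootPoly_sub_eq (cs := cs) i hyz.1
    have hyz' := hyz.mul_simple i hne
    have key : ∀ u v, u = y ∨ u = y * cs.simple i → v = z ∨ v = z * cs.simple i →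
        v * u⁻¹ = z * y⁻¹ → u ∈ I → v ∈ I → cs.Edge u v → ((m y).1 u, (m z).1 v) ∈ F.rel u v := by
      intro u v hu hv huv huI hvI hedge
      rw [hm y hy u hu, hm z hz v hv]
      have h1 := add_mem (hμ u huI v hvI hedge)
        ((F.rel u v).smul_mem (cs.rootPoly i y) (hν u huI v hvI hedge))
      have h2 := add_mem h1 ((F.rel u v).smul_mem (MvPolynomial.C c)
        (hF.rel_zero_smul hedge (ν v)))
      rw [huv] at h2
      convert h2 using 1
      refine Prod.ext ?_ ?_
      · simp
      · simp only [Prod.smul_mk, Prod.mk_add_mk]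
        rw [smul_smul, ← e, sub_smul]
        abel
    exact ⟨key y z (Or.inl rfl) (Or.inl rfl) rfl hy hz hyz,
      key _ _ (Or.inr rfl) (Or.inr rfl) (mul_simple_mul_inv_eq _ _ _) (hI _ hy) (hI _ hz) hyz'⟩

end RelSheaf

end CoxeterSystem

/-! ### Decomposition of sections of the translated sheaf -/

namespace CoxeterSystem

universe u v w

namespace RelSheaf

variable {B : Type u} {W : Type v} [Group W] {M : CoxeterMatrix B} {cs : CoxeterSystem M W}
  {F : RelSheaf.{u, v, w} B W} {i : B}

lemma rootPoly_ne_zero (w : W) : cs.rootPoly i w ≠ 0 := by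
  obtain ⟨c, hc, e⟩ := exists_rootPoly_eq (cs := cs) i w
  rw [e]
  exact mul_ne_zero ((map_ne_zero_iff _ (MvPolynomial.C_injective B ℝ)).mpr hc)
    (label_ne_zero ⟨w, i, rfl⟩)

lemma C_half_add_half :
    (MvPolynomial.C (1 / 2 : ℝ) : PolyV B) + MvPolynomial.C (1 / 2 : ℝ) = 1 := by
  rw [← map_add, add_halves, map_one]

lemma C_half_smul_add_self {P : Type*} [AddCommGroup P] [Module (PolyV B) P] (a : P) :
    (MvPolynomial.C (1 / 2 : ℝ) : PolyV B) • (a + a) = a := by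
  rw [smul_add, ← add_smul, C_half_add_half, one_smul]

lemma cosetSections_of_upper {y : W} (f : (F.translate cs i).stalk (y * cs.simple i)) :
    f.1 ∈ F.cosetSections cs i y :=
  (cosetSections_mul_simple y).le f.2

/-- The difference of the values of a section of the translated sheaf at the two elements of a
coset. -/
lemma exists_sub_eq_rootPoly_smul {I : Set W} (hI : IsStable cs i I)
    {m : ∀ w, (F.translate cs i).stalk w} (hs : (F.translate cs i).IsSection cs I m) {w : W}
    (hw : w ∈ I) : ∃ h ∈ F.cosetSections cs i w,
      (m w).1 - (m (w * cs.simple i)).1 = cs.rootPoly i w • h + cs.rootPoly i w • h := by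
  have key : ∀ w ∈ I, cs.length w < cs.length (w * cs.simple i) →
      ∃ h ∈ F.cosetSections cs i w,
      (m w).1 - (m (w * cs.simple i)).1 = cs.rootPoly i w • h + cs.rootPoly i w • h := by
    intro w hw hl
    obtain ⟨h, hh, e⟩ := translate_rel_simple_iff.mp (hs w hw _ (hI w hw) (edge_mul_simple hl))
    obtain ⟨c, hc, e'⟩ := exists_rootPoly_eq (cs := cs) i w
    -- The label is `c⁻¹ (w α_s)`, and half of the multiple goes into each of the two summands.
    refine ⟨MvPolynomial.C (1 / 2 * c⁻¹) • h, Submodule.smul_mem _ _ hh, ?_⟩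
    rw [e, e', ← smul_add, ← add_smul, smul_smul]
    congr 1
    rw [map_mul, ← add_mul, C_half_add_half, one_mul, mul_right_comm, ← map_mul,
      mul_inv_cancel₀ hc, map_one, one_mul]
  rcases lt_or_gt_of_ne (cs.length_mul_simple_ne w i) with hl | hl
  · obtain ⟨h, hh, e⟩ := key _ (hI w hw) (by rwa [simple_mul_simple_cancel_right])
    refine ⟨h, by rwa [cosetSections_mul_simple] at hh, ?_⟩
    rw [simple_mul_simple_cancel_right, rootPoly_mul_simple, neg_smul, ← neg_add] at e
    rw [← neg_sub, e, neg_neg]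
  · exact key w hw hl

/-- The sections of the translated sheaf over a union of cosets. -/
theorem exists_isLiftOf_of_isSection {x : W} (hF : F.IsGood cs x) {I : Set W}
    (hI : IsStable cs i I) {m : ∀ w, (F.translate cs i).stalk w} {k : ℤ} (hm : HasDegree m k)
    (hs : (F.translate cs i).IsSection cs I m) :
    ∃ μ ν : ∀ w, F.stalk w, HasDegree μ k ∧ HasDegree ν (k - 2) ∧ F.IsSection cs I μ ∧
      F.IsSection cs I ν ∧ IsLiftOf I m μ ν := by
  classical
  have hdiff := fun w (hw : w ∈ I) => exists_sub_eq_rootPoly_smul hI hs hw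
  choose h hh he using hdiff
  have he' : ∀ w (hw : w ∈ I) v, cs.rootPoly i w • h w hw v =
      (MvPolynomial.C (1 / 2 : ℝ) : PolyV B) • ((m w).1 v - (m (w * cs.simple i)).1 v) := by
    intro w hw v
    have := congrFun (he w hw) v
    rw [Pi.sub_apply] at this
    rw [this]
    exact (C_half_smul_add_self _).symm
  -- Passing from `w` to `w s` changes the sign both of the difference and of `w α_s`, so their
  -- quotient depends only on the coset.
  have hhs : ∀ w (hw : w ∈ I) v, h (w * cs.simple i) (hI w hw) v = h w hw v := by
    intro w hw v
    apply (hF.proj v).smul_injective (rootPoly_ne_zero (cs := cs) (i := i) w)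
    have h1 := he' _ (hI w hw) v
    rw [simple_mul_simple_cancel_right, rootPoly_mul_simple, neg_smul] at h1
    rw [he' w hw v, ← neg_sub, smul_neg, ← h1, neg_neg]
  -- Invariant and anti-invariant parts: `μ` is the average of the values at `w` and `w s`, and `ν`
  -- is half their difference divided by `w α_s`.
  let ν : ∀ w, F.stalk w := fun v => if hv : v ∈ I then h v hv v else 0
  let μ : ∀ w, F.stalk w := fun v => (MvPolynomial.C (1 / 2 : ℝ) : PolyV B) •
    ((m v).1 v + (m (v * cs.simple i)).1 v)
  have hν0 : ∀ w (hw : w ∈ I), ν w = h w hw w := fun w hw => dif_pos hw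
  have hν : ∀ w (hw : w ∈ I) v, v = w ∨ v = w * cs.simple i → ν v = h w hw v := by
    rintro w hw v (rfl | rfl)
    · exact hν0 v hw
    · rw [hν0 _ (hI w hw), hhs w hw]
  have hμ : ∀ w v, v = w ∨ v = w * cs.simple i →
      μ v = (MvPolynomial.C (1 / 2 : ℝ) : PolyV B) • ((m w).1 v + (m (w * cs.simple i)).1 v) := by
    rintro w v (rfl | rfl)
    · rfl
    · change _ • (_ + _) = _
      rw [simple_mul_simple_cancel_right, add_comm]
  refine ⟨μ, ν, ?_, ?_, ?_, ?_, ?_⟩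
  · intro v
    exact C_smul_mem hF _ (add_mem (hm v v) (hm (v * cs.simple i) v))
  · intro v
    by_cases hv : v ∈ I
    · rw [hν0 v hv]
      refine (hF.proj v).mem_of_smul_mem (rootPoly_mem (cs := cs) i v) (rootPoly_ne_zero v) ?_
      rw [he', add_sub_cancel]
      exact C_smul_mem hF _ (sub_mem (hm v v) (hm (v * cs.simple i) v))
    · change (if hv : v ∈ I then h v hv v else 0) ∈ _
      rw [dif_neg hv]
      exact zero_mem _
  · intro y hy z hz hyz
    by_cases hne : z = y * cs.simple i
    · subst hne
      rw [hμ y y (Or.inl rfl), hμ y _ (Or.inr rfl)]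
      exact (F.rel _ _).smul_mem _ (add_mem (cosetSections_rel (m y).2 hyz.2)
        (cosetSections_rel (cosetSections_of_upper _) hyz.2))
    · have h1 := (translate_rel_iff hne).mp (hs y hy z hz hyz)
      have h2 := (translate_rel_upper_iff hne).mp (hs _ (hI y hy) _ (hI z hz)
        (hyz.mul_simple i hne))
      exact (F.rel _ _).smul_mem _ (add_mem h1.1 h2.1)
  · intro y hy z hz hyz
    by_cases hne : z = y * cs.simple i
    · subst hne
      rw [hν y hy y (Or.inl rfl), hν y hy _ (Or.inr rfl)]
      exact cosetSections_rel (hh y hy) hyz.2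
    · have h1 := (translate_rel_iff hne).mp (hs y hy z hz hyz)
      have h2 := (translate_rel_upper_iff hne).mp (hs _ (hI y hy) _ (hI z hz)
        (hyz.mul_simple i hne))
      -- This is the compatibility of `(y α_s) ν y` and `(z α_s) ν z`. Replacing `z α_s` by `y α_s`
      -- costs a multiple of the edge label, and `y α_s` can then be cancelled because it is not
      -- proportional to that label.
      have h3 := (F.rel _ _).smul_mem (MvPolynomial.C (1 / 2 : ℝ)) (sub_mem h1.1 h2.1)
      rw [Prod.mk_sub_mk, Prod.smul_mk, ← he' y hy, ← he' z hz, ← hν0 y hy, ← hν0 z hz] at h3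
      obtain ⟨c, e⟩ := exists_rootPoly_sub_eq (cs := cs) i hyz.1
      have h4 := sub_mem h3 ((F.rel y z).smul_mem (MvPolynomial.C c)
        (hF.rel_zero_smul hyz (ν z)))
      refine hF.rel_of_rootPoly_smul i hyz (w := y) ?_ (a := ν y) (b := ν z) ?_
      · intro e'
        exact hne (mul_right_cancel e').symm
      · convert h4 using 1
        refine Prod.ext ?_ ?_
        · simp
        · simp only [Prod.smul_mk, Prod.mk_sub_mk]
          rw [smul_smul, ← e, sub_smul]
          abel
  · intro w hw v hv
    rw [hμ w v hv, hν w hw v hv, he' w hw, ← smul_add, add_add_sub_cancel, C_half_smul_add_self]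

/-! ### Sets above the lower element of a coset -/

section Lower

variable {y : W} (hy : cs.length y < cs.length (y * cs.simple i))
include hy

lemma isStable_ge : IsStable cs i {z | cs.BruhatLE y z} :=
  fun _ hw => BruhatLE.mul_simple_of_lower hy hw

lemma isStable_gt : IsStable cs i {z | cs.BruhatLT y z ∧ z ≠ y * cs.simple i} := by
  rintro z ⟨hz, hne⟩
  refine ⟨⟨BruhatLE.mul_simple_of_lower hy hz.1, ?_⟩, ?_⟩
  · intro e
    apply hne
    rw [e, simple_mul_simple_cancel_right]
  · intro e
    exact hz.2 (mul_right_cancel e).symm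

/-- The length of `y s` is only one more than that of `y`, so no edge that starts strictly above `y`
ends in `y s`. -/
lemma isUpper_gt_ne : IsUpper cs {z | cs.BruhatLT y z ∧ z ≠ y * cs.simple i} := by
  rintro u ⟨hu, _⟩ z huz
  refine ⟨hu.trans huz.lt, ?_⟩
  rintro rfl
  have := hu.length_lt
  have := huz.2
  have := cs.length_mul_simple y i
  omega

lemma lt_of_upper_lt {z : W} (hz : cs.BruhatLT (y * cs.simple i) z) :
    cs.BruhatLT y z ∧ z ≠ y * cs.simple i :=
  ⟨(edge_mul_simple hy).lt.trans hz, Ne.symm hz.2⟩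

/-- Edges that originate at the two elements of a coset and do not connect them. -/
lemma edge_upper_iff {z : W} (hne : z ≠ y * cs.simple i) :
    cs.Edge (y * cs.simple i) (z * cs.simple i) ↔ cs.Edge y z := by
  refine ⟨fun h => ?_, fun h => h.mul_simple i hne⟩
  have := h.mul_simple i (by
    rw [simple_mul_simple_cancel_right]
    rintro e
    have := h.2
    rw [e] at this
    omega)
  rwa [simple_mul_simple_cancel_right, simple_mul_simple_cancel_right] at this

end Lower

/-! ### Flabbiness of the translated sheaf -/

section Flabby

variable {x : W} (hF : F.IsGood cs x) {y : W} (hy : cs.length y < cs.length (y * cs.simple i))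
include hF hy

/-- Sections of the translated sheaf above a coset extend to the coset. -/
lemma exists_coset_extension {m : ∀ w, (F.translate cs i).stalk w} {k : ℤ} (hm : HasDegree m k)
    (hs : (F.translate cs i).IsSection cs {z | cs.BruhatLT y z ∧ z ≠ y * cs.simple i} m) :
    ∃ m' : ∀ w, (F.translate cs i).stalk w, HasDegree m' k ∧
      (F.translate cs i).IsSection cs {z | cs.BruhatLE y z} m' ∧
      ∀ z, cs.BruhatLT y z → z ≠ y * cs.simple i → m' z = m z := by
  -- The set above the coset is a union of cosets. Decompose the section as `μ + β ν`, extend `μ`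
  -- and `ν` as sections of `F`, and recombine.
  obtain ⟨μ, ν, hμ, hν, hμs, hνs, hl⟩ := exists_isLiftOf_of_isSection hF (isStable_gt hy) hm hs
  obtain ⟨μ', hμ', hμs', hμe⟩ := hF.exists_extension (isUpper_gt_ne hy) (isUpper_ge y) hμ hμs
  obtain ⟨ν', hν', hνs', hνe⟩ := hF.exists_extension (isUpper_gt_ne hy) (isUpper_ge y) hν hνs
  obtain ⟨m', hm', hl'⟩ := exists_isLiftOf hF (isStable_ge hy) hμ' hν' hμs' hνs'
  refine ⟨m', hm', hl'.isSection hF (isStable_ge hy) hμs' hνs', fun z hz hne => ?_⟩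
  refine Subtype.ext (cosetSections_ext (m' z).2 (m z).2 fun v hv => ?_)
  have hvI : v ∈ {z | cs.BruhatLT y z ∧ z ≠ y * cs.simple i} := by
    rcases hv with rfl | rfl
    · exact ⟨hz, hne⟩
    · exact isStable_gt hy z ⟨hz, hne⟩
  rw [hl' z hz.1 v hv, hl z ⟨hz, hne⟩ v hv, hμe v hvI, hνe v hvI]

/-- The given section already has a value at `y s`, which the extension over the coset need not
reproduce. The discrepancy at `y s` is compatible with zero above the coset; adding it to the value
at `y` repairs the edge from `y` to `y s` and spoils no other. -/
lemma flabbyAt_translate_lower : (F.translate cs i).FlabbyAt cs y := by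
  intro k m hm hs
  obtain ⟨m', hm', hs', he⟩ := exists_coset_extension hF hy hm (hs.mono fun z hz => hz.1)
  have hys : cs.Edge y (y * cs.simple i) := edge_mul_simple hy
  obtain ⟨h, hh, hhe⟩ := translate_rel_simple_iff.mp (hs' y Relation.ReflTransGen.refl _ hys.le hys)
  refine ⟨⟨(m' y).1 + ((m (y * cs.simple i)).1 - (m' (y * cs.simple i)).1),
    add_mem (m' y).2
      (sub_mem (cosetSections_of_upper _) (cosetSections_of_upper _))⟩, ?_, ?_⟩
  · intro v
    exact add_mem (hm' y v) (sub_mem (hm _ v) (hm' _ v))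
  · intro z hz
    by_cases hne : z = y * cs.simple i
    · subst hne
      refine translate_rel_simple_iff.mpr ⟨h, hh, ?_⟩
      rw [← hhe]
      dsimp only
      abel
    · have h1 := (translate_rel_iff hne).mp (hs' y Relation.ReflTransGen.refl _ hz.le hz)
      rw [he z hz.lt hne] at h1
      have hz' := hz.mul_simple i hne
      have hlt := lt_of_upper_lt hy hz'.lt
      have h2 := hs' _ hys.le _ (hys.le.trans hz'.le) hz'
      rw [he _ hlt.1 hlt.2] at h2
      have h3 := (translate_rel_upper_iff hne).mp h2
      have h4 := (translate_rel_upper_iff hne).mp (hs _ hys.lt _ hlt.1 hz')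
      refine (translate_rel_iff hne).mpr ⟨?_, ?_⟩
      · have := add_mem h1.1 (sub_mem h4.1 h3.1)
        rwa [Prod.mk_sub_mk, sub_self, Prod.mk_add_mk, add_zero] at this
      · have := add_mem h1.2 (sub_mem h4.2 h3.2)
        rwa [Prod.mk_sub_mk, sub_self, Prod.mk_add_mk, add_zero] at this

/-- First enlarge `{> y s}` to the whole set above the coset. Any upper element of a coset that lies
above `y` also lies above `y s`, so only lower elements are new, where flabbiness is known. Then
extend over the coset itself. -/
lemma flabbyAt_translate_upper {L : ℕ}
    (hsub : ∀ w, L < cs.length w → Subsingleton ((F.translate cs i).stalk w)) :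
    (F.translate cs i).FlabbyAt cs (y * cs.simple i) := by
  intro k m hm hs
  have hys : cs.Edge y (y * cs.simple i) := edge_mul_simple hy
  obtain ⟨m₁, hm₁, hs₁, he₁⟩ := RelSheaf.exists_extension hsub
    (isUpper_gt (y * cs.simple i)) (isUpper_gt_ne hy) (by
      rintro u ⟨hu, hne⟩ hu'
      apply flabbyAt_translate_lower hF
      by_contra hcon
      refine hu' ⟨hu.1.upper_le_of_lower
        (lt_of_le_of_ne (not_lt.mp hcon) (cs.length_mul_simple_ne u i)), Ne.symm hne⟩) hm hs
  obtain ⟨m', hm', hs', he⟩ := exists_coset_extension hF hy hm₁ hs₁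
  refine ⟨m' (y * cs.simple i), hm' _, fun z hz => ?_⟩
  have hlt := lt_of_upper_lt hy hz.lt
  have := hs' _ hys.le _ hlt.1.1 hz
  rwa [he z hlt.1 hlt.2, he₁ z hz.lt] at this

/-- Every homogeneous element over a coset extends to a section of the original sheaf. -/
lemma exists_section_of_coset {f : ∀ v, F.stalk v} (hf : f ∈ F.cosetSections cs i y) {k : ℤ}
    (hk : ∀ v, f v ∈ F.gr v k) :
    ∃ μ : ∀ w, F.stalk w, HasDegree μ k ∧ F.IsSection cs {z | cs.BruhatLE y z} μ ∧
      μ y = f y ∧ μ (y * cs.simple i) = f (y * cs.simple i) := by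
  have hys : cs.Edge y (y * cs.simple i) := edge_mul_simple hy
  obtain ⟨m, hm, hs, hmy⟩ := hF.exists_section (hk y)
  have h1 := sub_mem (cosetSections_rel hf hy) (hs y Relation.ReflTransGen.refl _ hys.le hys)
  rw [Prod.mk_sub_mk, hmy, sub_self, hF.rel_zero _ _ hys] at h1
  obtain ⟨c, hc⟩ := h1
  have hck : c ∈ F.gr _ (k - 2) := by
    refine (hF.proj _).mem_of_smul_mem (label_mem _) (label_ne_zero hys.1) ?_
    rw [← hc, add_sub_cancel]
    exact sub_mem (hk _) (hm _)
  obtain ⟨n₀, hn₀, hns₀, hne₀⟩ := hF.exists_section hck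
  obtain ⟨n, hn, hns, hne⟩ := hF.exists_extension (isUpper_ge (y * cs.simple i)) (isUpper_ge y)
    hn₀ hns₀
  obtain ⟨r, hr, e⟩ := exists_rootPoly_eq (cs := cs) i y
  -- Here `m` has the right value at `y` and is off by `α c` at `y s`. The factor `y α_s - w α_s`
  -- vanishes at `w = y` and equals `2 (y α_s) = 2 r α` at `w = y s`, whence the constant.
  refine ⟨fun w => m w +
    (MvPolynomial.C (1 / 2 * r⁻¹) : PolyV B) • ((cs.rootPoly i y - cs.rootPoly i w) • n w),
    ?_, ?_, ?_, ?_⟩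
  · intro w
    refine add_mem (hm w) (C_smul_mem hF _ ?_)
    rw [sub_smul]
    exact sub_mem (rootPoly_smul_mem hF (hn w)) (rootPoly_smul_mem hF (hn w))
  · intro u hu z hz huz
    refine add_mem (hs u hu z hz huz) ((F.rel u z).smul_mem (MvPolynomial.C (1 / 2 * r⁻¹))
      (x := ((cs.rootPoly i y - cs.rootPoly i u) • n u,
        (cs.rootPoly i y - cs.rootPoly i z) • n z)) ?_)
    obtain ⟨d, hd⟩ := exists_rootPoly_sub_eq (cs := cs) i huz.1
    have h2 := sub_mem ((F.rel u z).smul_mem (cs.rootPoly i y - cs.rootPoly i u)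
      (hns u hu z hz huz)) ((F.rel u z).smul_mem (MvPolynomial.C d) (hF.rel_zero_smul huz (n z)))
    convert h2 using 1
    refine Prod.ext ?_ ?_
    · simp
    · simp only [Prod.smul_mk, Prod.mk_sub_mk]
      rw [smul_smul, ← hd, ← sub_smul]
      congr 1
      ring
  · dsimp only
    rw [sub_self, zero_smul, smul_zero, add_zero, hmy]
  · dsimp only
    rw [hne _ Relation.ReflTransGen.refl, hne₀, rootPoly_mul_simple, sub_neg_eq_add, smul_smul]
    have : MvPolynomial.C (1 / 2 * r⁻¹) * (cs.rootPoly i y + cs.rootPoly i y) =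
        cs.label (y * cs.simple i * y⁻¹) := by
      rw [e, mul_add, ← mul_assoc, ← map_mul, mul_assoc, inv_mul_cancel₀ hr, mul_one, ← add_mul,
        C_half_add_half, one_mul]
    rw [this, ← hc, add_sub_cancel]

/-- A homogeneous element over a coset extends to a section of the translated sheaf. -/
lemma exists_translate_section {f : ∀ v, F.stalk v} (hf : f ∈ F.cosetSections cs i y) {k : ℤ}
    (hk : ∀ v, f v ∈ F.gr v k) :
    ∃ m : ∀ w, (F.translate cs i).stalk w, HasDegree m k ∧
      (F.translate cs i).IsSection cs {z | cs.BruhatLE y z} m ∧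
      (m y).1 = f ∧ (m (y * cs.simple i)).1 = f := by
  obtain ⟨μ, hμ, hs, h1, h2⟩ := exists_section_of_coset hF hy hf hk
  obtain ⟨m, hm, hl⟩ := exists_isLiftOf (ν := fun _ => 0) hF (isStable_ge hy) hμ
    (fun w => zero_mem _) hs (fun _ _ _ _ _ => zero_mem _)
  refine ⟨m, hm, hl.isSection hF (isStable_ge hy) hs (fun _ _ _ _ _ => zero_mem _), ?_, ?_⟩
  · refine cosetSections_ext (m y).2 hf fun v hv => ?_
    rw [hl y Relation.ReflTransGen.refl v hv, smul_zero, add_zero]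
    rcases hv with rfl | rfl
    · exact h1
    · exact h2
  · refine cosetSections_ext (cosetSections_of_upper _) hf fun v hv => ?_
    rw [hl _ (edge_mul_simple hy).le v (by rw [simple_mul_simple_cancel_right]; exact hv.symm),
      smul_zero, add_zero]
    rcases hv with rfl | rfl
    · exact h1
    · exact h2

end Flabby

end RelSheaf

end CoxeterSystem

/-! ### Stalks and costalks of the translated sheaf -/

namespace CoxeterSystem

universe u v w

namespace RelSheaf

variable {B : Type u} {W : Type v} [Group W] {M : CoxeterMatrix B} {cs : CoxeterSystem M W}
  {F : RelSheaf.{u, v, w} B W} {i : B}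

lemma lower_or_upper (cs : CoxeterSystem M W) (i : B) (w : W) :
    cs.length w < cs.length (w * cs.simple i) ∨
      ∃ y, w = y * cs.simple i ∧ cs.length y < cs.length (y * cs.simple i) := by
  rcases lt_or_gt_of_ne (cs.length_mul_simple_ne w i) with hl | hl
  · exact Or.inr ⟨w * cs.simple i, (cs.simple_mul_simple_cancel_right i).symm,
      by rwa [simple_mul_simple_cancel_right]⟩
  · exact Or.inl hl

/-- The stalks of the translated sheaf at the two elements of a coset agree. -/
noncomputable def translateUpperEquiv (cs : CoxeterSystem M W) (F : RelSheaf.{u, v, w} B W) (i : B)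
    (y : W) :
    (F.translate cs i).stalk y ≃ₗ[PolyV B] (F.translate cs i).stalk (y * cs.simple i) :=
  LinearEquiv.ofEq _ _ (cosetSections_mul_simple y).symm

section Single

open Classical in
/-- The family with the value `a` at `y`. -/
noncomputable def single (F : RelSheaf.{u, v, w} B W) (y : W) :
    F.stalk y →ₗ[PolyV B] ∀ v, F.stalk v :=
  LinearMap.single (PolyV B) F.stalk y

omit [Group W] in
lemma single_self (y : W) (a : F.stalk y) : F.single y a y = a := by
  simp [single]

omit [Group W] in
lemma single_of_ne {y v : W} (h : v ≠ y) (a : F.stalk y) : F.single y a v = 0 := by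
  simp [single, h]

omit [Group W] in
lemma single_mem_gr {y : W} {k : ℤ} {a : F.stalk y} (v : W) (h : v = y → a ∈ F.gr y k) :
    F.single y a v ∈ F.gr v k := by
  by_cases hv : v = y
  · subst hv
    rw [single_self]
    exact h rfl
  · rw [single_of_ne hv]
    exact zero_mem _

omit [Group W] in
lemma single_mem_gr_iff {y : W} {k : ℤ} {a : F.stalk y} :
    (∀ v, F.single y a v ∈ F.gr v k) ↔ a ∈ F.gr y k := by
  refine ⟨fun h => ?_, fun h v => single_mem_gr v fun _ => h⟩
  have := h y
  rwa [single_self] at this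

end Single

section Good

variable {x : W} (hF : F.IsGood cs x)
include hF

lemma isGradedSMul_translate (w : W) : IsGradedSMul B ((F.translate cs i).gr w) :=
  fun j k a f ha hf v => (hF.proj v).isGradedSMul j k a (f.1 v) ha (hf v)

/-- Evaluation at `y` maps the coset sections onto the stalk of `F` at `y`. Its kernel consists of
the label multiples at `y s`, a copy of that stalk shifted by two. So the stalk is an extension of
graded projective modules. -/
lemma proj_translate_lower {y : W} (hy : cs.length y < cs.length (y * cs.simple i)) :
    IsGradedProjective B ((F.translate cs i).gr y) := by
  have hys := edge_mul_simple (cs := cs) hy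
  have hne := mul_simple_ne_self (cs := cs) y i
  have hA : IsGradedProjective B (fun k => F.gr (y * cs.simple i) (k - 2)) :=
    (hF.proj (y * cs.simple i)).of_equiv (LinearEquiv.refl _ _) 2 fun k v => by
      rw [add_sub_cancel_right]
      rfl
  have hj : ∀ d, F.single (y * cs.simple i) (cs.label (y * cs.simple i * y⁻¹) • d) ∈
      F.cosetSections cs i y := by
    intro d
    refine mem_cosetSections hy (fun v _ h => single_of_ne h _) ?_
    rw [single_of_ne hne.symm, single_self]
    exact hF.rel_zero_smul hys d
  refine IsGradedProjective.of_exact hA (hF.proj y) (isGradedSMul_translate hF y)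
    (M := (F.translate cs i).stalk y)
    (LinearMap.codRestrict _ (F.single (y * cs.simple i) ∘ₗ
      LinearMap.lsmul (PolyV B) _ (cs.label (y * cs.simple i * y⁻¹))) hj)
    (LinearMap.proj y ∘ₗ Submodule.subtype _) ?_ ?_ ?_ ?_ ?_
  · intro k f hf
    exact hf y
  · intro k a
    have h1 := single_mem_gr_iff (F := F) (k := k)
      (a := cs.label (y * cs.simple i * y⁻¹) • a)
    refine Iff.trans ?_ h1.symm
    constructor
    · intro ha
      have := (hF.proj _).isGradedSMul _ _ _ _ (label_mem (cs := cs) (y * cs.simple i * y⁻¹)) ha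
      rwa [add_sub_cancel] at this
    · intro ha
      refine (hF.proj _).mem_of_smul_mem (label_mem _) (label_ne_zero hys.1) ?_
      rw [add_sub_cancel]
      exact ha
  · intro a b hab
    have h1 := congrFun (congrArg Subtype.val hab) (y * cs.simple i)
    have h2 : cs.label (y * cs.simple i * y⁻¹) • a = cs.label (y * cs.simple i * y⁻¹) • b := by
      rw [← single_self (F := F) (y * cs.simple i) (_ • a),
        ← single_self (F := F) (y * cs.simple i) (_ • b)]
      exact h1
    exact (hF.proj _).smul_injective (label_ne_zero hys.1) h2
  · intro f hf
    have hf : f.1 y = 0 := hf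
    have h1 := cosetSections_rel f.2 hy
    rw [hf, hF.rel_zero _ _ hys] at h1
    obtain ⟨d, hd⟩ := h1
    refine ⟨d, Subtype.ext (cosetSections_ext (hj d) f.2 ?_)⟩
    rintro v (rfl | rfl)
    · exact (single_of_ne hne.symm _).trans hf.symm
    · exact (single_self _ _).trans hd.symm
  · intro k c hc
    obtain ⟨m, hm, hs, hmy⟩ := hF.exists_section hc
    have h1 := hs y Relation.ReflTransGen.refl _ hys.le hys
    refine ⟨⟨F.single y (m y) + F.single (y * cs.simple i) (m _), mem_cosetSections hy ?_ ?_⟩,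
      ?_, ?_⟩
    · intro v h h'
      rw [Pi.add_apply, single_of_ne h, single_of_ne h', add_zero]
    · rw [Pi.add_apply, Pi.add_apply, single_self, single_self, single_of_ne hne,
        single_of_ne hne.symm, add_zero, zero_add]
      exact h1
    · exact fun v => add_mem (single_mem_gr v fun _ => hm _) (single_mem_gr v fun _ => hm _)
    · change F.single y (m y) y + F.single (y * cs.simple i) (m _) y = c
      rw [single_self, single_of_ne hne.symm, add_zero, hmy]

lemma proj_translate (w : W) : IsGradedProjective B ((F.translate cs i).gr w) := by
  rcases lower_or_upper cs i w with hw | ⟨y, rfl, hy⟩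
  · exact proj_translate_lower hF hw
  · refine (proj_translate_lower hF hy).of_equiv (translateUpperEquiv cs F i y) 0 fun k f => ?_
    rw [add_zero]
    exact Iff.rfl

lemma subsingleton_translate (hx : cs.length x < cs.length (x * cs.simple i)) (w : W)
    (hw : cs.length (x * cs.simple i) < cs.length w) :
    Subsingleton ((F.translate cs i).stalk w) := by
  have h1 := hF.subsingleton w (by omega)
  have h2 := hF.subsingleton (w * cs.simple i) (by have := cs.length_mul_simple w i; omega)
  refine ⟨fun f g => Subtype.ext (cosetSections_ext f.2 g.2 ?_)⟩
  rintro v (rfl | rfl)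
  · exact h1.elim _ _
  · exact h2.elim _ _

/-- Away from the coset of `y`, both coordinates of `g` are divisible by the label. The quotients
still form a coset section, since this label differs from the one of the edge joining `z` and `z s`.
-/
lemma rel_zero_translate (y z : W) (h : cs.Edge y z) (g : (F.translate cs i).stalk z) :
    (0, g) ∈ (F.translate cs i).rel y z ↔ ∃ c, g = cs.label (z * y⁻¹) • c := by
  by_cases hne : z = y * cs.simple i
  · subst hne
    rw [translate_rel_simple_iff]
    constructor
    · rintro ⟨f, hf, e⟩
      refine ⟨⟨-f, (cosetSections_mul_simple y).ge (neg_mem hf)⟩, Subtype.ext ?_⟩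
      change g.1 = cs.label (y * cs.simple i * y⁻¹) • (-f)
      rw [smul_neg, ← e]
      change g.1 = -((0 : ∀ v, F.stalk v) - g.1)
      rw [zero_sub, neg_neg]
    · rintro ⟨c, rfl⟩
      refine ⟨-c.1, neg_mem (cosetSections_of_upper c), ?_⟩
      change (0 : ∀ v, F.stalk v) - cs.label (y * cs.simple i * y⁻¹) • c.1 = _
      rw [zero_sub, smul_neg]
  · rw [translate_rel_iff hne]
    have h' := h.mul_simple i hne
    have hlab : cs.label (z * cs.simple i * (y * cs.simple i)⁻¹) = cs.label (z * y⁻¹) := by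
      rw [mul_simple_mul_inv_eq]
    constructor
    · rintro ⟨h1, h2⟩
      have h1 : (0, g.1 z) ∈ F.rel y z := h1
      have h2 : (0, g.1 (z * cs.simple i)) ∈ F.rel (y * cs.simple i) (z * cs.simple i) := h2
      rw [hF.rel_zero y z h] at h1
      rw [hF.rel_zero _ _ h', hlab] at h2
      obtain ⟨c, hc⟩ := h1
      obtain ⟨d, hd⟩ := h2
      have hzz := mul_simple_ne_self (cs := cs) z i
      set e : ∀ v, F.stalk v := F.single z c + F.single (z * cs.simple i) d with he
      have ez : e z = c := by
        rw [he, Pi.add_apply, single_self, single_of_ne hzz.symm, add_zero]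
      have ezs : e (z * cs.simple i) = d := by
        rw [he, Pi.add_apply, single_self, single_of_ne hzz, zero_add]
      have heq : ∀ v, v = z ∨ v = z * cs.simple i → g.1 v = cs.label (z * y⁻¹) • e v := by
        rintro v (rfl | rfl)
        · rw [ez, hc]
        · rw [ezs, hd]
      have hmem : e ∈ F.cosetSections cs i z := by
        refine ⟨fun v hv hv' => by
          rw [he, Pi.add_apply, single_of_ne hv, single_of_ne hv', add_zero], ?_⟩
        intro a ha b hb hab
        refine hF.rel_of_label_smul hab h.1 ?_ ?_
        · have hab' : b * a⁻¹ = z * cs.simple i * z⁻¹ := by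
            have hsi := cs.inv_simple i
            rcases ha with rfl | rfl <;> rcases hb with rfl | rfl
            · exact absurd hab.2 (lt_irrefl _)
            · rfl
            · rw [mul_inv_rev, hsi, mul_assoc]
            · exact absurd hab.2 (lt_irrefl _)
          rw [hab']
          intro e'
          apply hne
          have e2 : y = z * cs.simple i := by
            have := congrArg (fun t => t⁻¹ * z) e'
            simpa [mul_assoc] using this
          rw [e2, simple_mul_simple_cancel_right]
        · rw [← heq a ha, ← heq b hb]
          exact g.2.2 a ha b hb hab
      exact ⟨⟨e, hmem⟩, Subtype.ext (cosetSections_ext g.2 (Submodule.smul_mem _ _ hmem) heq)⟩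
    · rintro ⟨c, rfl⟩
      refine ⟨hF.rel_zero_smul h (c.1 z), ?_⟩
      have := hF.rel_zero_smul h' (c.1 (z * cs.simple i))
      rwa [hlab] at this

/-- The translate of a good sheaf is good. -/
theorem isGood_translate (hx : cs.length x < cs.length (x * cs.simple i)) :
    (F.translate cs i).IsGood cs (x * cs.simple i) where
  proj := proj_translate hF
  subsingleton := subsingleton_translate hF hx
  rel_zero := rel_zero_translate hF
  flabby := fun w => by
    rcases lower_or_upper cs i w with hw | ⟨y, rfl, hy⟩
    · exact flabbyAt_translate_lower hF hw
    · exact flabbyAt_translate_upper hF hy (subsingleton_translate hF hx)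
  extend := by
    intro w k f hf
    rcases lower_or_upper cs i w with hy | ⟨y, rfl, hy⟩
    · obtain ⟨m, hm, hs, h1, h2⟩ := exists_translate_section hF hy f.2 hf
      refine ⟨m, hm, hs.mono fun z hz => hz.1, fun z hz => ?_⟩
      rw [← show m w = f from Subtype.ext h1]
      exact hs w Relation.ReflTransGen.refl z hz.le hz
    · obtain ⟨m, hm, hs, h1, h2⟩ := exists_translate_section hF hy (cosetSections_of_upper f) hf
      have hys := (edge_mul_simple hy).le
      refine ⟨m, hm, hs.mono fun z hz => hys.trans hz.1, fun z hz => ?_⟩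
      rw [← show m (y * cs.simple i) = f from Subtype.ext h2]
      exact hs _ hys z (hys.trans hz.le) hz

/-! ### The costalks of the translated sheaf -/

variable {y : W} (hy : cs.length y < cs.length (y * cs.simple i))
include hy

-- Right multiplication by `s` matches the edges out of `y s` with the edges out of `y` other than
-- the one to `y s`. So the conditions on the two coordinates separate.
omit hF in
lemma mem_costalk_upper_iff (f : (F.translate cs i).stalk (y * cs.simple i)) :
    f ∈ (F.translate cs i).costalk cs (y * cs.simple i) ↔
      (∀ z, z ≠ y * cs.simple i → cs.Edge y z → (f.1 y, 0) ∈ F.rel y z) ∧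
        f.1 (y * cs.simple i) ∈ F.costalk cs (y * cs.simple i) := by
  constructor
  · intro h
    have key : ∀ z, z ≠ y * cs.simple i → cs.Edge y z → (f.1 y, 0) ∈ F.rel y z ∧
        (f.1 (y * cs.simple i), 0) ∈ F.rel (y * cs.simple i) (z * cs.simple i) :=
      fun z hne hz => (translate_rel_upper_iff hne).mp (h _ (hz.mul_simple i hne))
    refine ⟨fun z hne hz => (key z hne hz).1, fun z hz => ?_⟩
    have hne : z * cs.simple i ≠ y * cs.simple i := fun e => by
      have := hz.2
      rw [mul_right_cancel e] at this
      omega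
    have hz' : cs.Edge y (z * cs.simple i) := by
      rw [← edge_upper_iff hy hne, simple_mul_simple_cancel_right]
      exact hz
    have := (key _ hne hz').2
    rwa [simple_mul_simple_cancel_right] at this
  · rintro ⟨h1, h2⟩ z hz
    have hne : z * cs.simple i ≠ y * cs.simple i := fun e => by
      have := hz.2
      rw [mul_right_cancel e] at this
      omega
    have hz' : cs.Edge y (z * cs.simple i) := by
      rw [← edge_upper_iff hy hne, simple_mul_simple_cancel_right]
      exact hz
    have h3 := (translate_rel_upper_iff (F := F) (z := z * cs.simple i) hne (f := f) (g := 0)).mpr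
      ⟨h1 _ hne hz', h2 _ (by rw [simple_mul_simple_cancel_right]; exact hz)⟩
    rwa [simple_mul_simple_cancel_right] at h3

/-- Evaluation at `y s` maps onto the costalk of `F` there. If the coordinate at `y s` vanishes, the
one at `y` is compatible with zero along all edges, so the kernel is the costalk at `y`. Again an
extension of graded projectives. -/
lemma costalk_translate_upper
    (h1 : IsGradedProjective B (subGr (F.gr y) (F.costalk cs y)))
    (h2 : IsGradedProjective B (subGr (F.gr (y * cs.simple i)) (F.costalk cs (y * cs.simple i)))) :
    IsGradedProjective B (subGr ((F.translate cs i).gr (y * cs.simple i))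
      ((F.translate cs i).costalk cs (y * cs.simple i))) := by
  have hys := edge_mul_simple (cs := cs) hy
  have hne := mul_simple_ne_self (cs := cs) y i
  have hj : ∀ a ∈ F.costalk cs y, F.single y a ∈ F.cosetSections cs i y := by
    intro a ha
    refine mem_cosetSections hy (fun v h _ => single_of_ne h _) ?_
    rw [single_of_ne hne, single_self]
    exact ha _ hys
  let j₀ : F.costalk cs y →ₗ[PolyV B] (F.translate cs i).stalk (y * cs.simple i) :=
    LinearMap.codRestrict _ (F.single y ∘ₗ (F.costalk cs y).subtype)
      fun a => (cosetSections_mul_simple y).ge (hj a a.2)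
  have hj₀ : ∀ a, (j₀ a).1 = F.single y a.1 := fun a => rfl
  have hj₁ : ∀ a, j₀ a ∈ (F.translate cs i).costalk cs (y * cs.simple i) := by
    intro a
    rw [mem_costalk_upper_iff hy, hj₀, single_self, single_of_ne hne]
    exact ⟨fun z _ hz => a.2 z hz, zero_mem _⟩
  let ev : (F.translate cs i).costalk cs (y * cs.simple i) →ₗ[PolyV B]
      F.costalk cs (y * cs.simple i) :=
    LinearMap.codRestrict _ (LinearMap.proj (y * cs.simple i) ∘ₗ
      (F.cosetSections cs i (y * cs.simple i)).subtype ∘ₗ Submodule.subtype _)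
      fun f => ((mem_costalk_upper_iff hy f.1).mp f.2).2
  refine IsGradedProjective.of_exact h1 h2 (fun p q a f ha hf =>
    isGradedSMul_translate hF _ p q a f.1 ha hf) (LinearMap.codRestrict _ j₀ hj₁) ev ?_ ?_ ?_ ?_ ?_
  · intro k f hf
    exact hf (y * cs.simple i)
  · intro k a
    exact single_mem_gr_iff.symm
  · intro a b hab
    have h3 : F.single y a.1 y = F.single y b.1 y :=
      congrFun (congrArg (fun f => f.1.1) hab) y
    rw [single_self, single_self] at h3
    exact Subtype.ext h3
  · intro f hf
    have hf0 : f.1.1 (y * cs.simple i) = 0 := congrArg Subtype.val hf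
    have hfs := cosetSections_of_upper f.1
    have hmem := (mem_costalk_upper_iff hy f.1).mp f.2
    have hfy : f.1.1 y ∈ F.costalk cs y := by
      intro z hz
      by_cases hzs : z = y * cs.simple i
      · subst hzs
        have := cosetSections_rel hfs hy
        rwa [hf0] at this
      · exact hmem.1 z hzs hz
    refine ⟨⟨f.1.1 y, hfy⟩, Subtype.ext (Subtype.ext (cosetSections_ext (hj _ hfy) hfs ?_))⟩
    rintro v (rfl | rfl)
    · exact single_self _ _
    · exact (single_of_ne hne _).trans hf0.symm
  · intro k c hc
    -- A costalk element at `y s`, extended by zero, is a section on `{> y}`; flabbiness at `y`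
    -- supplies the other coordinate of a preimage.
    obtain ⟨a, ha, hac⟩ := hF.flabby y k (F.single (y * cs.simple i) c.1)
      (fun v => single_mem_gr v fun _ => hc) (by
        intro u hu z hz huz
        have hzs : z ≠ y * cs.simple i := by
          rintro rfl
          have := BruhatLT.length_lt hu
          have := huz.2
          have := cs.length_mul_simple y i
          omega
        rw [single_of_ne hzs]
        by_cases hus : u = y * cs.simple i
        · subst hus
          rw [single_self]
          exact c.2 z huz
        · rw [single_of_ne hus]
          exact zero_mem _)
    set e : ∀ v, F.stalk v := F.single y a + F.single (y * cs.simple i) c.1 with he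
    have ey : e y = a := by
      rw [he, Pi.add_apply, single_self, single_of_ne hne.symm, add_zero]
    have eys : e (y * cs.simple i) = c.1 := by
      rw [he, Pi.add_apply, single_self, single_of_ne hne, zero_add]
    have hmem : e ∈ F.cosetSections cs i y := by
      refine mem_cosetSections hy (fun v hv hv' => by
        rw [he, Pi.add_apply, single_of_ne hv, single_of_ne hv', add_zero]) ?_
      rw [ey, eys]
      have := hac _ hys
      rwa [single_self] at this
    refine ⟨⟨⟨e, (cosetSections_mul_simple y).ge hmem⟩, ?_⟩, ?_, ?_⟩
    · refine (mem_costalk_upper_iff hy _).mpr ⟨fun z hz hyz => ?_, ?_⟩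
      · have := hac z hyz
        rw [single_of_ne hz] at this
        change (e y, 0) ∈ _
        rwa [ey]
      · change e (y * cs.simple i) ∈ _
        rw [eys]
        exact c.2
    · intro v
      exact add_mem (single_mem_gr v fun _ => ha) (single_mem_gr v fun _ => hc)
    · exact Subtype.ext eys

/-- Multiplication by the label of the edge from `y` to `y s` identifies the costalk at `y s` with
that at `y`, up to a shift by two. Compatibility with zero along that edge is divisibility by the
label, and along the other edges this label can be cancelled. -/
lemma costalk_translate_lower
    (h : IsGradedProjective B (subGr ((F.translate cs i).gr (y * cs.simple i))
      ((F.translate cs i).costalk cs (y * cs.simple i)))) :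
    IsGradedProjective B (subGr ((F.translate cs i).gr y) ((F.translate cs i).costalk cs y)) := by
  have hys := edge_mul_simple (cs := cs) hy
  have hlab := label_ne_zero hys.1
  let θ : (F.translate cs i).costalk cs (y * cs.simple i) →ₗ[PolyV B] (F.translate cs i).stalk y :=
    LinearMap.lsmul (PolyV B) _ (cs.label (y * cs.simple i * y⁻¹)) ∘ₗ
      (translateUpperEquiv cs F i y).symm.toLinearMap ∘ₗ Submodule.subtype _
  have hθ : ∀ f, (θ f).1 = cs.label (y * cs.simple i * y⁻¹) • f.1.1 := fun f => rfl
  have hθmem : ∀ f, θ f ∈ (F.translate cs i).costalk cs y := by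
    intro f z hz
    by_cases hne : z = y * cs.simple i
    · subst hne
      refine translate_rel_simple_iff.mpr ⟨f.1.1, cosetSections_of_upper f.1, ?_⟩
      rw [hθ]
      exact sub_zero _
    · have h1 := (mem_costalk_upper_iff hy f.1).mp f.2
      refine (translate_rel_iff hne).mpr ⟨?_, ?_⟩
      · have := (F.rel y z).smul_mem (cs.label (y * cs.simple i * y⁻¹)) (h1.1 z hne hz)
        rwa [Prod.smul_mk, smul_zero] at this
      · have := (F.rel _ _).smul_mem (cs.label (y * cs.simple i * y⁻¹))
          (h1.2 _ (hz.mul_simple i hne))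
        rwa [Prod.smul_mk, smul_zero] at this
  have hinj : Function.Injective (LinearMap.codRestrict _ θ hθmem) := by
    intro f g hfg
    refine Subtype.ext (Subtype.ext ?_)
    have h1 : cs.label (y * cs.simple i * y⁻¹) • f.1.1 =
        cs.label (y * cs.simple i * y⁻¹) • g.1.1 := congrArg (fun f => f.1.1) hfg
    funext v
    exact (hF.proj v).smul_injective hlab (congrFun h1 v)
  have hsurj : Function.Surjective (LinearMap.codRestrict _ θ hθmem) := by
    intro g
    obtain ⟨f, hf, e⟩ := translate_rel_simple_iff.mp (g.2 _ hys)
    have e : g.1.1 = cs.label (y * cs.simple i * y⁻¹) • f := by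
      rw [← e]
      exact (sub_zero _).symm
    refine ⟨⟨⟨f, (cosetSections_mul_simple y).ge hf⟩, ?_⟩, Subtype.ext (Subtype.ext e.symm)⟩
    have key : ∀ z, z ≠ y * cs.simple i → cs.Edge y z → (f y, 0) ∈ F.rel y z ∧
        (f (y * cs.simple i), 0) ∈ F.rel (y * cs.simple i) (z * cs.simple i) := by
      intro z hne hz
      have hz' := hz.mul_simple i hne
      have hne' : y * cs.simple i * y⁻¹ ≠ z * y⁻¹ := fun e => hne (mul_right_cancel e).symm
      have h1 := (translate_rel_iff hne).mp (g.2 z hz)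
      rw [e] at h1
      refine ⟨hF.rel_of_label_smul hz hys.1 hne' ?_,
        hF.rel_of_label_smul hz' hys.1 (by rwa [mul_simple_mul_inv_eq]) ?_⟩
      · rw [smul_zero]
        exact h1.1
      · rw [smul_zero]
        exact h1.2
    refine (mem_costalk_upper_iff hy _).mpr ⟨fun z hne hz => (key z hne hz).1, fun z hz => ?_⟩
    have hne : z * cs.simple i ≠ y * cs.simple i := fun e => by
      have := hz.2
      rw [mul_right_cancel e] at this
      omega
    have hz' : cs.Edge y (z * cs.simple i) := by
      rw [← edge_upper_iff hy hne, simple_mul_simple_cancel_right]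
      exact hz
    have := (key _ hne hz').2
    rwa [simple_mul_simple_cancel_right] at this
  refine h.of_equiv (LinearEquiv.ofBijective _ ⟨hinj, hsurj⟩) 2 fun k f => ?_
  change (∀ v, f.1.1 v ∈ F.gr v k) ↔
    ∀ v, cs.label (y * cs.simple i * y⁻¹) • f.1.1 v ∈ F.gr v (k + 2)
  refine forall_congr' fun v => ⟨fun hv => ?_, fun hv => ?_⟩
  · have := (hF.proj v).isGradedSMul _ _ _ _ (label_mem (cs := cs) (y * cs.simple i * y⁻¹)) hv
    rwa [add_comm] at this
  · rw [add_comm] at hv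
    exact (hF.proj v).mem_of_smul_mem (label_mem _) hlab hv

omit hy in
theorem costalk_translate (h : ∀ w, IsGradedProjective B (subGr (F.gr w) (F.costalk cs w)))
    (w : W) :
    IsGradedProjective B (subGr ((F.translate cs i).gr w) ((F.translate cs i).costalk cs w)) := by
  rcases lower_or_upper cs i w with hw | ⟨y, rfl, hy⟩
  · exact costalk_translate_lower hF hw (costalk_translate_upper hF hw (h _) (h _))
  · exact costalk_translate_upper hF hy (h _) (h _)

omit hF hy in
lemma top_translate_val [Subsingleton (F.stalk (y * cs.simple i))]
    (f : (F.translate cs i).stalk y) : f.1 = F.single y (f.1 y) := by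
  have hne := mul_simple_ne_self (cs := cs) y i
  funext v
  by_cases hv : v = y
  · subst hv
    rw [single_self]
  · rw [single_of_ne hv]
    by_cases hv' : v = y * cs.simple i
    · subst hv'
      exact Subsingleton.elim _ _
    · exact f.2.1 v hv hv'

end Good

end RelSheaf

end CoxeterSystem

namespace CoxeterSystem

universe u v w

namespace RelSheaf

variable {B : Type u} {W : Type v} [Group W] {M : CoxeterMatrix B} {cs : CoxeterSystem M W}

/-! ### Bott–Samelson sheaves -/

section Skyscraper

/-- The stalks of the skyscraper sheaf: functions that vanish outside of `{w} ∩ {1}`. -/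
def skyscraperStalk (B : Type u) {W : Type v} [Group W] (w : W) :
    Submodule (PolyV B) (W → PolyV B) where
  carrier := {f : W → PolyV B | ∀ v, ¬ (v = w ∧ w = 1) → f v = 0}
  add_mem' := fun hf hg v hv => by rw [Pi.add_apply, hf v hv, hg v hv, add_zero]
  zero_mem' := fun _ _ => rfl
  smul_mem' := fun r f hf v hv => by rw [Pi.smul_apply, hf v hv, smul_zero]

/-- The sheaf with stalk `S` at the identity and no other stalks. -/
noncomputable def skyscraper (B : Type u) (W : Type v) [Group W] :
    RelSheaf.{u, v, max u v} B W where
  stalk w := skyscraperStalk B w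
  gr _ k :=
    { carrier := {f | ∀ v, f.1 v ∈ symGr B k}
      add_mem' := fun hf hg v => add_mem (hf v) (hg v)
      zero_mem' := fun _ => zero_mem _
      neg_mem' := fun hf v => neg_mem (hf v) }
  rel _ _ := ⊤

lemma subsingleton_skyscraper {w : W} (hw : w ≠ 1) : Subsingleton ((skyscraper B W).stalk w) :=
  ⟨fun f g => Subtype.ext <| funext fun v =>
    (f.2 v fun h => hw h.2).trans (g.2 v fun h => hw h.2).symm⟩

open Classical in
/-- The stalk at the identity. -/
noncomputable def skyscraperEquiv (B : Type u) (W : Type v) [Group W] :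
    (skyscraper B W).stalk 1 ≃ₗ[PolyV B] PolyV B where
  toFun f := f.1 1
  map_add' _ _ := rfl
  map_smul' _ _ := rfl
  invFun a := ⟨Pi.single 1 a, fun v hv => by
    rw [Pi.single_eq_of_ne fun h => hv ⟨h, rfl⟩]⟩
  left_inv f := Subtype.ext <| funext fun v => by
    by_cases hv : v = 1
    · subst hv
      change (Pi.single 1 (f.1 1) : W → PolyV B) 1 = f.1 1
      rw [Pi.single_eq_same]
    · change (Pi.single 1 (f.1 1) : W → PolyV B) v = f.1 v
      rw [Pi.single_eq_of_ne hv, f.2 v fun h => hv h.1]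
  right_inv a := by
    change (Pi.single 1 a : W → PolyV B) 1 = a
    rw [Pi.single_eq_same]

lemma skyscraperEquiv_apply (f : (skyscraper B W).stalk 1) : skyscraperEquiv B W f = f.1 1 := rfl

lemma isGradedIso_skyscraperEquiv :
    IsGradedIso ((skyscraper B W).gr 1) (symGr B) (skyscraperEquiv B W) := by
  intro k f
  rw [skyscraperEquiv_apply]
  refine ⟨fun h => h 1, fun h v => ?_⟩
  by_cases hv : v = 1
  · subst hv
    exact h
  · rw [f.2 v fun h => hv h.1]
    exact zero_mem _

lemma proj_skyscraper (w : W) : IsGradedProjective B ((skyscraper B W).gr w) := by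
  by_cases hw : w = 1
  · subst hw
    refine IsGradedProjective.symGr.of_equiv (skyscraperEquiv B W).symm 0 fun k a => ?_
    rw [add_zero, isGradedIso_skyscraperEquiv, LinearEquiv.apply_symm_apply]
  · have := subsingleton_skyscraper (B := B) hw
    exact IsGradedProjective.of_subsingleton

lemma isGood_skyscraper : (skyscraper B W).IsGood cs 1 where
  proj := proj_skyscraper
  subsingleton w hw := subsingleton_skyscraper fun h => by
    rw [h] at hw
    exact lt_irrefl _ hw
  rel_zero y z h b := by
    have := subsingleton_skyscraper (B := B) (w := z) fun hz => by
      have := h.2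
      rw [hz, cs.length_one] at this
      exact absurd this (Nat.not_lt_zero _)
    exact ⟨fun _ => ⟨0, Subsingleton.elim _ _⟩, fun _ => trivial⟩
  flabby y k m _ _ := ⟨0, zero_mem _, fun _ _ => trivial⟩
  extend y k a _ := ⟨0, fun _ => zero_mem _, fun _ _ _ _ _ => trivial, fun _ _ => trivial⟩

lemma costalk_skyscraper (w : W) : IsGradedProjective B
    (subGr ((skyscraper B W).gr w) ((skyscraper B W).costalk cs w)) :=
  (proj_skyscraper w).of_retract (Submodule.subtype _)
    (LinearMap.codRestrict _ LinearMap.id fun _ _ _ => trivial) (fun _ _ h => h) (fun _ _ h => h)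
    fun _ => rfl

end Skyscraper

open Classical in
/-- The stalk of a translated sheaf at the largest element of the support. -/
noncomputable def translateTopEquiv {F : RelSheaf.{u, v, w} B W} {i : B} {x : W}
    (hF : F.IsGood cs x) (hx : cs.length x < cs.length (x * cs.simple i)) :
    (F.translate cs i).stalk x ≃ₗ[PolyV B] F.stalk x where
  toFun f := f.1 x
  map_add' _ _ := rfl
  map_smul' _ _ := rfl
  invFun a := ⟨F.single x a, by
    have := hF.subsingleton _ hx
    refine mem_cosetSections hx (fun v hv _ => single_of_ne hv _) ?_
    rw [single_self]
    exact hF.rel_of_subsingleton (edge_mul_simple hx) _ _⟩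
  left_inv f := by
    have := hF.subsingleton _ hx
    exact Subtype.ext (top_translate_val f).symm
  right_inv a := single_self x a

lemma isGradedIso_translateTopEquiv {F : RelSheaf.{u, v, w} B W} {i : B} {x : W}
    (hF : F.IsGood cs x) (hx : cs.length x < cs.length (x * cs.simple i)) :
    IsGradedIso ((F.translate cs i).gr x) (F.gr x) (translateTopEquiv hF hx) := by
  intro k f
  refine ⟨fun h => h x, fun h v => ?_⟩
  have := hF.subsingleton _ hx
  have h1 := top_translate_val f
  rw [h1]
  exact single_mem_gr v fun _ => h

/-- There is a sheaf with the same support and top stalk as the Braden–MacPherson sheaf whose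
stalks and costalks are all graded projective. -/
theorem exists_bottSamelson (cs : CoxeterSystem M W) (x : W) :
    ∃ F : RelSheaf.{u, v, max u v} B W, F.IsGood cs x ∧
      (∀ w, IsGradedProjective B (subGr (F.gr w) (F.costalk cs w))) ∧
      ∃ e : F.stalk x ≃ₗ[PolyV B] PolyV B, IsGradedIso (F.gr x) (symGr B) e := by
  induction hn : cs.length x generalizing x with
  | zero =>
    rw [cs.length_eq_zero_iff] at hn
    subst hn
    exact ⟨skyscraper B W, isGood_skyscraper, costalk_skyscraper, skyscraperEquiv B W,
      isGradedIso_skyscraperEquiv⟩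
  | succ n ih =>
    have hx : x ≠ 1 := fun h => by
      rw [h, cs.length_one] at hn
      omega
    -- Write `x = y s` with `y` shorter and translate the sheaf for `y`. The new stalks at `y` and
    -- `x` coincide, and both are the old top stalk because the old stalk at `x` is zero.
    obtain ⟨i, hi⟩ := cs.exists_rightDescent_of_ne_one hx
    rw [isRightDescent_iff] at hi
    obtain ⟨y, rfl⟩ : ∃ y, x = y * cs.simple i := ⟨x * cs.simple i, by simp⟩
    rw [simple_mul_simple_cancel_right] at hi
    obtain ⟨F, hF, hK, e, he⟩ := ih y (by omega)
    have hy : cs.length y < cs.length (y * cs.simple i) := by omega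
    refine ⟨F.translate cs i, isGood_translate hF hy, costalk_translate hF hK,
      (translateUpperEquiv cs F i y).symm ≪≫ₗ translateTopEquiv hF hy ≪≫ₗ e, fun k f => ?_⟩
    have h1 := isGradedIso_translateTopEquiv hF hy k ((translateUpperEquiv cs F i y).symm f)
    rw [he] at h1
    exact h1

end RelSheaf

end CoxeterSystem

/-! ### Minimal sheaves as direct summands -/

namespace IsGradedProjective

open CoxeterSystem

universe u

variable {B : Type u} {M N : Type*} [AddCommGroup M] [Module (PolyV B) M] {ℳ : ℤ → AddSubgroup M}
  [AddCommGroup N] [Module (PolyV B) N] {𝒩 : ℤ → AddSubgroup N}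

lemma exists_sum_eq (h : IsGradedProjective B ℳ) (m : M) :
    ∃ (s : Finset ℤ) (x : ℤ → M), (∀ k, x k ∈ ℳ k) ∧ ∑ k ∈ s, x k = m := by
  obtain ⟨n, d, i, p, hi, hp, hpi⟩ := h
  obtain ⟨s, hs⟩ := (freeMod d).sum_proj (i m)
  refine ⟨s, fun k => p ((freeMod d).proj k (i m)), fun k => hp _ _ ((freeMod d).proj_mem k _), ?_⟩
  rw [← map_sum, hs s subset_rfl, hpi]

/-- Compare homogeneous components in the target: those of `m` outside degree `k` have zero image,
so injectivity kills them. -/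
lemma mem_of_map_mem (hM : IsGradedProjective B ℳ) (hN : IsGradedProjective B 𝒩)
    {f : M →ₗ[PolyV B] N} (hf : IsDegZero ℳ 𝒩 f) (hinj : Function.Injective f) {m : M} {k : ℤ}
    (hm : f m ∈ 𝒩 k) : m ∈ ℳ k := by
  classical
  obtain ⟨s, x, hx, rfl⟩ := hM.exists_sum_eq m
  have h1 := hN.indepGr (insert k s)
    (fun j => (if j ∈ s then f (x j) else 0) - if j = k then f (∑ k ∈ s, x k) else 0)
    (fun j => by
      refine sub_mem ?_ ?_
      · split_ifs
        · exact hf _ _ (hx j)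
        · exact zero_mem _
      · split_ifs with hj
        · rwa [hj]
        · exact zero_mem _)
    (by
      rw [Finset.sum_sub_distrib, Finset.sum_ite_eq', if_pos (Finset.mem_insert_self _ _),
        Finset.sum_ite_mem, Finset.inter_eq_right.mpr (Finset.subset_insert _ _), map_sum,
        sub_self])
  have h2 : ∀ j ∈ s, j ≠ k → x j = 0 := by
    intro j hj hjk
    have := h1 j (Finset.mem_insert_of_mem hj)
    rw [if_pos hj, if_neg hjk, sub_zero] at this
    exact (map_eq_zero_iff f hinj).mp this
  refine sum_mem fun j hj => ?_
  by_cases hjk : j = k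
  · exact hjk ▸ hx j
  · rw [h2 j hj hjk]
    exact zero_mem _

end IsGradedProjective

namespace CoxeterSystem

universe u v w w'

namespace RelSheaf

variable {B : Type u} {W : Type v} [Group W] {M : CoxeterMatrix B} {cs : CoxeterSystem M W}
  {F : RelSheaf.{u, v, w} B W} {H : RelSheaf.{u, v, w'} B W} {x : W}

/-- No proper homogeneous submodule of a stalk, except for the one at `x`, generates the stalk
modulo the costalk. -/
def IsMinimal (cs : CoxeterSystem M W) (F : RelSheaf.{u, v, w} B W) (x : W) : Prop :=
  ∀ w, w ≠ x → ∀ Q : Submodule (PolyV B) (F.stalk w), IsHomogeneousSubmodule (F.gr w) Q →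
    Q ⊔ F.costalk cs w = ⊤ → Q = ⊤

section Endomorphism

variable (hF : F.IsGood cs x) {φ : ∀ w, F.stalk w →ₗ[PolyV B] F.stalk w} (hφ : IsHom cs φ)
include hF hφ

/-- Let `b'` be a partner of `a`. Then `φ z (b - b')` is a multiple of the label; surjectivity of `φ
z` lifts the cofactor, and injectivity shows that `b - b'` itself is such a multiple. -/
lemma rel_of_map_rel {y z : W} (h : cs.Edge y z) (hz : Function.Bijective (φ z)) {a : F.stalk y}
    {b : F.stalk z} (hab : (φ y a, φ z b) ∈ F.rel y z) : (a, b) ∈ F.rel y z := by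
  obtain ⟨b', hb'⟩ := hF.exists_partner h a
  have h1 := sub_mem hab (hφ.map_rel y z h _ _ hb')
  rw [Prod.mk_sub_mk, sub_self, ← map_sub, hF.rel_zero y z h] at h1
  obtain ⟨c, hc⟩ := h1
  obtain ⟨c', rfl⟩ := hz.2 c
  rw [← map_smul] at hc
  have h2 := hz.1 hc
  have h3 := hF.rel_zero_smul h c'
  rw [← h2] at h3
  have := add_mem hb' h3
  rwa [Prod.mk_add_mk, add_zero, add_sub_cancel] at this

/-- A sheaf endomorphism of a minimal sheaf is bijective if it is bijective on the top stalk. -/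
theorem bijective_of_isMinimal (hmin : IsMinimal cs F x) (hx : Function.Bijective (φ x)) (w : W) :
    Function.Bijective (φ w) := by
  have key : ∀ n w, cs.length x < cs.length w + n → Function.Bijective (φ w) := by
    intro n
    induction n with
    | zero =>
      intro w hw
      have := hF.subsingleton w hw
      exact ⟨fun _ _ _ => Subsingleton.elim _ _, fun b => ⟨0, Subsingleton.elim _ _⟩⟩
    | succ n ih =>
      intro w hw
      by_cases hwx : w = x
      · exact hwx ▸ hx
      have hup : ∀ z, cs.length w < cs.length z → Function.Bijective (φ z) :=
        fun z hz => ih z (by omega)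
      -- Extend a homogeneous `a` to a section above `w`, pull that section back through the
      -- bijections there, and extend it down to some `a'`. Then `a - φ w a'` is in the costalk, so
      -- the range and the costalk together span, and minimality applies.
      have hsurj : LinearMap.range (φ w) = ⊤ := by
        refine hmin w hwx _ ?_ ?_
        · rw [← Submodule.map_top, ← (hF.proj w).homogeneous_top]
          refine le_antisymm (Submodule.span_le.mpr fun v hv => hv.1) ?_
          rw [Submodule.map_span_le]
          rintro v ⟨_, k, hv⟩
          exact Submodule.subset_span
            ⟨Submodule.mem_map_of_mem (Submodule.subset_span ⟨trivial, k, hv⟩), k,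
              hφ.isDegZero w k v hv⟩
        · refine eq_top_iff.mpr fun a _ => (hF.proj w).mem_of_homogeneous _ ?_ a
          intro k a ha
          obtain ⟨m, hm, hs, hc⟩ := hF.extend w k a ha
          have hex : ∀ z, ∃ b ∈ F.gr z k, cs.length w < cs.length z → φ z b = m z := by
            intro z
            by_cases hz : cs.length w < cs.length z
            · obtain ⟨b, hb⟩ := (hup z hz).2 (m z)
              exact ⟨b, (hF.proj z).mem_of_map_mem (hF.proj z) (hφ.isDegZero z) (hup z hz).1
                (hb ▸ hm z), fun _ => hb⟩
            · exact ⟨0, zero_mem _, fun h => absurd h hz⟩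
          choose m' hm' e using hex
          obtain ⟨a', ha', hc'⟩ := hF.flabby w k m' hm' (by
            intro y hy z hz hyz
            have h1 := BruhatLT.length_lt hy
            have h2 := BruhatLT.length_lt hz
            refine rel_of_map_rel hF hφ hyz (hup z h2) ?_
            rw [e y h1, e z h2]
            exact hs y hy z hz hyz)
          refine Submodule.mem_sup.mpr ⟨φ w a', ⟨a', rfl⟩, a - φ w a', fun z hz => ?_,
            add_sub_cancel _ _⟩
          have h1 := hφ.map_rel w z hz _ _ (hc' z hz)
          rw [e z hz.2] at h1
          have := sub_mem (hc z hz) h1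
          rwa [Prod.mk_sub_mk, sub_self] at this
      have hsurj := LinearMap.range_eq_top.mp hsurj
      have := (hF.proj w).finite
      -- A surjective endomorphism of a finite module over a commutative ring is injective.
      exact ⟨OrzechProperty.injective_of_surjective_endomorphism _ hsurj, hsurj⟩
  exact key _ w (by omega : cs.length x < cs.length w + (cs.length x + 1))

end Endomorphism

/-- The costalks of a minimal sheaf are direct summands of those of a sheaf with the same top
stalk. -/
theorem costalk_of_isMinimal (hF : F.IsGood cs x) (hH : H.IsGood cs x) (hmin : IsMinimal cs F x)
    (e : F.stalk x ≃ₗ[PolyV B] H.stalk x) (he : IsGradedIso (F.gr x) (H.gr x) e) {w : W}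
    (h : IsGradedProjective B (subGr (H.gr w) (H.costalk cs w))) :
    IsGradedProjective B (subGr (F.gr w) (F.costalk cs w)) := by
  obtain ⟨i, hi, hix⟩ := exists_isHom hF hH e.toLinearMap fun k v hv => (he k v).mp hv
  obtain ⟨p, hp, hpx⟩ := exists_isHom hH hF e.symm.toLinearMap fun k v hv => by
    rw [he]
    simpa using hv
  have hφ : IsHom cs fun w => p w ∘ₗ i w :=
    ⟨fun w k v hv => hp.isDegZero w k _ (hi.isDegZero w k v hv),
      fun y z h a b hab => hp.map_rel y z h _ _ (hi.map_rel y z h a b hab)⟩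
  have hbij := bijective_of_isMinimal hF hφ hmin (by
    rw [hix, hpx]
    exact (e.trans e.symm).bijective)
  -- With `ψ = p w ∘ i w` bijective, `ψ⁻¹ ∘ p w` is a retraction of `i w`. It respects costalks
  -- because compatibility with zero can be tested after applying `ψ`.
  let ψ := LinearEquiv.ofBijective _ (hbij w)
  have hψ : ∀ a, p w (i w (ψ.symm a)) = a := ψ.apply_symm_apply
  have hmap : ∀ a ∈ H.costalk cs w, ψ.symm (p w a) ∈ F.costalk cs w := by
    intro a ha z hz
    refine rel_of_map_rel hF hφ hz (hbij z) ?_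
    have := hp.map_rel w z hz _ _ (ha z hz)
    rw [map_zero] at this ⊢
    rwa [LinearMap.comp_apply, hψ]
  refine h.of_retract
    ((i w).restrict (p := F.costalk cs w) (q := H.costalk cs w) fun a ha z hz => by
      have := hi.map_rel w z hz _ _ (ha z hz)
      rwa [map_zero] at this)
    ((ψ.symm.toLinearMap ∘ₗ p w).restrict (p := H.costalk cs w) (q := F.costalk cs w) hmap)
    (fun k a ha => hi.isDegZero w k _ ha) (fun k a ha => ?_) fun a => Subtype.ext ?_
  · refine (hF.proj w).mem_of_map_mem (hF.proj w) (hφ.isDegZero w) (hbij w).1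
      (m := ψ.symm (p w a.1)) ?_
    rw [LinearMap.comp_apply, hψ]
    exact hp.isDegZero w k _ ha
  · exact ψ.symm_apply_apply a.1

end RelSheaf

end CoxeterSystem

namespace CoxeterSystem

universe u v

variable {B : Type u} {W : Type v} [Group W] {M : CoxeterMatrix B} {cs : CoxeterSystem M W}

/-! ### The Braden–MacPherson sheaf as a sheaf given by relations -/

lemma UpEdge.edge {y : W} (E : cs.UpEdge y) : cs.Edge y E.target := by
  refine ⟨?_, E.2.2.length_lt⟩
  rw [UpEdge.target, mul_inv_cancel_right]
  exact E.2.1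

lemma UpEdge.target_mul_inv {y : W} (E : cs.UpEdge y) : E.target * y⁻¹ = E.1 :=
  mul_inv_cancel_right _ _

lemma UpEdge.target_injective {y : W} {E E' : cs.UpEdge y} (h : E.target = E'.target) : E = E' :=
  Subtype.ext (mul_right_cancel h)

lemma Edge.exists_upEdge {y z : W} (h : cs.Edge y z) : ∃ E : cs.UpEdge y, E.target = z :=
  ⟨⟨z * y⁻¹, h.1, by rw [inv_mul_cancel_right]; exact h.lt⟩, inv_mul_cancel_right _ _⟩

namespace BruhatSheaf

/-- The sheaf given by the relations `ρ_{y,E}(a) = [b]`. -/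
def toRelSheaf (ℱ : cs.BruhatSheaf) : RelSheaf.{u, v, u} B W where
  stalk w := ℱ.stalk w
  gr w := (ℱ.stalk w).gr
  rel y z :=
    -- An edge out of `y` is determined by its end point, so at most one `E` occurs; if there is
    -- none, every pair is compatible.
    { carrier := {p | ∀ (E : cs.UpEdge y) (h : z = E.target), ℱ.ρ y E p.1 = ℱ.toEdge E (h ▸ p.2)}
      add_mem' := by
        rintro p q hp hq E rfl
        have h1 := hp E rfl
        have h2 := hq E rfl
        rw [Prod.fst_add, Prod.snd_add, map_add, map_add, h1, h2]
      zero_mem' := by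
        rintro E rfl
        rw [Prod.fst_zero, Prod.snd_zero, map_zero, map_zero]
      smul_mem' := by
        rintro r p hp E rfl
        have h1 := hp E rfl
        rw [Prod.smul_fst, Prod.smul_snd, map_smul, map_smul, h1] }

variable {ℱ : cs.BruhatSheaf}

lemma toRelSheaf_rel_iff {y : W} (E : cs.UpEdge y) {a : ℱ.stalk y} {b : ℱ.stalk E.target} :
    (a, b) ∈ ℱ.toRelSheaf.rel y E.target ↔ ℱ.ρ y E a = ℱ.toEdge E b := by
  refine ⟨fun h => h E rfl, fun h E' hE => ?_⟩
  obtain rfl := UpEdge.target_injective hE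
  exact h

lemma isCompatible_toRelSheaf_iff {y : W} {a : ℱ.stalk y} {m : ∀ w, ℱ.stalk w} :
    ℱ.toRelSheaf.IsCompatible cs a m ↔ ∀ E : cs.UpEdge y, ℱ.ρ y E a = ℱ.toEdge E (m E.target) := by
  refine ⟨fun h E => (toRelSheaf_rel_iff E).mp (h _ E.edge), fun h z hz => ?_⟩
  obtain ⟨E, rfl⟩ := hz.exists_upEdge
  exact (toRelSheaf_rel_iff E).mpr (h E)

lemma isSection_toRelSheaf_iff {I : Set W} {m : ∀ w, ℱ.stalk w} :
    ℱ.toRelSheaf.IsSection cs I m ↔ (fun w : I => m w) ∈ ℱ.sections I := by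
  refine ⟨fun h w hw E hE => (toRelSheaf_rel_iff E).mp (h w hw _ hE E.edge),
    fun h w hw z hz hwz => ?_⟩
  obtain ⟨E, rfl⟩ := hwz.exists_upEdge
  exact (toRelSheaf_rel_iff E).mpr (h w hw E hz)

lemma costalk_toRelSheaf (ℱ : cs.BruhatSheaf) (y : W) :
    ℱ.toRelSheaf.costalk cs y = ℱ.costalk y := by
  ext a
  refine (isCompatible_toRelSheaf_iff (m := 0)).trans ?_
  refine ⟨fun h => funext fun E => (h E).trans (map_zero _), fun h E => ?_⟩
  exact (congrFun h E).trans (map_zero (ℱ.toEdge E)).symm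

lemma indepGr_edgeGr {y : W} (E : cs.UpEdge y) : IndepGr (ℱ.edgeGr E) :=
  indep_quot _ _ fun _ hv k => cs.proj_mem_labelSMul _ _ hv k

lemma toEdge_eq_zero_iff {y : W} (E : cs.UpEdge y) {b : ℱ.stalk E.target} :
    ℱ.toEdge E b = 0 ↔ ∃ c, b = cs.label E.1 • c :=
  (Submodule.Quotient.mk_eq_zero _).trans (mem_labelSMul E.2.1)

lemma ρ_zero_eq_iff {y : W} (E : cs.UpEdge y) {b : ℱ.stalk E.target} :
    ℱ.ρ y E 0 = ℱ.toEdge E b ↔ ∃ c, b = cs.label E.1 • c := by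
  rw [map_zero, eq_comm, toEdge_eq_zero_iff]

namespace IsBradenMacPherson

variable {x : W} (hℱ : ℱ.IsBradenMacPherson x)
include hℱ

lemma subsingleton_target {y : W} (hy : ¬ cs.BruhatLT y x) (E : cs.UpEdge y) :
    Subsingleton (ℱ.stalk E.target) :=
  hℱ.eq_zero _ fun h => hy (BruhatLT.trans_le E.2.2 h)

lemma ρ_eq_toEdge {y : W} (hy : ¬ cs.BruhatLT y x) (E : cs.UpEdge y) (a : ℱ.stalk y)
    (b : ℱ.stalk E.target) : ℱ.ρ y E a = ℱ.toEdge E b := by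
  have := hℱ.subsingleton_target hy E
  have : Subsingleton (ℱ.edge E) :=
    (Submodule.mkQ_surjective (cs.labelSMul E.1 (ℱ.stalk E.target))).subsingleton
  exact Subsingleton.elim _ _

lemma isDegZero_ρ (y : W) (E : cs.UpEdge y) :
    IsDegZero (ℱ.stalk y).gr (ℱ.edgeGr E) (ℱ.ρ y E) := by
  intro k v hv
  by_cases hy : cs.BruhatLT y x
  · exact (hℱ.cover y hy).isDegZero k v hv E trivial
  · rw [hℱ.ρ_eq_toEdge hy E v 0, map_zero]
    exact zero_mem _

/-- Turns categorical projectivity into being a summand of a finite free module. Compare with an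
explicit free cover of the same image: lifts of its generators to the stalk generate by
essentiality, and the resulting surjection splits by projectivity. -/
lemma isGradedProjective_of_lt [Finite B] {y : W} (hy : cs.BruhatLT y x)
    (hfin : ∀ w, cs.BruhatLT y w → Module.Finite (PolyV B) (ℱ.stalk w)) :
    IsGradedProjective B (ℱ.stalk y).gr := by
  classical
  have hc := hℱ.cover y hy
  obtain ⟨n, d, q, hq⟩ := ℱ.exists_cover hℱ.eq_zero hfin fun w _ => hℱ.isDegZero_ρ w
  have hq1 : ∀ j, Fintype.linearCombination (PolyV B) q (Pi.single j 1) = q j := fun j => by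
    rw [Fintype.linearCombination_apply_single, one_smul]
  have hex : ∀ j, ∃ p ∈ (ℱ.stalk y).gr (d j), ℱ.upRestriction y p = q j := by
    intro j
    have h1 : q j ∈ LinearMap.range (ℱ.upRestriction y) := by
      rw [hc.range_eq, ← hq.range_eq]
      exact ⟨_, hq1 j⟩
    obtain ⟨p, hp⟩ := h1
    refine ⟨_, (ℱ.stalk y).proj_mem (d j) p, ?_⟩
    rw [map_proj_eq (P' := freeMod d) (ℱ.indep_edgesGr y) hc.isDegZero hq.isDegZero
      (hp.trans (hq1 j).symm), (freeMod d).proj_of_mem (single_mem d j), hq1]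
  choose p hp hpq using hex
  have hθ : IsDegZero (freeMod d).gr (ℱ.stalk y).gr (Fintype.linearCombination (PolyV B) p) :=
    linearCombination_mem (d := d) (fun {_ _ _ _} => (ℱ.stalk y).smul_mem) hp
  have hrange : LinearMap.range (Fintype.linearCombination (PolyV B) p) = ⊤ := by
    refine hc.essential _ ?_ ?_
    · rw [Fintype.range_linearCombination]
      refine le_antisymm (Submodule.span_le.mpr fun v hv => hv.1) (Submodule.span_mono ?_)
      rintro _ ⟨j, rfl⟩
      exact ⟨Submodule.subset_span ⟨j, rfl⟩, d j, hp j⟩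
    · rw [Fintype.range_linearCombination, Submodule.map_span, ← hq.range_eq,
        Fintype.range_linearCombination, ← Set.range_comp]
      congr 2
      exact funext hpq
  obtain ⟨g, hg, hgθ⟩ := hc.isProjective (freeMod d) (ℱ.stalk y)
    (Fintype.linearCombination (PolyV B) p) LinearMap.id hθ (LinearMap.range_eq_top.mp hrange)
    fun _ _ h => h
  exact ⟨n, d, g, _, hg, hθ, fun m => LinearMap.congr_fun hgθ m⟩

lemma isGradedProjective [Finite B] (y : W) : IsGradedProjective B (ℱ.stalk y).gr := by
  have key : ∀ n y, cs.length x < cs.length y + n → IsGradedProjective B (ℱ.stalk y).gr := by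
    intro n
    induction n with
    | zero =>
      intro y hy
      have := hℱ.eq_zero y fun h => by
        have := h.length_le
        omega
      exact IsGradedProjective.of_subsingleton
    | succ n ih =>
      intro y hy
      by_cases hyx : cs.BruhatLT y x
      · exact hℱ.isGradedProjective_of_lt hyx fun w hw =>
          (ih w (by have := hw.length_lt; omega)).finite
      by_cases hy : y = x
      · subst hy
        obtain ⟨e, he⟩ := hℱ.top
        refine IsGradedProjective.symGr.of_equiv e.symm 0 fun k a => ?_
        rw [add_zero, he, LinearEquiv.apply_symm_apply]
      · have := hℱ.eq_zero y fun h => hyx ⟨h, hy⟩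
        exact IsGradedProjective.of_subsingleton
  exact key _ y (by omega : cs.length x < cs.length y + (cs.length x + 1))

/-- The stalk maps onto the image of the sections on `{> y}`, and the homogeneous component of a
preimage is again one. -/
lemma flabbyAt (y : W) : ℱ.toRelSheaf.FlabbyAt cs y := by
  intro k m hm hs
  by_cases hy : cs.BruhatLT y x
  · have h1 : ℱ.restrictToEdges y (fun w => m w) ∈ LinearMap.range (ℱ.upRestriction y) := by
      rw [(hℱ.cover y hy).range_eq]
      exact Submodule.mem_map_of_mem (isSection_toRelSheaf_iff.mp hs)
    obtain ⟨a, ha⟩ := h1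
    refine ⟨(ℱ.stalk y).proj k a, (ℱ.stalk y).proj_mem k a,
      isCompatible_toRelSheaf_iff.mpr fun E => ?_⟩
    have h2 : ℱ.ρ y E a = ℱ.toEdge E (m E.target) := congrFun ha E
    rw [map_proj_eq (indepGr_edgeGr E) (hℱ.isDegZero_ρ y E) (ℱ.isDegZero_toEdge E) h2,
      (ℱ.stalk E.target).proj_of_mem (hm E.target)]
  · exact ⟨0, zero_mem _, isCompatible_toRelSheaf_iff.mpr fun E => hℱ.ρ_eq_toEdge hy E _ _⟩

theorem isGood [Finite B] : ℱ.toRelSheaf.IsGood cs x where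
  proj := hℱ.isGradedProjective
  subsingleton w hw := hℱ.eq_zero w fun h => by
    have := h.length_le
    omega
  rel_zero y z h b := by
    obtain ⟨E, rfl⟩ := h.exists_upEdge
    rw [E.target_mul_inv]
    exact (toRelSheaf_rel_iff E).trans (ρ_zero_eq_iff E)
  flabby := hℱ.flabbyAt
  extend y k a ha := by
    classical
    by_cases hy : cs.BruhatLT y x
    · have h1 : ℱ.upRestriction y a ∈ ℱ.boundary y := by
        rw [← (hℱ.cover y hy).range_eq]
        exact ⟨a, rfl⟩
      obtain ⟨m, hm, e⟩ := h1
      let m' : ∀ w, ℱ.stalk w := fun w =>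
        if h : cs.BruhatLT y w then (ℱ.stalk w).proj k (m ⟨w, h⟩) else 0
      have hm' : ∀ w (h : cs.BruhatLT y w), m' w = (ℱ.stalk w).proj k (m ⟨w, h⟩) :=
        fun w h => dif_pos h
      have hmk : ∀ w, m' w ∈ (ℱ.stalk w).gr k := by
        intro w
        by_cases h : cs.BruhatLT y w
        · rw [hm' w h]
          exact (ℱ.stalk w).proj_mem k _
        · simp only [m', dif_neg h, zero_mem]
      refine ⟨m', hmk, isSection_toRelSheaf_iff.mpr ?_,
        isCompatible_toRelSheaf_iff.mpr fun E => ?_⟩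
      · have := ℱ.proj_mem_sections (fun w _ => hℱ.isDegZero_ρ w) hm k
        convert this using 2 with w
        exact hm' w.1 w.2
      · have h1 : m' E.target = (ℱ.stalk E.target).proj k (m ⟨E.target, E.2.2⟩) := hm' _ E.2.2
        rw [h1]
        have h2 : ℱ.ρ y E a = ℱ.toEdge E (m ⟨E.target, E.2.2⟩) := (congrFun e E).symm
        rw [← map_proj_eq (indepGr_edgeGr E) (hℱ.isDegZero_ρ y E) (ℱ.isDegZero_toEdge E) h2,
          (ℱ.stalk y).proj_of_mem ha]
    · exact ⟨0, fun _ => zero_mem _, fun y _ z _ _ => zero_mem _,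
        isCompatible_toRelSheaf_iff.mpr fun E => hℱ.ρ_eq_toEdge hy E _ _⟩

/-- Modulo the costalk, the stalk is the module it covers. A graded submodule that generates
together with the costalk still surjects onto that module, against essentiality unless it is
everything. -/
lemma eq_top_of_sup_costalk {w : W} (hwx : w ≠ x) {Q : Submodule (PolyV B) (ℱ.stalk w)}
    (hQ : IsHomogeneousSubmodule (ℱ.stalk w).gr Q) (hsup : Q ⊔ ℱ.costalk w = ⊤) : Q = ⊤ := by
  by_cases hw : cs.BruhatLT w x
  · refine (hℱ.cover w hw).essential Q hQ ?_
    have h1 := congrArg (Submodule.map (ℱ.upRestriction w)) hsup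
    rw [Submodule.map_sup, Submodule.map_top, (hℱ.cover w hw).range_eq] at h1
    have h2 : (ℱ.costalk w).map (ℱ.upRestriction w) = ⊥ :=
      LinearMap.le_ker_iff_map.mp le_rfl
    rwa [h2, sup_bot_eq] at h1
  · have := hℱ.eq_zero w fun h => hw ⟨h, hwx⟩
    exact Subsingleton.elim _ _

lemma isMinimal : RelSheaf.IsMinimal cs ℱ.toRelSheaf x := by
  intro w hwx Q hQ hsup
  rw [costalk_toRelSheaf] at hsup
  exact hℱ.eq_top_of_sup_costalk hwx hQ hsup

/-- The costalks of the Braden–MacPherson sheaf are graded projective. -/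
theorem isGradedProjective_costalk [Finite B] (y : W) :
    IsGradedProjective B (subGr (ℱ.stalk y).gr (ℱ.costalk y)) := by
  obtain ⟨H, hH, hK, e, he⟩ := RelSheaf.exists_bottSamelson cs x
  obtain ⟨e', he'⟩ := hℱ.top
  rw [← costalk_toRelSheaf]
  -- Both top stalks are `S` with the same grading, so `ℬ(x)` can be compared with the Bott–Samelson
  -- sheaf.
  refine RelSheaf.costalk_of_isMinimal hℱ.isGood hH hℱ.isMinimal (e'.trans e.symm)
    (fun k v => ?_) (hK y)
  rw [he]
  change _ ↔ e (e.symm (e' v)) ∈ _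
  rw [LinearEquiv.apply_symm_apply]
  exact he' k v

end IsBradenMacPherson

end BruhatSheaf

end CoxeterSystem

namespace CoxeterSystem

universe u

variable {B : Type u}

/-! ### Evaluation at a point of the line -/

section Line

variable (l : Module.Dual ℝ (B →₀ ℝ))

/-- The value of a polynomial function at the point `l`. -/
noncomputable def evalAt : PolyV B →+* ℝ :=
  MvPolynomial.eval fun i => l (Finsupp.single i 1)

lemma evalAt_linearForm (v : B →₀ ℝ) : evalAt l (linearForm B v) = l v := by
  induction v using Finsupp.induction_linear with
  | zero => simp
  | add v w hv hw => rw [map_add, map_add, map_add, hv, hw]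
  | single i c =>
    rw [linearForm, Finsupp.linearCombination_single, MvPolynomial.smul_eq_C_mul, map_mul, evalAt,
      MvPolynomial.eval_C, MvPolynomial.eval_X, ← smul_eq_mul, ← map_smul, Finsupp.smul_single,
      smul_eq_mul, mul_one]

lemma exists_eq_two_mul_of_mem_symGr {k : ℤ} {a : PolyV B} (ha : a ∈ symGr B k) (h0 : a ≠ 0) :
    ∃ j : ℕ, k = 2 * j := by
  obtain ⟨s, hs⟩ := MvPolynomial.ne_zero_iff.mp h0
  have h1 : Finsupp.weight (fun _ : B => (2 : ℤ)) s = k := ha hs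
  rw [weight_eq] at h1
  exact ⟨_, h1.symm⟩

/-- The monomial `r T ^ b`. -/
noncomputable def lineMonomial (b : ℕ) : ℝ →+ LineAlg l :=
  (Polynomial.monomial b : ℝ →ₗ[ℝ] Polynomial ℝ).toAddMonoidHom

variable {l}

lemma lineMonomial_mul (b b' : ℕ) (r r' : ℝ) :
    lineMonomial l b r * lineMonomial l b' r' = lineMonomial l (b + b') (r * r') :=
  Polynomial.monomial_mul_monomial b b' r r'

lemma lineT_pow_mul (a b : ℕ) (r : ℝ) :
    lineT l ^ a * lineMonomial l b r = lineMonomial l (a + b) r :=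
  (Polynomial.X_pow_mul_monomial a b r).trans (by rw [add_comm]; rfl)

lemma lineMonomial_mem (b : ℕ) (r : ℝ) : lineMonomial l b r ∈ lineGr l (2 * b) := by
  have h := Submodule.smul_mem (Submodule.span ℝ {p : Polynomial ℝ | ∃ j : ℕ,
    (2 * j : ℤ) = 2 * b ∧ p = Polynomial.X ^ j}) r (Submodule.subset_span ⟨b, rfl, rfl⟩)
  rw [← Polynomial.C_mul', Polynomial.C_mul_X_pow_eq_monomial] at h
  exact h

lemma exists_eq_lineMonomial {k : ℤ} {p : LineAlg l} (hp : p ∈ lineGr l k) :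
    p = 0 ∨ ∃ (b : ℕ) (r : ℝ), k = 2 * b ∧ p = lineMonomial l b r := by
  have key : ∀ p : Polynomial ℝ, p ∈ Submodule.span ℝ {p : Polynomial ℝ | ∃ j : ℕ,
      (2 * j : ℤ) = k ∧ p = Polynomial.X ^ j} →
      p = 0 ∨ ∃ (b : ℕ) (r : ℝ), k = 2 * b ∧ p = Polynomial.monomial b r := by
    intro p hp
    by_cases hk : ∃ b : ℕ, k = 2 * b
    · obtain ⟨b, rfl⟩ := hk
      have h1 : {p : Polynomial ℝ | ∃ j : ℕ, (2 * j : ℤ) = 2 * b ∧ p = Polynomial.X ^ j} =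
          {Polynomial.X ^ b} := by
        ext q
        refine ⟨?_, fun h => ⟨b, rfl, h⟩⟩
        rintro ⟨j, hj, rfl⟩
        obtain rfl : j = b := by omega
        rfl
      rw [h1] at hp
      obtain ⟨r, rfl⟩ := Submodule.mem_span_singleton.mp hp
      refine Or.inr ⟨b, r, rfl, ?_⟩
      rw [← Polynomial.C_mul', Polynomial.C_mul_X_pow_eq_monomial]
    · have h1 : {p : Polynomial ℝ | ∃ j : ℕ, (2 * j : ℤ) = k ∧ p = Polynomial.X ^ j} = ∅ := by
        refine Set.eq_empty_of_forall_notMem ?_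
        rintro _ ⟨j, hj, _⟩
        exact hk ⟨j, hj.symm⟩
      rw [h1, Submodule.span_empty] at hp
      exact Or.inl hp
  exact key p hp

/-- Elements of degree `2 b` are homogeneous polynomials of polynomial degree `b`, so on the line
only their value at `l` is left. -/
lemma toLine_eq_of_mem {a : PolyV B} {b : ℕ} (ha : a ∈ symGr B (2 * b)) :
    toLine l a = lineMonomial l b (evalAt l a) := by
  have h1 : ∀ s ∈ a.support, toLine l (MvPolynomial.monomial s (a.coeff s)) =
      lineMonomial l b (evalAt l (MvPolynomial.monomial s (a.coeff s))) := by
    intro s hs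
    have h2 : Finsupp.weight (fun _ : B => (2 : ℤ)) s = 2 * b :=
      ha (MvPolynomial.mem_support_iff.mp hs)
    rw [weight_eq] at h2
    obtain rfl : s.degree = b := by omega
    change MvPolynomial.aeval _ _ = Polynomial.monomial _ _
    rw [MvPolynomial.aeval_monomial, evalAt, MvPolynomial.eval_monomial,
      ← Polynomial.C_mul_X_pow_eq_monomial, map_mul, mul_assoc]
    congr 1
    simp only [Finsupp.prod, mul_pow, Finset.prod_mul_distrib, map_prod, map_pow,
      Finset.prod_pow_eq_pow_sum]
    rfl
  conv_lhs => rw [a.as_sum, map_sum]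
  conv_rhs => rw [a.as_sum, map_sum, map_sum]
  exact Finset.sum_congr rfl h1

/-- Multiplication by `T ^ a` is injective in low degrees. -/
lemma IsLefschetzSum.eq_zero {P : Type*} [AddCommGroup P] [Module (PolyV B) P]
    {𝒢 : ℤ → AddSubgroup P} {δ g : ℤ} (h : IsLefschetzSum l 𝒢 δ) {u : OnLine l P}
    (hu : u ∈ onLineGr l 𝒢 g) {a : ℕ} (ha : a + δ + g ≤ 0) (h0 : lineT l ^ a • u = 0) : u = 0 := by
  obtain ⟨ι, n, e, he⟩ := h
  have h1 := (he g u).mp hu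
  have h2 := congrArg e h0
  rw [map_smul, map_zero] at h2
  rw [← map_eq_zero_iff e e.injective]
  refine DFinsupp.ext fun i => ?_
  have h3 : e u i ∈ truncatedGr l (n i) (δ + n i) g := (AddSubgroup.mem_iInf.mp h1) i
  have h4 : lineT l ^ a • e u i = 0 := congrArg (fun f => f i) h2
  change e u i = 0
  generalize e u i = z at h3 h4
  obtain ⟨p, hp, rfl⟩ := h3
  obtain rfl | ⟨b, r, hb, rfl⟩ := exists_eq_lineMonomial hp
  · exact map_zero _
  · have h5 : Ideal.Quotient.mk (Ideal.span {lineT l ^ (n i + 1)})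
        (lineT l ^ a * lineMonomial l b r) = 0 := h4
    rw [Ideal.Quotient.eq_zero_iff_mem, Ideal.mem_span_singleton, lineT_pow_mul] at h5
    have h6 : (Polynomial.X : Polynomial ℝ) ^ (n i + 1) ∣ Polynomial.monomial (a + b) r := h5
    -- The component is `r T^b` with `2 b = δ + n_i + g`. From `a + δ + g ≤ 0 ≤ b` follows `a + b ≤
    -- n_i`, so `T^(a+b)` is non-zero in the quotient and `r` must vanish.
    have h7 := (Polynomial.X_pow_dvd_iff.mp h6) (a + b) (by omega)
    rw [Polynomial.coeff_monomial_same] at h7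
    rw [h7, map_zero]
    exact map_zero _

end Line

end CoxeterSystem

/-! ### Relations between generators under the Lefschetz condition -/

namespace CoxeterSystem

universe u

variable {B : Type u} {l : Module.Dual ℝ (B →₀ ℝ)}

lemma constantCoeff_eq_zero_of_mem_symGr {k : ℤ} {a : PolyV B} (ha : a ∈ symGr B k) (hk : k ≠ 0) :
    MvPolynomial.constantCoeff a = 0 := by
  by_contra h
  have h1 : Finsupp.weight (fun _ : B => (2 : ℤ)) 0 = k := ha h
  rw [map_zero] at h1
  exact hk h1.symm

lemma exists_eq_C_of_mem_symGr_zero {a : PolyV B} (ha : a ∈ symGr B 0) :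
    a = MvPolynomial.C (MvPolynomial.constantCoeff a) := by
  classical
  ext s
  rw [MvPolynomial.coeff_C]
  split_ifs with hs
  · rw [← hs]
    rfl
  · by_contra h
    have h1 : Finsupp.weight (fun _ : B => (2 : ℤ)) s = 0 := ha h
    rw [weight_eq] at h1
    exact hs ((Finsupp.degree_eq_zero_iff s).mp (by omega)).symm

/-- The line passes through the origin of `V*`. This makes evaluation at `T = 0` compatible with
reduction modulo the maximal ideal of `S`. -/
lemma coeff_zero_toLine (a : PolyV B) :
    Polynomial.coeff (toLine l a : Polynomial ℝ) 0 = MvPolynomial.constantCoeff a := by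
  have h : (Polynomial.constantCoeff.comp (toLine l : PolyV B →+* Polynomial ℝ)) =
      MvPolynomial.constantCoeff := by
    refine MvPolynomial.ringHom_ext (fun r => ?_) fun i => ?_
    · change Polynomial.coeff (MvPolynomial.aeval _ (MvPolynomial.C r)) 0 = _
      rw [MvPolynomial.algHom_C, MvPolynomial.constantCoeff_C]
      exact Polynomial.coeff_C_zero
    · change Polynomial.coeff (MvPolynomial.aeval _ (MvPolynomial.X i)) 0 = _
      rw [MvPolynomial.aeval_X, MvPolynomial.constantCoeff_X]
      simp
  exact RingHom.congr_fun h a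

/-- The map `p ⊗ v ↦ p(0) χ(v)` on the restriction to the line. -/
noncomputable def onLineEval (l : Module.Dual ℝ (B →₀ ℝ)) {P : Type*} [AddCommGroup P]
    [Module (PolyV B) P] (χ : P →+ ℝ)
    (hχ : ∀ (a : PolyV B) v, χ (a • v) = MvPolynomial.constantCoeff a * χ v) : OnLine l P →+ ℝ :=
  TensorProduct.liftAddHom
    { toFun := fun p => (AddMonoidHom.mulLeft (Polynomial.coeff (p : Polynomial ℝ) 0)).comp χ
      map_zero' := by
        ext v
        exact zero_mul _
      map_add' := fun p q => by
        ext v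
        exact (congrArg (· * χ v) (Polynomial.coeff_add p q 0)).trans (add_mul _ _ _) }
    fun a p v => by
      change Polynomial.coeff (toLine l a * p : Polynomial ℝ) 0 * χ v =
        Polynomial.coeff (p : Polynomial ℝ) 0 * χ (a • v)
      have h1 : Polynomial.coeff (toLine l a * p : Polynomial ℝ) 0 =
          MvPolynomial.constantCoeff a * Polynomial.coeff (p : Polynomial ℝ) 0 :=
        (Polynomial.mul_coeff_zero (toLine l a : Polynomial ℝ) p).trans
          (congrArg (· * _) (coeff_zero_toLine a))
      rw [h1, hχ]
      ring

lemma onLineEval_tmul {P : Type*} [AddCommGroup P] [Module (PolyV B) P] {χ : P →+ ℝ}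
    (hχ : ∀ (a : PolyV B) v, χ (a • v) = MvPolynomial.constantCoeff a * χ v) (b : ℕ) (r : ℝ)
    (v : P) :
    onLineEval l χ hχ (lineMonomial l b r ⊗ₜ v) = if b = 0 then r * χ v else 0 := by
  change Polynomial.coeff (Polynomial.monomial b r) 0 * χ v = _
  rw [Polynomial.coeff_monomial]
  split_ifs <;> simp

/-- A matrix over `S` is injective if its value at the point `l` is. -/
lemma eq_zero_of_evalAt {ι κ : Type*} [Fintype ι] [Fintype κ] (A : Matrix ι κ (PolyV B))
    (hA : ∀ γ : κ → ℝ, (∀ i, ∑ j, evalAt l (A i j) * γ j = 0) → γ = 0) {c : κ → PolyV B}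
    (hc : ∀ i, ∑ j, A i j * c j = 0) : c = 0 := by
  classical
  obtain ⟨g, hg⟩ := (Matrix.mulVecLin (A.map (evalAt l))).exists_leftInverse_of_injective (by
    rw [LinearMap.ker_eq_bot']
    intro γ hγ
    exact hA γ fun i => congrFun hγ i)
  -- A real left inverse of `A(l)`, viewed as a constant matrix. The determinant of `L A` takes the
  -- value `1` at `l`, hence is non-zero, and `S` is a domain.
  let L := LinearMap.toMatrix' g
  have h1 : L * A.map (evalAt l) = 1 := by
    apply Matrix.toLin'.injective
    rw [Matrix.toLin'_mul, Matrix.toLin'_toMatrix', Matrix.toLin'_one]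
    exact hg
  have h2 : (L.map (MvPolynomial.C : ℝ →+* PolyV B) * A).map (evalAt l) = 1 := by
    rw [Matrix.map_mul, ← h1]
    congr 1
    ext i j
    exact MvPolynomial.eval_C _
  have h3 : (L.map (MvPolynomial.C : ℝ →+* PolyV B) * A).det ≠ 0 := by
    intro h
    have h4 := congrArg (evalAt l) h
    rw [RingHom.map_det, RingHom.mapMatrix_apply, h2, Matrix.det_one, map_zero] at h4
    exact one_ne_zero h4
  refine Matrix.eq_zero_of_mulVec_eq_zero h3 ?_
  rw [← Matrix.mulVec_mulVec]
  have h5 : A.mulVec c = 0 := funext hc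
  rw [h5, Matrix.mulVec_zero]

section Lefschetz

variable {P : Type*} [AddCommGroup P] [Module (PolyV B) P] {𝒢 : ℤ → AddSubgroup P} {n r : ℕ}
  {d : Fin n → ℤ} {f : Fin r → ℤ} {A : Fin n → Fin r → PolyV B} {q : Fin n → P} {N δ m : ℤ}

/-- The relations between the generators of a module that satisfies the Lefschetz condition, at
the point `l`: the case of degrees of fixed parity. -/
lemma sum_evalAt_eq_zero_of_parity (hA : ∀ i j, A i j ∈ symGr B (f j - d i))
    (hq : ∀ i, q i ∈ 𝒢 (d i)) (hAq : ∀ j, ∑ i, A i j • q i = 0)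
    (hχ : ∀ i, ∃ χ : P →+ ℝ, (∀ (a : PolyV B) v, χ (a • v) = MvPolynomial.constantCoeff a * χ v) ∧
      ∀ i', χ (q i') = if i' = i then 1 else 0)
    (hsum : IsLefschetzSum l 𝒢 δ) (hδ : δ ≤ 1 - N) (hm : 1 ≤ m) {γ : Fin r → ℝ} {p : ℤ}
    (hγ : ∀ j, γ j ≠ 0 → f j ≤ N + m - 1 ∧ f j % 2 = p)
    (h0 : ∀ i, N - m < d i → ∑ j, γ j * evalAt l (A i j) = 0) (i : Fin n) :
    ∑ j, γ j * evalAt l (A i j) = 0 := by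
  classical
  set κ : Fin n → ℝ := fun i => ∑ j, γ j * evalAt l (A i j) with hκ
  change κ i = 0
  by_contra hi
  have hparity : ∀ i, κ i ≠ 0 → d i % 2 = p := by
    intro i hi
    obtain ⟨j, _, hj⟩ := Finset.exists_ne_zero_of_sum_ne_zero hi
    have hA0 : A i j ≠ 0 := by
      rintro h
      rw [h, map_zero, mul_zero] at hj
      exact hj rfl
    obtain ⟨b, hb⟩ := exists_eq_two_mul_of_mem_symGr (hA i j) hA0
    have := (hγ j (left_ne_zero_of_mul hj)).2
    omega
  -- The top degree among the generators that occur in `κ`; the class below is homogenised to this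
  -- degree.
  obtain ⟨i₀, hi₀, hmax⟩ := Finset.exists_max_image (Finset.univ.filter fun i => κ i ≠ 0) d
    ⟨i, Finset.mem_filter.mpr ⟨Finset.mem_univ _, hi⟩⟩
  have hi₀ : κ i₀ ≠ 0 := (Finset.mem_filter.mp hi₀).2
  have hmax : ∀ i, κ i ≠ 0 → d i ≤ d i₀ := fun i hi =>
    hmax i (Finset.mem_filter.mpr ⟨Finset.mem_univ _, hi⟩)
  have hD : d i₀ ≤ N - m := by
    by_contra h
    exact hi₀ (h0 i₀ (not_le.mp h))
  have hp₀ := hparity i₀ hi₀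
  -- The largest power of `T` that the bound `δ ≤ 1 - N` makes injective in degree `d i₀`.
  obtain ⟨a, ha⟩ : ∃ a : ℕ, (a : ℤ) = N - 1 - d i₀ := ⟨(N - 1 - d i₀).toNat, by omega⟩
  -- The truncations in `ε` and `β` are harmless where `κ` and `γ` are non-zero. For `β` this needs
  -- `f j ≤ 2 N - 2 - d i₀`. The only doubtful case is `d i₀ = N - m` with `f j = N + m - 1`, which
  -- equal parity excludes.
  let ε : Fin n → ℕ := fun i => ((d i₀ - d i) / 2).toNat
  let β : Fin r → ℕ := fun j => ((d i₀ + 2 * a - f j) / 2).toNat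
  have hε : ∀ i, κ i ≠ 0 → 2 * (ε i : ℤ) = d i₀ - d i := by
    intro i hi
    have h1 := hparity i hi
    have h2 := hmax i hi
    simp only [ε]
    omega
  have hβ : ∀ j, γ j ≠ 0 → 2 * (β j : ℤ) = d i₀ + 2 * a - f j := by
    intro j hj
    have h1 := hγ j hj
    simp only [β]
    omega
  let ū : OnLine l P := ∑ i, lineMonomial l (ε i) (κ i) ⊗ₜ q i
  have hū : ū ∈ onLineGr l 𝒢 (d i₀) := by
    refine sum_mem fun i _ => ?_
    by_cases hi : κ i = 0
    · rw [hi, map_zero, TensorProduct.zero_tmul]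
      exact zero_mem _
    · exact AddSubgroup.subset_closure ⟨2 * ε i, d i, by rw [hε i hi]; ring, _,
        lineMonomial_mem _ _, _, hq i, rfl⟩
  -- Homogenised form of `κ = A(l) γ`: every non-zero term of row `i` has the same power of `T`, by
  -- degree reasons.
  have hrow : ∀ i, ∑ j, A i j • lineMonomial l (β j) (γ j) = lineMonomial l (a + ε i) (κ i) := by
    intro i
    let b : ℕ := ((d i₀ + 2 * a - d i) / 2).toNat
    have h1 : ∀ j, A i j • lineMonomial l (β j) (γ j) =
        lineMonomial l b (γ j * evalAt l (A i j)) := by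
      intro j
      by_cases hj : γ j = 0
      · rw [hj, zero_mul, map_zero, map_zero, smul_zero]
      by_cases hAij : A i j = 0
      · rw [hAij, map_zero, mul_zero, map_zero, zero_smul]
      obtain ⟨s, hs⟩ := exists_eq_two_mul_of_mem_symGr (hA i j) hAij
      have h2 := hA i j
      rw [hs] at h2
      have h3 := hβ j hj
      have h4 : s + β j = b := by
        simp only [b]
        omega
      rw [Algebra.smul_def]
      change toLine l (A i j) * _ = _
      rw [toLine_eq_of_mem h2, lineMonomial_mul, mul_comm (evalAt l _), h4]
    rw [Finset.sum_congr rfl fun j _ => h1 j, ← map_sum]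
    by_cases hi : κ i = 0
    · rw [hi, map_zero]
      exact (congrArg _ hi).trans (map_zero _)
    · have h2 := hε i hi
      have h3 : b = a + ε i := by
        simp only [b]
        omega
      rw [h3]
  -- Up to the factor `T^a`, the class is the combination with coefficients `γ j T^(β j)` of the
  -- relations given by the columns of `A`.
  have hTū : lineT l ^ a • ū = 0 := by
    have h1 : ∑ j, lineMonomial l (β j) (γ j) ⊗ₜ[PolyV B] (∑ i, A i j • q i) = 0 :=
      Finset.sum_eq_zero fun j _ => by rw [hAq j, TensorProduct.tmul_zero]
    rw [← h1]
    simp only [ū, Finset.smul_sum, TensorProduct.smul_tmul', smul_eq_mul, lineT_pow_mul, ← hrow,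
      TensorProduct.sum_tmul, TensorProduct.tmul_sum, TensorProduct.tmul_smul]
    exact Finset.sum_comm
  have hū0 := hsum.eq_zero hū (a := a) (by omega) hTū
  -- Reduce modulo the maximal ideal and `T`. Only the generator `q i₀` is seen by `χ`, and its
  -- coefficient is the constant `κ i₀`.
  obtain ⟨χ, hχ, hχq⟩ := hχ i₀
  have h1 := congrArg (onLineEval l χ hχ) hū0
  rw [map_zero, map_sum, Finset.sum_eq_single i₀] at h1
  · rw [onLineEval_tmul, if_pos (by simp [ε]), hχq, if_pos rfl, mul_one] at h1
    exact hi₀ h1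
  · intro i _ hne
    rw [onLineEval_tmul, hχq, if_neg hne, mul_zero, ite_self]
  · exact fun h => absurd (Finset.mem_univ _) h

/-- The relations between the generators of a module that satisfies the Lefschetz condition, at
the point `l`. -/
lemma sum_evalAt_eq_zero (hA : ∀ i j, A i j ∈ symGr B (f j - d i))
    (hq : ∀ i, q i ∈ 𝒢 (d i)) (hAq : ∀ j, ∑ i, A i j • q i = 0)
    (hχ : ∀ i, ∃ χ : P →+ ℝ, (∀ (a : PolyV B) v, χ (a • v) = MvPolynomial.constantCoeff a * χ v) ∧
      ∀ i', χ (q i') = if i' = i then 1 else 0)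
    (hsum : IsLefschetzSum l 𝒢 δ) (hδ : δ ≤ 1 - N) (hm : 1 ≤ m) {γ : Fin r → ℝ}
    (hγ : ∀ j, γ j ≠ 0 → f j ≤ N + m - 1)
    (h0 : ∀ i, N - m < d i → ∑ j, γ j * evalAt l (A i j) = 0) (i : Fin n) :
    ∑ j, γ j * evalAt l (A i j) = 0 := by
  -- A non-zero entry `A i j` has even degree `f j - d i`. So the even and the odd part of `γ`
  -- contribute to disjoint sets of rows.
  let γ' : ℤ → Fin r → ℝ := fun p j => if f j % 2 = p then γ j else 0
  have hsplit : ∀ i, ∑ j, γ j * evalAt l (A i j) =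
      ∑ j, γ' 0 j * evalAt l (A i j) + ∑ j, γ' 1 j * evalAt l (A i j) := by
    intro i
    rw [← Finset.sum_add_distrib]
    refine Finset.sum_congr rfl fun j _ => ?_
    rcases Int.emod_two_eq_zero_or_one (f j) with h | h <;> simp [γ', h]
  have hzero : ∀ p i, d i % 2 ≠ p → ∑ j, γ' p j * evalAt l (A i j) = 0 := by
    intro p i hi
    refine Finset.sum_eq_zero fun j _ => ?_
    by_cases hA0 : A i j = 0
    · rw [hA0, map_zero, mul_zero]
    obtain ⟨b, hb⟩ := exists_eq_two_mul_of_mem_symGr (hA i j) hA0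
    have h1 : f j % 2 ≠ p := by omega
    simp only [γ', if_neg h1, zero_mul]
  have key : ∀ p, p = 0 ∨ p = 1 → ∀ i, ∑ j, γ' p j * evalAt l (A i j) = 0 := by
    intro p hp
    refine sum_evalAt_eq_zero_of_parity (p := p) hA hq hAq hχ hsum hδ hm (fun j hj => ?_)
      fun i hi => ?_
    · have h1 : f j % 2 = p := by
        by_contra h
        exact hj (if_neg h)
      refine ⟨hγ j ?_, h1⟩
      simpa only [γ', if_pos h1] using hj
    · by_cases hip : d i % 2 = p
      · have h1 := h0 i hi
        rw [hsplit] at h1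
        rcases hp with rfl | rfl
        · rwa [hzero 1 i (by omega), add_zero] at h1
        · rwa [hzero 0 i (by omega), zero_add] at h1
      · exact hzero p i hip
  rw [hsplit, key 0 (Or.inl rfl), key 1 (Or.inr rfl), add_zero]

end Lefschetz

end CoxeterSystem

/-! ### Kernels of projective covers and the degree bound -/

namespace CoxeterSystem

universe u v

section Cover

variable {B : Type u} {l : Module.Dual ℝ (B →₀ ℝ)}

/-- A coordinate of an element of degree `j ≤ k` at a generator of degree above `k` has negative
degree, and `S` lives in non-negative degrees. -/
lemma coord_eq_zero_of_mem_generatedLE {n : ℕ} {d : Fin n → ℤ} {P : Type*} [AddCommGroup P]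
    [Module (PolyV B) P] {𝒢 : ℤ → AddSubgroup P} {e : (Fin n → PolyV B) ≃ₗ[PolyV B] P}
    (he : IsGradedIso (freeMod d).gr 𝒢 e) {k : ℤ} {v : P} (hv : v ∈ generatedLE (PolyV B) 𝒢 k)
    {i : Fin n} (hi : k < d i) : e.symm v i = 0 := by
  have h : generatedLE (PolyV B) 𝒢 k ≤
      LinearMap.ker (LinearMap.proj (φ := fun _ => PolyV B) i ∘ₗ e.symm.toLinearMap) := by
    rw [generatedLE, Submodule.span_le]
    rintro v ⟨j, hj, hv⟩
    rw [← e.apply_symm_apply v, ← he] at hv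
    exact symGr_neg (by omega) (mem_freeMod_gr.mp hv i)
  exact h hv

variable {P : GrSMod B} {N : Type*} [AddCommGroup N] [Module (PolyV B) N] {𝒩 : ℤ → AddSubgroup N}
  {Q : Submodule (PolyV B) N} {π : P →ₗ[PolyV B] N} (hπ : IsProjectiveCover P 𝒩 Q π)
  (hK : IsGradedProjective B (subGr P.gr (LinearMap.ker π)))
  {n : ℕ} {d : Fin n → ℤ} {e : (Fin n → PolyV B) ≃ₗ[PolyV B] P}
  (he : IsGradedIso (freeMod d).gr P.gr e)

include hπ hK he

/-- The kernel of a projective cover is contained in the maximal ideal times the module. -/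
lemma constantCoeff_coord_eq_zero {v : P} (hv : v ∈ LinearMap.ker π) (i : Fin n) :
    MvPolynomial.constantCoeff (e.symm v i) = 0 := by
  classical
  let I : Submodule (PolyV B) (LinearMap.ker π) :=
    Submodule.comap
      (LinearMap.proj (φ := fun _ => PolyV B) i ∘ₗ e.symm.toLinearMap ∘ₗ Submodule.subtype _)
      (RingHom.ker (MvPolynomial.constantCoeff (σ := B) (R := ℝ)))
  have key := hK.mem_of_homogeneous I (fun k u hu => ?_) ⟨v, hv⟩
  · exact key
  have hu' : e.symm u.1 ∈ (freeMod d).gr k := by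
    rw [he, e.apply_symm_apply]
    exact hu
  have h1 := mem_freeMod_gr.mp hu'
  change MvPolynomial.constantCoeff (e.symm u.1 i) = 0
  by_cases hki : k = d i
  swap
  · exact constantCoeff_eq_zero_of_mem_symGr (h1 i) (by omega)
  by_contra hc
  set c := MvPolynomial.constantCoeff (e.symm u.1 i) with hcdef
  have h2 : e.symm u.1 i = MvPolynomial.C c := exists_eq_C_of_mem_symGr_zero (by
    have := h1 i
    rwa [hki, sub_self] at this)
  -- A homogeneous kernel element with a non-zero constant coordinate at `i` could replace the
  -- `i`-th basis vector. The other basis vectors would then already generate modulo the kernel,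
  -- contradicting essentiality.
  let T : Submodule (PolyV B) P := Submodule.span (PolyV B)
    ((fun j => e (Pi.single j 1)) '' {j | j ≠ i})
  have hT : T ≤ LinearMap.ker (LinearMap.proj (φ := fun _ => PolyV B) i ∘ₗ e.symm.toLinearMap) := by
    rw [Submodule.span_le]
    rintro _ ⟨j, hj, rfl⟩
    change e.symm (e _) i = 0
    rw [e.symm_apply_apply, Pi.single_eq_of_ne (Ne.symm hj)]
  have hTu : T ⊔ LinearMap.ker π = ⊤ := by
    refine eq_top_iff.mpr fun a _ => ?_
    have h3 : ∀ b : Fin n → PolyV B, b i = 0 → e b ∈ T := by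
      intro b hb
      rw [pi_eq_sum_univ' b, map_sum]
      refine sum_mem fun j _ => ?_
      by_cases hj : j = i
      · rw [hj, hb, zero_smul, map_zero]
        exact zero_mem _
      · rw [map_smul]
        refine T.smul_mem _ (Submodule.subset_span ⟨j, hj, ?_⟩)
        congr 1
    have h4 : a = e (e.symm a - (e.symm a i * MvPolynomial.C c⁻¹) • e.symm u.1) +
        (e.symm a i * MvPolynomial.C c⁻¹) • u.1 := by
      rw [map_sub, map_smul, e.apply_symm_apply, e.apply_symm_apply, sub_add_cancel]
    rw [h4]
    refine Submodule.add_mem_sup (h3 _ ?_) (Submodule.smul_mem _ _ u.2)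
    rw [Pi.sub_apply, Pi.smul_apply, h2, smul_eq_mul, mul_assoc, ← map_mul, inv_mul_cancel₀ hc,
      map_one, mul_one, sub_self]
  have hTtop := hπ.essential T (by
    refine le_antisymm (Submodule.span_le.mpr fun v hv => hv.1) (Submodule.span_mono ?_)
    rintro _ ⟨j, hj, rfl⟩
    exact ⟨Submodule.subset_span ⟨j, hj, rfl⟩, d j, (he _ _).mp (single_mem d j)⟩) (by
    have h3 := congrArg (Submodule.map π) hTu
    have h4 : (LinearMap.ker π).map π = ⊥ := LinearMap.le_ker_iff_map.mp le_rfl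
    rwa [Submodule.map_sup, h4, sup_bot_eq, Submodule.map_top, hπ.range_eq] at h3)
  have h5 := hT (hTtop ▸ Submodule.mem_top : e (Pi.single i 1) ∈ T)
  change e.symm (e _) i = 0 at h5
  rw [e.symm_apply_apply, Pi.single_eq_same] at h5
  exact one_ne_zero h5

/-- The coordinate functions modulo the maximal ideal descend along a projective cover. -/
lemma exists_coord (i : Fin n) : ∃ χ : Q →+ ℝ,
    (∀ (a : PolyV B) v, χ (a • v) = MvPolynomial.constantCoeff a * χ v) ∧
      ∀ v (hv : π v ∈ Q), χ ⟨π v, hv⟩ = MvPolynomial.constantCoeff (e.symm v i) := by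
  have hπQ : ∀ v, π v ∈ Q := fun v => hπ.range_eq ▸ LinearMap.mem_range_self π v
  let π' : P →ₗ[PolyV B] Q := π.codRestrict Q hπQ
  have hsurj : Function.Surjective π' := by
    rintro ⟨v, hv⟩
    rw [← hπ.range_eq] at hv
    obtain ⟨w, rfl⟩ := hv
    exact ⟨w, rfl⟩
  let θ : P →+ ℝ := (MvPolynomial.constantCoeff (σ := B) (R := ℝ)).toAddMonoidHom.comp
    (LinearMap.proj (φ := fun _ => PolyV B) i ∘ₗ e.symm.toLinearMap).toAddMonoidHom
  -- Since the kernel lies in the maximal ideal times `P`, the constant term of the `i`-th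
  -- coordinate factors through `Q`.
  have hθ : π'.toAddMonoidHom.ker ≤ θ.ker := fun v hv =>
    constantCoeff_coord_eq_zero hπ hK he (congrArg Subtype.val hv : π v = 0) i
  have hs := Function.rightInverse_surjInv hsurj
  let χ : Q →+ ℝ := π'.toAddMonoidHom.liftOfRightInverse _ hs ⟨θ, hθ⟩
  have hχ : ∀ v, χ (π' v) = θ v :=
    fun v => π'.toAddMonoidHom.liftOfRightInverse_comp_apply _ hs ⟨θ, hθ⟩ v
  refine ⟨χ, fun a v => ?_, fun v hv => hχ v⟩
  obtain ⟨v, rfl⟩ := hsurj v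
  rw [← map_smul, hχ, hχ]
  change MvPolynomial.constantCoeff (e.symm (a • v) i) = _ * MvPolynomial.constantCoeff (e.symm v i)
  rw [map_smul, Pi.smul_apply, smul_eq_mul, map_mul]

omit hπ hK he in
/-- The Lefschetz condition on a graded module restricts the degrees of the generators of its
projective cover and of the kernel of the latter. -/
theorem generatedLE_inf_eq_bot (hπ : IsProjectiveCover P 𝒩 Q π)
    (hK : IsGradedProjective B (subGr P.gr (LinearMap.ker π))) (hP : IsGradedProjective B P.gr)
    {Δ : PolyV B} (hΔ : evalAt l Δ ≠ 0) (hΔπ : ∀ v, π (Δ • v) = 0) {D δ m : ℤ}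
    (hsum : IsLefschetzSum l (subGr 𝒩 Q) δ) (hδ : δ ≤ 1 - D) (hm : 1 ≤ m) :
    (generatedLE (PolyV B) (subGr P.gr (LinearMap.ker π)) (D + m - 1)).map
        (LinearMap.ker π).subtype ⊓ generatedLE (PolyV B) P.gr (D - m) = ⊥ := by
  classical
  obtain ⟨n, d, e, he⟩ := hP.exists_basis
  obtain ⟨r, f, e', he'⟩ := hK.exists_basis
  have hπQ : ∀ v, π v ∈ Q := fun v => hπ.range_eq ▸ LinearMap.mem_range_self π v
  let k : Fin r → LinearMap.ker π := fun j => e' (Pi.single j 1)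
  -- The matrix of the inclusion of the kernel into `P`; its columns are the relations among the
  -- generators `q i` of `Q`.
  let A : Fin n → Fin r → PolyV B := fun i j => e.symm (k j).1 i
  let q : Fin n → Q := fun i => ⟨π (e (Pi.single i 1)), hπQ _⟩
  have hsumk : ∀ c : Fin r → PolyV B, ∀ i, e.symm (e' c).1 i = ∑ j, A i j * c j := by
    intro c i
    have h1 : e' c = ∑ j, c j • k j := by
      conv_lhs => rw [← Finset.univ_sum_single c, map_sum]
      refine Finset.sum_congr rfl fun j _ => ?_
      rw [← map_smul, ← Pi.single_smul', smul_eq_mul, mul_one]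
    rw [h1, Submodule.coe_sum, map_sum, Finset.sum_apply]
    refine Finset.sum_congr rfl fun j _ => ?_
    rw [Submodule.coe_smul, map_smul, Pi.smul_apply, smul_eq_mul, mul_comm]
  have hA : ∀ i j, A i j ∈ symGr B (f j - d i) := by
    intro i j
    have h1 : (k j).1 ∈ P.gr (f j) := (he' _ _).mp (single_mem f j)
    rw [← e.apply_symm_apply (k j).1, ← he] at h1
    exact mem_freeMod_gr.mp h1 i
  have hq : ∀ i, q i ∈ subGr 𝒩 Q (d i) := fun i =>
    hπ.isDegZero _ _ ((he _ _).mp (single_mem d i))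
  have hAq : ∀ j, ∑ i, A i j • q i = 0 := by
    intro j
    refine Subtype.ext ?_
    rw [Submodule.coe_sum]
    have h1 : (k j).1 = ∑ i, A i j • e (Pi.single i 1) := by
      conv_lhs => rw [← e.apply_symm_apply (k j).1, ← Finset.univ_sum_single (e.symm (k j).1),
        map_sum]
      refine Finset.sum_congr rfl fun i _ => ?_
      rw [← map_smul, ← Pi.single_smul', smul_eq_mul, mul_one]
    have h2 : π (k j).1 = 0 := (k j).2
    rw [h1, map_sum] at h2
    rw [← Submodule.coe_zero (p := Q)] at h2
    refine Eq.trans (Finset.sum_congr rfl fun i _ => ?_) h2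
    rw [map_smul]
    rfl
  have hχ : ∀ i, ∃ χ : Q →+ ℝ,
      (∀ (a : PolyV B) v, χ (a • v) = MvPolynomial.constantCoeff a * χ v) ∧
        ∀ i', χ (q i') = if i' = i then 1 else 0 := by
    intro i
    obtain ⟨χ, hχ, hχv⟩ := exists_coord hπ hK he i
    refine ⟨χ, hχ, fun i' => ?_⟩
    rw [hχv, e.symm_apply_apply, Pi.single_apply]
    split_ifs with h1 h2 h2
    · exact map_one _
    · exact absurd h1.symm h2
    · exact absurd h2.symm h1
    · exact map_zero _
  have hinj : ∀ γ : Fin r → ℝ, (∀ i, ∑ j, γ j * evalAt l (A i j) = 0) → γ = 0 := by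
    have hle : r ≤ n := le_of_fin_injective (PolyV B)
      (e.symm.toLinearMap ∘ₗ (LinearMap.ker π).subtype ∘ₗ e'.toLinearMap)
      (e.symm.injective.comp (Subtype.val_injective.comp e'.injective))
    let Aℓ : (Fin r → ℝ) →ₗ[ℝ] (Fin n → ℝ) :=
      Matrix.mulVecLin (Matrix.of fun i j => evalAt l (A i j))
    -- As `Δ P` is contained in the kernel, each vector `Δ b` is in the image of `A`; evaluate at
    -- `l` and divide by the non-zero number `Δ(l)`.
    have hsurj : Function.Surjective Aℓ := by
      intro b
      let c : Fin r → PolyV B := e'.symm ⟨Δ • e fun i => MvPolynomial.C (b i), hΔπ _⟩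
      refine ⟨fun j => (evalAt l Δ)⁻¹ * evalAt l (c j), ?_⟩
      funext i
      have h1 := hsumk c i
      rw [e'.apply_symm_apply, map_smul, e.symm_apply_apply, Pi.smul_apply, smul_eq_mul] at h1
      have h2 := congrArg (evalAt l) h1
      rw [map_mul, map_sum] at h2
      have h3 : evalAt l (MvPolynomial.C (b i)) = b i := MvPolynomial.eval_C _
      rw [h3] at h2
      change ∑ j, evalAt l (A i j) * ((evalAt l Δ)⁻¹ * evalAt l (c j)) = b i
      rw [← mul_right_inj' hΔ, h2, Finset.mul_sum]
      refine Finset.sum_congr rfl fun j _ => ?_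
      rw [map_mul]
      field_simp
    have hge : n ≤ r := le_of_fin_surjective ℝ Aℓ hsurj
    obtain rfl : r = n := le_antisymm hle hge
    have hinj : Function.Injective Aℓ := LinearMap.injective_iff_surjective.mpr hsurj
    intro γ hγ
    refine hinj (Eq.trans (funext fun i => ?_) (map_zero Aℓ).symm)
    exact (Finset.sum_congr rfl fun j _ => mul_comm _ _).trans (hγ i)
  rw [Submodule.eq_bot_iff]
  rintro v ⟨⟨v', hv', rfl⟩, hv⟩
  have hc : ∀ j, D + m - 1 < f j → e'.symm v' j = 0 :=
    fun j hj => coord_eq_zero_of_mem_generatedLE he' hv' hj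
  have hb : ∀ i, D - m < d i → ∑ j, A i j * e'.symm v' j = 0 := by
    intro i hi
    rw [← hsumk, e'.apply_symm_apply]
    exact coord_eq_zero_of_mem_generatedLE he hv hi
  -- Encodes both degree conditions as linear equations: the rows of `A` in degrees above `D - m`,
  -- and a unit row for every kernel generator of degree above `D + m - 1`.
  let A' : Matrix (Fin n ⊕ Fin r) (Fin r) (PolyV B) := fun s j => Sum.elim
    (fun i => if D - m < d i then A i j else 0)
    (fun j' => if j' = j ∧ D + m - 1 < f j then 1 else 0) s
  have hzero : e'.symm v' = 0 := by
    refine eq_zero_of_evalAt (l := l) A' (fun γ hγ => ?_) ?_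
    · refine hinj γ (sum_evalAt_eq_zero hA hq hAq hχ hsum hδ hm (fun j hj => ?_) fun i hi => ?_)
      · by_contra hlt
        have h1 := hγ (Sum.inr j)
        rw [Finset.sum_eq_single j] at h1
        · simp only [A', Sum.elim_inr, true_and, if_pos (not_le.mp hlt), map_one, one_mul] at h1
          exact hj h1
        · intro j' _ hne
          simp only [A', Sum.elim_inr, if_neg fun h : j = j' ∧ _ => hne h.1.symm, map_zero,
            zero_mul]
        · exact fun h => absurd (Finset.mem_univ _) h
      · have h1 := hγ (Sum.inl i)
        simp only [A', Sum.elim_inl, if_pos hi] at h1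
        rw [← h1]
        exact Finset.sum_congr rfl fun j _ => mul_comm _ _
    · rintro (i | j)
      · by_cases hi : D - m < d i
        · simp only [A', Sum.elim_inl, if_pos hi]
          exact hb i hi
        · simp only [A', Sum.elim_inl, if_neg hi, zero_mul, Finset.sum_const_zero]
      · refine Finset.sum_eq_zero fun j' _ => ?_
        by_cases hj : j = j' ∧ D + m - 1 < f j'
        · rw [hc j' hj.2, mul_zero]
        · simp only [A', Sum.elim_inr, if_neg hj, zero_mul]
  rw [← e'.apply_symm_apply v', hzero, map_zero]
  rfl

end Cover

variable {B : Type u} {W : Type v} [Group W] {M : CoxeterMatrix B} {cs : CoxeterSystem M W}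

/-- If `l` vanished on the root of `t`, then `t` would fix `l`, placing the line in the reflection
hyperplane. -/
lemma evalAt_label_ne_zero {l : Module.Dual ℝ (B →₀ ℝ)} (hl : cs.IsRegularLine l) {t : W}
    (ht : cs.IsReflection t) : evalAt l (cs.label t) ≠ 0 := by
  obtain ⟨β, hβ, e⟩ := exists_label_eq ht
  rw [e, evalAt_linearForm]
  intro h
  refine hl t ht (LinearMap.ext fun v => ?_)
  rw [Representation.dual_apply, ht.inv, Module.Dual.transpose_apply, LinearMap.comp_apply,
    hβ.apply_eq, map_sub, map_smul, h, smul_zero, sub_zero]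

namespace BruhatSheaf

/-- A product of labels annihilates the image of a stalk in the modules on the edges. -/
lemma IsBradenMacPherson.exists_upRestriction_smul_eq_zero [Finite B] {ℱ : cs.BruhatSheaf} {x : W}
    (hℱ : ℱ.IsBradenMacPherson x) {l : Module.Dual ℝ (B →₀ ℝ)} (hl : cs.IsRegularLine l) (y : W) :
    ∃ Δ : PolyV B, evalAt l Δ ≠ 0 ∧ ∀ v, ℱ.upRestriction y (Δ • v) = 0 := by
  classical
  have hfin : {E : cs.UpEdge y | cs.BruhatLE E.target x}.Finite :=
    (cs.finite_bruhatLE x).preimage fun _ _ _ _ h => UpEdge.target_injective h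
  -- Each edge module is annihilated by its label. Only the finitely many edges with end point below
  -- `x` matter, since all other edge modules are zero.
  refine ⟨∏ E ∈ hfin.toFinset, cs.label E.1, ?_, fun v => funext fun E => ?_⟩
  · rw [map_prod]
    exact Finset.prod_ne_zero_iff.mpr fun E _ => evalAt_label_ne_zero hl E.2.1
  · change ℱ.ρ y E _ = 0
    by_cases hE : cs.BruhatLE E.target x
    · obtain ⟨b, hb⟩ := Submodule.mkQ_surjective (cs.labelSMul E.1 (ℱ.stalk E.target)) (ℱ.ρ y E v)
      rw [map_smul, ← hb, ← map_smul]
      change ℱ.toEdge E _ = 0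
      rw [toEdge_eq_zero_iff, ← Finset.mul_prod_erase _ _ (hfin.mem_toFinset.mpr hE)]
      exact ⟨_, mul_smul _ _ _⟩
    · have := hℱ.eq_zero _ hE
      have : Subsingleton (ℱ.edge E) :=
        (Submodule.mkQ_surjective (cs.labelSMul E.1 (ℱ.stalk E.target))).subsingleton
      exact Subsingleton.elim _ _

end BruhatSheaf

end CoxeterSystem

theorem mainTheorem2 {B W : Type*} [Finite B] [Group W] {M : CoxeterMatrix B}
    (cs : CoxeterSystem M W)
    -- a line in `V*` that is not contained in any reflection hyperplane
    (l : Module.Dual ℝ (B →₀ ℝ)) (hl : cs.IsRegularLine l)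
    -- the sheaf `ℬ(x)` and an element `y < x`
    (x y : W) (hyx : cs.BruhatLT y x)
    (ℬ : cs.BruhatSheaf) (hℬ : ℬ.IsBradenMacPherson x)
    -- `ℬ(x)^{δy}_T` is a direct sum of modules `(ℝ[T] / T^{n+1}){-(l(x) - l(y)) + n + c}`
    (c : ℤ) (hc : c = 0 ∨ c = 1)
    (hsum : CoxeterSystem.IsLefschetzSum l (subGr (ℬ.edgesGr y) (ℬ.boundary y))
      (-((cs.length x : ℤ) - (cs.length y : ℤ)) + c)) :
    ∀ m : ℤ, 1 ≤ m →
      (generatedLE (CoxeterSystem.PolyV B) (subGr (ℬ.stalk y).gr (ℬ.costalk y))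
          ((cs.length x : ℤ) - (cs.length y : ℤ) + m - 1)).map (ℬ.costalk y).subtype ⊓
        generatedLE (CoxeterSystem.PolyV B) (ℬ.stalk y).gr
          ((cs.length x : ℤ) - (cs.length y : ℤ) - m) = ⊥ := by
  intro m hm
  -- The general bound applies with shift `δ = -D + c`, where `c ≤ 1` gives `δ ≤ 1 - D`.
  obtain ⟨Δ, hΔ, hΔπ⟩ := hℬ.exists_upRestriction_smul_eq_zero hl y
  exact CoxeterSystem.generatedLE_inf_eq_bot (hℬ.cover y hyx) (hℬ.isGradedProjective_costalk y)
    (hℬ.isGradedProjective y) hΔ hΔπ hsum (by rcases hc with rfl | rfl <;> omega) hm
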